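/- Let $\hat f(\xi)=\frac1{\sqrt{2\pi}}\int_{\mathbb R}e^{-i\xi x}f(x)\,dx$ and $2^{\mathbb N}=\{1,2,4,8,\dots\}$, and let $\log$ be the natural logarithm. For $\kappa_0>0$ and $f\in\mathcal S(\mathbb R;\mathbb C)$ put $$\|f\|_{Y_{\kappa_0}}=\max\Bigl\{\kappa_0^{-1/2}\|\hat f\|_{L^2(|\xi|\le\kappa_0)},\ \sup_{N\in2^{\mathbb N}}(\kappa_0N)^{-1/2}\log^2(2N)\,\|\hat f\|_{L^2(N\kappa_0<|\xi|\le2N\kappa_0)}\Bigr\},$$ $$\|f\|_{X_{\kappa_0}}^2=\kappa_0^{-1}\|\hat f\|_{L^2(|\xi|\le\kappa_0)}^2+\sum_{N\in2^{\mathbb N}}\frac{\log^3(2N)}{\kappa_0N}\,\|\hat f\|_{L^2(N\kappa_0<|\xi|\le2N\kappa_0)}^2 .$$ There are absolute constants $c,C>0$ with the following property. Let $\kappa_0>0$, and let $q$ be a global complex-valued Schwartz solution on $\mathbb R$ (that is, $t\mapsto q(t)$ is a continuous map from $\mathbb R$ to $\mathcal S(\mathbb R;\mathbb C)$ and the equation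 holds at every $(t,x)\in\mathbb R^2$), for either choice of sign, of $$-i\,\partial_tq=-q''\pm2|q|^2q\quad\text{(NLS)}\qquad\text{or}\qquad \partial_tq=-q'''\pm6|q|^2q'\quad\text{(Hirota mKdV)},$$ where primes denote derivatives in $x$. If $\|q(0)\|_{Y_{\kappa_0}}\le c$, then $$C^{-1}\|q(0)\|_{Y_{\kappa_0}}\le\sup_{t\in\mathbb R}\|q(t)\|_{Y_{\kappa_0}}\le C\|q(0)\|_{Y_{\kappa_0}},$$ and if $\|q(0)\|_{X_{\kappa_0}}\le c$, then $$C^{-1}\|q(0)\|_{X_{\kappa_0}}\le\sup_{t\in\mathbb R}\|q(t)\|_{X_{\kappa_0}}\le C\|q(0)\|_{X_{\kappa_0}}.$$ -/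

import Mathlib

open MeasureTheory
open scoped SchwartzMap ENNReal

noncomputable section

/-- The Fourier transform on the line in the unitary normalization with angular frequency,
`f̂(ξ) = (2π)^(-1/2) ∫ e^(-iξx) f(x) dx`. -/
def fourierHat (f : ℝ → ℂ) (ξ : ℝ) : ℂ :=
  ((1 / Real.sqrt (2 * Real.pi) : ℝ) : ℂ) *
    ∫ x : ℝ, Complex.exp (-(Complex.I * (ξ : ℂ) * (x : ℂ))) * f x

/-- `‖f̂(ξ)‖_{L²(|ξ| ≤ κ₀)}`. -/
def lowFreqNorm (κ₀ : ℝ) (f : ℝ → ℂ) : ℝ≥0∞ :=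
  eLpNorm (fourierHat f) 2 (volume.restrict {ξ : ℝ | |ξ| ≤ κ₀})

/-- `‖f̂(ξ)‖_{L²(N κ₀ < |ξ| ≤ 2 N κ₀)}`. -/
def dyadicNorm (κ₀ N : ℝ) (f : ℝ → ℂ) : ℝ≥0∞ :=
  eLpNorm (fourierHat f) 2 (volume.restrict {ξ : ℝ | N * κ₀ < |ξ| ∧ |ξ| ≤ 2 * N * κ₀})

/-- The norm `Y_{κ₀}`, with values in `[0, ∞]`. The dyadic numbers `N = 1, 2, 4, …` are
written as `2 ^ k` with `k : ℕ`. -/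
def normY (κ₀ : ℝ) (f : ℝ → ℂ) : ℝ≥0∞ :=
  max (ENNReal.ofReal (κ₀ ^ (-(1 / 2) : ℝ)) * lowFreqNorm κ₀ f)
    (⨆ k : ℕ, ENNReal.ofReal
        ((κ₀ * (2 : ℝ) ^ k) ^ (-(1 / 2) : ℝ) * Real.log (2 * (2 : ℝ) ^ k) ^ 2) *
      dyadicNorm κ₀ ((2 : ℝ) ^ k) f)

/-- The norm `X_{κ₀}`, with values in `[0, ∞]`: the square root of the sum defining its square. -/
def normX (κ₀ : ℝ) (f : ℝ → ℂ) : ℝ≥0∞ :=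
  (ENNReal.ofReal κ₀⁻¹ * lowFreqNorm κ₀ f ^ 2 +
    ∑' k : ℕ, ENNReal.ofReal (Real.log (2 * (2 : ℝ) ^ k) ^ 3 / (κ₀ * (2 : ℝ) ^ k)) *
      dyadicNorm κ₀ ((2 : ℝ) ^ k) f ^ 2) ^ (1 / 2 : ℝ)

/-- A global Schwartz solution of `-i ∂ₜ q = -q'' ± 2 |q|² q` on the line: a continuous curve in
Schwartz space satisfying the equation at every point. The unit `σ = ±1` is the sign. -/
structure IsSchwartzSolutionNLS (σ : ℤˣ) (q : ℝ → 𝓢(ℝ, ℂ)) : Prop where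
  continuous : Continuous q
  differentiableAt : ∀ t x : ℝ, DifferentiableAt ℝ (fun s : ℝ => q s x) t
  equation : ∀ t x : ℝ,
    -Complex.I * deriv (fun s : ℝ => q s x) t =
      -iteratedDeriv 2 (fun y : ℝ => q t y) x
        + ((σ : ℤ) : ℂ) * (2 * ((‖q t x‖ ^ 2 : ℝ) : ℂ) * q t x)

/-- A global Schwartz solution of Hirota's `∂ₜ q = -q''' ± 6 |q|² q'` on the line: a continuous
curve in Schwartz space satisfying the equation at every point. The unit `σ = ±1` is the sign. -/
structure IsSchwartzSolutionHmKdV (σ : ℤˣ) (q : ℝ → 𝓢(ℝ, ℂ)) : Prop where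
  continuous : Continuous q
  differentiableAt : ∀ t x : ℝ, DifferentiableAt ℝ (fun s : ℝ => q s x) t
  equation : ∀ t x : ℝ,
    deriv (fun s : ℝ => q s x) t =
      -iteratedDeriv 3 (fun y : ℝ => q t y) x
        + ((σ : ℤ) : ℂ) * (6 * ((‖q t x‖ ^ 2 : ℝ) : ℂ) * deriv (fun y : ℝ => q t y) x)

end

noncomputable section

open scoped FourierTransform

/-! Both equations belong to the AKNS hierarchy, so for each κ > 0 the transmission coefficient of
the spectral problem is preserved. With ε = ±1 the sign, the quotient r of the two components of a
Jost solution solves the Riccati equation r' + 2κr = q − ε q̄ r², and ∫ ε q̄ r (`jostEnergy`) is the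
logarithm of that coefficient. Replacing r by the linear solution shows that ε Re ∫ ε q̄ r equals ∫
2κ|q̂|²/(4κ² + ξ²) plus a quartic error (`jostEnergy_expansion`). The main term is a Lorentzian
average of |q̂|² which sees |ξ| ≈ κ. Taking κ = κ₀2^m for all m recovers every dyadic shell, hence
both norms, as long as the quartic error is summable with the same weights.

The regularity is scaling critical, and the logarithms rescue the estimates. The weight `wK` is (1 +
log(1 + |ξ|/k))/(k + |ξ|)^{1/2} in angular frequency, with k = 2κ; `wZ` is one derivative better,
and `wM` = 1/`wZ` is square integrable only because of its logarithm. Hence the `wZ` norm controls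
the sup norm of r, and multiplication by r is bounded on the `wK` and `wH` spaces (`wnorm_conv_le`).
If the `wK` norm of q̂ is at most 1/100, a contraction solves the Riccati equation
(`exists_isRiccati`), together with the mirror equation for p, and solutions depend Lipschitz
continuously on q (`IsRiccati.wnorm_sub_le`).

Conservation is proved without differentiating r in time. Integrating the derivative of log(1 + pr),
with p and r belonging to two different potentials, gives an exact formula for the difference of two
energies in terms of the difference of the potentials (`jostEnergy_sub`). Its infinitesimal version
is the integral of an exact derivative by the zero-curvature equation
(`ZeroCurvature.integral_eq_zero`), so the energy is constant on time intervals where q is small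
(`IsLaxFlow.jostEnergy_eq`).

The quartic error at scale m is at most a constant times ‖q̂‖²_`wH` ‖q̂‖²_`wK`. For Y the squared
norm carries (m+1)⁴: three powers go to the `wH` factor and one to the `wK` factor. For X the split
is 3 = 2 + 1. This gives N(t) ≤ C(N(0) + N(0)² + N(t)²) while N stays small
(`specY_almost_conserved`, `specX_almost_conserved`), and a continuity argument in time
(`bootstrap`) removes the smallness hypothesis. The lower bounds of the theorem come from t = 0. -/

/-! ### A weighted Young inequality. -/

lemma sq_lintegral_mul_le {α : Type*} [MeasurableSpace α] (μ : Measure α) {f g : α → ℝ≥0∞}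
    (hf : AEMeasurable f μ) (hg : AEMeasurable g μ) :
    (∫⁻ a, f a * g a ∂μ) ^ 2 ≤ (∫⁻ a, f a ^ 2 ∂μ) * ∫⁻ a, g a ^ 2 ∂μ := by
  have h := ENNReal.lintegral_mul_le_Lp_mul_Lq μ Real.HolderConjugate.two_two hf hg
  simp only [Pi.mul_apply] at h
  have h2 := pow_le_pow_left₀ (zero_le (a := _)) h 2
  refine h2.trans (le_of_eq ?_)
  rw [mul_pow, ← ENNReal.rpow_natCast, ← ENNReal.rpow_natCast, ← ENNReal.rpow_mul,
    ← ENNReal.rpow_mul]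
  norm_num

lemma ENNReal.add_three_sq_le (a b c : ℝ≥0∞) :
    (a + b + c) ^ 2 ≤ 3 * (a ^ 2 + b ^ 2 + c ^ 2) := by
  by_cases ha : a = ⊤
  · simp [ha]
  by_cases hb : b = ⊤
  · simp [hb]
  by_cases hc : c = ⊤
  · simp [hc]
  lift a to NNReal using ha
  lift b to NNReal using hb
  lift c to NNReal using hc
  norm_cast
  rw [← NNReal.coe_le_coe]
  push_cast
  nlinarith [sq_nonneg ((a:ℝ) - b), sq_nonneg ((a:ℝ) - c), sq_nonneg ((b:ℝ) - c)]

/-- Weighted Young inequality: if the weight `u` is, up to a square integrable factor in one of the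
three variables, dominated by `u ⊗ v`, then convolution maps `L²(u) × L²(v)` to `L²(u)`. -/
lemma lintegral_weight_conv_sq_le {u v ν G R : ℝ → ℝ≥0∞} (hu : Measurable u) (hv : Measurable v)
    (hν : Measurable ν) (hG : Measurable G) (hR : Measurable R) {c : ℝ≥0∞}
    (hk : ∀ ξ η, u ξ ≤ c * (ν ξ + ν (ξ - η) + ν η) * (u (ξ - η) * v η)) :
    ∫⁻ ξ, (u ξ * ∫⁻ η, G (ξ - η) * R η) ^ 2 ≤
      9 * c ^ 2 * (∫⁻ ξ, ν ξ ^ 2) * (∫⁻ ξ, (u ξ * G ξ) ^ 2) * ∫⁻ ξ, (v ξ * R ξ) ^ 2 := by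
  set g : ℝ → ℝ≥0∞ := fun ξ => u ξ * G ξ with hgdef
  set r : ℝ → ℝ≥0∞ := fun ξ => v ξ * R ξ with hrdef
  have hg : Measurable g := hu.mul hG
  have hr : Measurable r := hv.mul hR
  have hgs : ∀ ξ : ℝ, Measurable fun η => g (ξ - η) := fun ξ => hg.comp (measurable_const.sub measurable_id)
  have hνs : ∀ ξ : ℝ, Measurable fun η => ν (ξ - η) := fun ξ => hν.comp (measurable_const.sub measurable_id)
  have hg2 : Measurable fun p : ℝ × ℝ => g (p.1 - p.2) := hg.comp (measurable_fst.sub measurable_snd)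
  have hν2 : Measurable fun p : ℝ × ℝ => ν (p.1 - p.2) := hν.comp (measurable_fst.sub measurable_snd)
  have hr2 : Measurable fun p : ℝ × ℝ => r p.2 := hr.comp measurable_snd
  set I1 : ℝ → ℝ≥0∞ := fun ξ => ∫⁻ η, ν ξ * (g (ξ - η) * r η) with hI1
  set I2 : ℝ → ℝ≥0∞ := fun ξ => ∫⁻ η, ν (ξ - η) * (g (ξ - η) * r η) with hI2
  set I3 : ℝ → ℝ≥0∞ := fun ξ => ∫⁻ η, ν η * (g (ξ - η) * r η) with hI3
  have hI1m : Measurable I1 := Measurable.lintegral_prod_right'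
    (f := fun p : ℝ × ℝ => ν p.1 * (g (p.1 - p.2) * r p.2)) ((hν.comp measurable_fst).mul (hg2.mul hr2))
  have hI2m : Measurable I2 := Measurable.lintegral_prod_right'
    (f := fun p : ℝ × ℝ => ν (p.1 - p.2) * (g (p.1 - p.2) * r p.2)) (hν2.mul (hg2.mul hr2))
  have hI3m : Measurable I3 := Measurable.lintegral_prod_right'
    (f := fun p : ℝ × ℝ => ν p.2 * (g (p.1 - p.2) * r p.2)) ((hν.comp measurable_snd).mul (hg2.mul hr2))
  have hpt : ∀ ξ, u ξ * ∫⁻ η, G (ξ - η) * R η ≤ c * (I1 ξ + I2 ξ + I3 ξ) := by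
    intro ξ
    have m1 : Measurable fun η => ν ξ * (g (ξ - η) * r η) := ((hgs ξ).mul hr).const_mul _
    have m2 : Measurable fun η => ν (ξ - η) * (g (ξ - η) * r η) := (hνs ξ).mul ((hgs ξ).mul hr)
    have m3 : Measurable fun η => ν η * (g (ξ - η) * r η) := hν.mul ((hgs ξ).mul hr)
    have hs : I1 ξ + I2 ξ + I3 ξ = ∫⁻ η, (ν ξ * (g (ξ - η) * r η) + ν (ξ - η) * (g (ξ - η) * r η)
        + ν η * (g (ξ - η) * r η)) := by
      rw [lintegral_add_right _ m3, lintegral_add_right _ m2]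
    rw [hs, ← lintegral_const_mul _ (by fun_prop), ← lintegral_const_mul _ (by fun_prop)]
    refine lintegral_mono fun η => ?_
    calc u ξ * (G (ξ - η) * R η)
        ≤ c * (ν ξ + ν (ξ - η) + ν η) * (u (ξ - η) * v η) * (G (ξ - η) * R η) := by
          gcongr; exact hk ξ η
      _ = _ := by simp only [hgdef, hrdef]; ring
  have hshift : ∀ (f : ℝ → ℝ≥0∞) (ξ : ℝ), ∫⁻ η, f (ξ - η) = ∫⁻ η, f η := fun f ξ =>
    lintegral_sub_left_eq_self f ξ
  have hconv : ∫⁻ ξ, ∫⁻ η, g (ξ - η) ^ 2 * r η ^ 2 = (∫⁻ ξ, g ξ ^ 2) * ∫⁻ ξ, r ξ ^ 2 := by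
    rw [lintegral_lintegral_swap ((hg2.pow_const 2).mul (hr2.pow_const 2)).aemeasurable]
    have : ∀ η, ∫⁻ ξ, g (ξ - η) ^ 2 * r η ^ 2 = (∫⁻ ξ, g ξ ^ 2) * r η ^ 2 := by
      intro η
      rw [lintegral_mul_const _ (by fun_prop),
        lintegral_sub_right_eq_self (fun ξ => g ξ ^ 2) η]
    simp_rw [this]
    rw [lintegral_const_mul _ (by fun_prop)]
  set M := ∫⁻ ξ, ν ξ ^ 2
  set Gn := ∫⁻ ξ, g ξ ^ 2
  set Rn := ∫⁻ ξ, r ξ ^ 2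
  -- With ν in the output variable, Cauchy–Schwarz in η separates g from r and ν is integrated last.
  -- With ν in an input variable (`e2`, `e3`), Cauchy–Schwarz separates ν from the product g r, and
  -- Fubini finishes.
  have e1 : ∫⁻ ξ, I1 ξ ^ 2 ≤ M * Gn * Rn := by
    have : ∀ ξ, I1 ξ ^ 2 ≤ ν ξ ^ 2 * (Gn * Rn) := by
      intro ξ
      rw [hI1]; simp only
      rw [lintegral_const_mul _ (by fun_prop), mul_pow]
      gcongr
      refine (sq_lintegral_mul_le _ (hgs ξ).aemeasurable hr.aemeasurable).trans (le_of_eq ?_)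
      rw [hshift (fun η => g η ^ 2) ξ]
    refine (lintegral_mono this).trans (le_of_eq ?_)
    rw [lintegral_mul_const _ (by fun_prop), mul_assoc]
  have e2 : ∫⁻ ξ, I2 ξ ^ 2 ≤ M * Gn * Rn := by
    have : ∀ ξ, I2 ξ ^ 2 ≤ M * ∫⁻ η, g (ξ - η) ^ 2 * r η ^ 2 := by
      intro ξ
      refine (sq_lintegral_mul_le _ (hνs ξ).aemeasurable ((hgs ξ).mul hr).aemeasurable).trans
        (le_of_eq ?_)
      rw [hshift (fun η => ν η ^ 2) ξ]
      simp only [Pi.mul_apply, mul_pow, M]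
    refine (lintegral_mono this).trans (le_of_eq ?_)
    rw [lintegral_const_mul _ (Measurable.lintegral_prod_right'
      (f := fun p : ℝ × ℝ => g (p.1 - p.2) ^ 2 * r p.2 ^ 2)
      ((hg2.pow_const 2).mul (hr2.pow_const 2))), hconv, mul_assoc]
  have e3 : ∫⁻ ξ, I3 ξ ^ 2 ≤ M * Gn * Rn := by
    have : ∀ ξ, I3 ξ ^ 2 ≤ M * ∫⁻ η, g (ξ - η) ^ 2 * r η ^ 2 := by
      intro ξ
      refine (sq_lintegral_mul_le _ hν.aemeasurable ((hgs ξ).mul hr).aemeasurable).trans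
        (le_of_eq ?_)
      simp only [Pi.mul_apply, mul_pow, M]
    refine (lintegral_mono this).trans (le_of_eq ?_)
    rw [lintegral_const_mul _ (Measurable.lintegral_prod_right'
      (f := fun p : ℝ × ℝ => g (p.1 - p.2) ^ 2 * r p.2 ^ 2)
      ((hg2.pow_const 2).mul (hr2.pow_const 2))), hconv, mul_assoc]
  calc ∫⁻ ξ, (u ξ * ∫⁻ η, G (ξ - η) * R η) ^ 2
      ≤ ∫⁻ ξ, c ^ 2 * 3 * (I1 ξ ^ 2 + I2 ξ ^ 2 + I3 ξ ^ 2) := by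
        refine lintegral_mono fun ξ => ?_
        refine (pow_le_pow_left₀ zero_le (hpt ξ) 2).trans ?_
        rw [mul_pow, mul_assoc]
        gcongr
        exact ENNReal.add_three_sq_le _ _ _
    _ = c ^ 2 * 3 * ((∫⁻ ξ, I1 ξ ^ 2) + (∫⁻ ξ, I2 ξ ^ 2) + ∫⁻ ξ, I3 ξ ^ 2) := by
        rw [lintegral_const_mul _ (by fun_prop), lintegral_add_left (by fun_prop),
          lintegral_add_left (by fun_prop)]
    _ ≤ c ^ 2 * 3 * (M * Gn * Rn + M * Gn * Rn + M * Gn * Rn) := by gcongr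
    _ = 9 * c ^ 2 * M * Gn * Rn := by ring

/-! ### Frequency weights and their product inequalities. -/

/-- The inhomogeneous frequency `1 + 2π|ξ|/k`. -/
def freqH (k ξ : ℝ) : ℝ := 1 + 2 * Real.pi * |ξ| / k

/-- The logarithmic weight `1 + log (1 + 2π|ξ|/k)`. -/
def freqL (k ξ : ℝ) : ℝ := 1 + Real.log (freqH k ξ)

/-- The weight, comparable to `(k + |ξ|)^(-1/2)`, of the space controlling the quadratic energy. -/
def wH (k ξ : ℝ) : ℝ := 1 / Real.sqrt (k * freqH k ξ)

/-- The weight of the space in which the potential is required to be small. -/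
def wK (k ξ : ℝ) : ℝ := freqL k ξ / Real.sqrt (k * freqH k ξ)

/-- The weight of the space in which the Riccati equation is solved, one derivative better than
`wK`. -/
def wZ (k ξ : ℝ) : ℝ := freqL k ξ * Real.sqrt (k * freqH k ξ)

/-- The reciprocal of `wZ`, a square integrable weight. -/
def wM (k ξ : ℝ) : ℝ := 1 / wZ k ξ

lemma one_le_freqH {k : ℝ} (hk : 0 < k) (ξ : ℝ) : 1 ≤ freqH k ξ := by
  have : 0 ≤ 2 * Real.pi * |ξ| / k := by positivity
  unfold freqH; linarith

lemma one_le_freqL {k : ℝ} (hk : 0 < k) (ξ : ℝ) : 1 ≤ freqL k ξ := by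
  have := Real.log_nonneg (one_le_freqH hk ξ)
  unfold freqL; linarith

lemma sqrt_freqH_pos {k : ℝ} (hk : 0 < k) (ξ : ℝ) : 0 < Real.sqrt (k * freqH k ξ) := by
  have := one_le_freqH hk ξ
  positivity

lemma wH_pos {k : ℝ} (hk : 0 < k) (ξ : ℝ) : 0 < wH k ξ := by
  have := sqrt_freqH_pos hk ξ
  unfold wH; positivity

lemma wK_pos {k : ℝ} (hk : 0 < k) (ξ : ℝ) : 0 < wK k ξ := by
  have := sqrt_freqH_pos hk ξ
  have := one_le_freqL hk ξ
  unfold wK; positivity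

lemma wZ_pos {k : ℝ} (hk : 0 < k) (ξ : ℝ) : 0 < wZ k ξ := by
  have := sqrt_freqH_pos hk ξ
  have := one_le_freqL hk ξ
  unfold wZ; positivity

lemma wM_pos {k : ℝ} (hk : 0 < k) (ξ : ℝ) : 0 < wM k ξ := by
  have := wZ_pos hk ξ
  unfold wM; positivity

lemma continuous_freqH (k : ℝ) : Continuous (freqH k) := by unfold freqH; fun_prop

lemma continuous_freqL {k : ℝ} (hk : 0 < k) : Continuous (freqL k) := by
  unfold freqL
  refine continuous_const.add ((continuous_freqH k).log fun ξ => ?_)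
  have := one_le_freqH hk ξ
  positivity

lemma continuous_wZ {k : ℝ} (hk : 0 < k) : Continuous (wZ k) := by
  unfold wZ
  have := continuous_freqL hk
  have := continuous_freqH k
  fun_prop

lemma continuous_wM {k : ℝ} (hk : 0 < k) : Continuous (wM k) :=
  continuous_const.div (continuous_wZ hk) fun ξ => (wZ_pos hk ξ).ne'

lemma continuous_wK {k : ℝ} (hk : 0 < k) : Continuous (wK k) := by
  have := continuous_freqH k
  exact (continuous_freqL hk).div (by fun_prop) fun ξ => (sqrt_freqH_pos hk ξ).ne'

lemma continuous_wH {k : ℝ} (hk : 0 < k) : Continuous (wH k) := by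
  have := continuous_freqH k
  exact continuous_const.div (by fun_prop) fun ξ => (sqrt_freqH_pos hk ξ).ne'

lemma freqH_neg (k ξ : ℝ) : freqH k (-ξ) = freqH k ξ := by simp [freqH]
lemma wH_neg (k ξ : ℝ) : wH k (-ξ) = wH k ξ := by simp [wH, freqH_neg]
lemma wK_neg (k ξ : ℝ) : wK k (-ξ) = wK k ξ := by simp [wK, freqL, freqH_neg]

lemma freqH_triangle {k : ℝ} (hk : 0 < k) {x y z : ℝ} (h : |x| ≤ |y| + |z|) :
    freqH k x ≤ freqH k y + freqH k z := by
  have : 2 * Real.pi * |x| / k ≤ 2 * Real.pi * |y| / k + 2 * Real.pi * |z| / k := by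
    rw [← add_div, ← mul_add]; gcongr
  unfold freqH; linarith

lemma sqrt_freqH_mono {k : ℝ} (hk : 0 < k) {x y : ℝ} (h : freqH k x ≤ freqH k y) :
    Real.sqrt (k * freqH k x) ≤ Real.sqrt (k * freqH k y) := by gcongr

lemma freqL_mono {k : ℝ} (hk : 0 < k) {x y : ℝ} (h : freqH k x ≤ freqH k y) :
    freqL k x ≤ freqL k y := by
  have := one_le_freqH hk x
  unfold freqL
  gcongr

lemma sqrt_freqH_double {k : ℝ} (hk : 0 < k) {x y : ℝ} (h : freqH k x ≤ 2 * freqH k y) :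
    Real.sqrt (k * freqH k x) ≤ 2 * Real.sqrt (k * freqH k y) := by
  have := one_le_freqH hk y
  rw [Real.sqrt_le_left (by positivity), mul_pow, Real.sq_sqrt (by positivity)]
  nlinarith

lemma freqL_double {k : ℝ} (hk : 0 < k) {x y : ℝ} (h : freqH k x ≤ 2 * freqH k y) :
    freqL k x ≤ 2 * freqL k y := by
  have hx := one_le_freqH hk x
  have hy := one_le_freqH hk y
  have h1 : Real.log (freqH k x) ≤ Real.log 2 + Real.log (freqH k y) := by
    rw [← Real.log_mul (by norm_num) (by positivity)]
    gcongr
  have h2 := Real.log_two_lt_d9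
  have h3 := Real.log_nonneg hy
  unfold freqL; linarith

/-- Each of the three frequencies is at most the sum of the other two, so the larger two agree up to
a factor 2. The cases record which variable may be taken as the small one: η, ξ − η or ξ. Only the
inequalities used afterwards are kept. -/
lemma weight_cases {k : ℝ} (hk : 0 < k) (ξ η : ℝ) :
    (freqH k ξ ≤ 2 * freqH k (ξ - η) ∧ freqH k (ξ - η) ≤ 2 * freqH k ξ) ∨
    (freqH k ξ ≤ 2 * freqH k η ∧ freqH k (ξ - η) ≤ freqH k ξ ∧ freqH k (ξ - η) ≤ freqH k η) ∨
    (freqH k (ξ - η) ≤ 2 * freqH k η ∧ freqH k ξ ≤ freqH k (ξ - η) ∧ freqH k ξ ≤ freqH k η) := by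
  have h1 : freqH k ξ ≤ freqH k (ξ - η) + freqH k η :=
    freqH_triangle hk (by simpa using abs_add_le (ξ - η) η)
  have h2 : freqH k (ξ - η) ≤ freqH k ξ + freqH k η := freqH_triangle hk (abs_sub ξ η)
  rcases le_total (freqH k ξ) (freqH k η) with h | h <;>
  rcases le_total (freqH k (ξ - η)) (freqH k η) with h' | h' <;>
  rcases le_total (freqH k ξ) (freqH k (ξ - η)) with h'' | h'' <;> grind

/-- The square integrable factor `wM` is put on the variable singled out by `weight_cases`. The
critical case is high × high → low: there the output weight contains one logarithm and `wM` at ξ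
costs another, and these are paid by the logarithms in `wK` at ξ − η and in `wZ` at η. -/
lemma wK_le_mul {k : ℝ} (hk : 0 < k) (ξ η : ℝ) :
    wK k ξ ≤ 4 * (wM k ξ + wM k (ξ - η) + wM k η) * (wK k (ξ - η) * wZ k η) := by
  have m1 := wM_pos hk ξ
  have m2 := wM_pos hk (ξ - η)
  have m3 := wM_pos hk η
  have hD : 0 < wK k (ξ - η) * wZ k η := mul_pos (wK_pos hk _) (wZ_pos hk _)
  have hA := sqrt_freqH_pos hk ξ
  have hB := sqrt_freqH_pos hk (ξ - η)
  have hC := sqrt_freqH_pos hk η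
  have lA := one_le_freqL hk ξ
  have lB := one_le_freqL hk (ξ - η)
  have lC := one_le_freqL hk η
  rcases weight_cases hk ξ η with ⟨h1, h2⟩ | ⟨h1, h2, h3⟩ | ⟨h1, h2, h3⟩
  · have e1 := freqL_double hk h1
    have e2 := sqrt_freqH_double hk h2
    have : wK k ξ ≤ 4 * wM k η * (wK k (ξ - η) * wZ k η) := by
      unfold wK wM wZ
      field_simp
      nlinarith
    refine this.trans ?_
    gcongr
    linarith
  · have e1 := freqL_double hk h1
    have e2 := sqrt_freqH_mono hk h2
    have e3 := sqrt_freqH_mono hk h3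
    have : wK k ξ ≤ 4 * wM k (ξ - η) * (wK k (ξ - η) * wZ k η) := by
      unfold wK wM wZ
      field_simp
      calc freqL k ξ * Real.sqrt (k * freqH k (ξ - η)) ^ 2
          ≤ (2 * freqL k η) * (Real.sqrt (k * freqH k ξ) * Real.sqrt (k * freqH k η)) := by
            rw [sq]; gcongr
        _ ≤ _ := by nlinarith [mul_pos (mul_pos hA hC) (zero_lt_one.trans_le lC)]
    refine this.trans ?_
    gcongr
    linarith
  · have e1 := freqL_mono hk h2
    have e1' := freqL_mono hk h3
    have e3 := sqrt_freqH_double hk h1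
    have : wK k ξ ≤ 4 * wM k ξ * (wK k (ξ - η) * wZ k η) := by
      unfold wK wM wZ
      field_simp
      calc freqL k ξ ^ 2 * Real.sqrt (k * freqH k (ξ - η))
          ≤ (freqL k (ξ - η) * freqL k η) * (2 * Real.sqrt (k * freqH k η)) := by
            rw [sq]; gcongr
        _ ≤ _ := by
          nlinarith [mul_pos (mul_pos (zero_lt_one.trans_le lB) hC) (zero_lt_one.trans_le lC)]
    refine this.trans ?_
    gcongr
    linarith

/-- The same trichotomy. Since the output weight has no logarithm, the single one in `wZ` pays for
`wM`. -/
lemma wH_le_mul {k : ℝ} (hk : 0 < k) (ξ η : ℝ) :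
    wH k ξ ≤ 4 * (wM k ξ + wM k (ξ - η) + wM k η) * (wH k (ξ - η) * wZ k η) := by
  have m1 := wM_pos hk ξ
  have m2 := wM_pos hk (ξ - η)
  have m3 := wM_pos hk η
  have hD : 0 < wH k (ξ - η) * wZ k η := mul_pos (wH_pos hk _) (wZ_pos hk _)
  have hA := sqrt_freqH_pos hk ξ
  have hB := sqrt_freqH_pos hk (ξ - η)
  have hC := sqrt_freqH_pos hk η
  have lA := one_le_freqL hk ξ
  have lB := one_le_freqL hk (ξ - η)
  have lC := one_le_freqL hk η
  rcases weight_cases hk ξ η with ⟨h1, h2⟩ | ⟨h1, h2, h3⟩ | ⟨h1, h2, h3⟩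
  · have e2 := sqrt_freqH_double hk h2
    have : wH k ξ ≤ 4 * wM k η * (wH k (ξ - η) * wZ k η) := by
      unfold wH wM wZ
      field_simp
      linarith
    refine this.trans ?_
    gcongr
    linarith
  · have e1 := freqL_mono hk h3
    have e2 := sqrt_freqH_mono hk h2
    have e3 := sqrt_freqH_mono hk h3
    have : wH k ξ ≤ 4 * wM k (ξ - η) * (wH k (ξ - η) * wZ k η) := by
      unfold wH wM wZ
      field_simp
      calc freqL k (ξ - η) * Real.sqrt (k * freqH k (ξ - η)) ^ 2
          ≤ freqL k η * (Real.sqrt (k * freqH k ξ) * Real.sqrt (k * freqH k η)) := by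
            rw [sq]; gcongr
        _ ≤ _ := by nlinarith [mul_pos (mul_pos hA hC) (zero_lt_one.trans_le lC)]
    refine this.trans ?_
    gcongr
    linarith
  · have e1' := freqL_mono hk h3
    have e3 := sqrt_freqH_double hk h1
    have : wH k ξ ≤ 4 * wM k ξ * (wH k (ξ - η) * wZ k η) := by
      unfold wH wM wZ
      field_simp
      calc freqL k ξ * Real.sqrt (k * freqH k (ξ - η))
          ≤ freqL k η * (2 * Real.sqrt (k * freqH k η)) := by gcongr
        _ ≤ _ := by nlinarith [mul_pos hC (zero_lt_one.trans_le lC)]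
    refine this.trans ?_
    gcongr
    linarith

/-- This is where the logarithm is indispensable: 1/(k + x) alone has divergent integral, while
division by (1 + log)² makes it the derivative of −1/(1 + log). The exact value is 1/π. -/
lemma lintegral_wM_sq_le {k : ℝ} (hk : 0 < k) : ∫⁻ ξ, ENNReal.ofReal (wM k ξ) ^ 2 ≤ 1 := by
  have hpi := Real.pi_pos
  set g : ℝ → ℝ := fun x => -(1 / (2 * Real.pi)) * (1 + Real.log (1 + 2 * Real.pi * x / k))⁻¹
  set g' : ℝ → ℝ := fun x =>
    1 / ((1 + Real.log (1 + 2 * Real.pi * x / k)) ^ 2 * (k * (1 + 2 * Real.pi * x / k)))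
  have hpos : ∀ x, 0 ≤ x → 1 ≤ 1 + 2 * Real.pi * x / k := fun x hx => by
    have : 0 ≤ 2 * Real.pi * x / k := by positivity
    linarith
  have hlog : ∀ x, 0 ≤ x → 1 ≤ 1 + Real.log (1 + 2 * Real.pi * x / k) := fun x hx => by
    linarith [Real.log_nonneg (hpos x hx)]
  have hd : ∀ x ∈ Set.Ici (0:ℝ), HasDerivAt g (g' x) x := by
    intro x hx
    have h1 := hpos x hx
    have h2 := hlog x hx
    have e : HasDerivAt (fun x : ℝ => 1 + 2 * Real.pi * x / k) (2 * Real.pi / k) x := by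
      simpa using (((hasDerivAt_id x).const_mul (2 * Real.pi)).div_const k).const_add 1
    have := (((e.log (by positivity)).const_add 1).inv (by positivity)).const_mul
      (-(1 / (2 * Real.pi)))
    refine this.congr_deriv ?_
    simp only [g']
    field_simp
  have hnn : ∀ x ∈ Set.Ioi (0:ℝ), 0 ≤ g' x := fun x hx => by
    have h1 := hpos x (le_of_lt hx)
    positivity
  have ht : Filter.Tendsto g Filter.atTop (nhds 0) := by
    have h1 : Filter.Tendsto (fun x : ℝ => 1 + 2 * Real.pi * x / k) Filter.atTop Filter.atTop := by
      refine Filter.tendsto_atTop_add_const_left _ _ ?_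
      refine Filter.Tendsto.atTop_div_const hk ?_
      exact Filter.Tendsto.const_mul_atTop (by positivity) Filter.tendsto_id
    have h2 := Filter.tendsto_atTop_add_const_left _ 1 (Real.tendsto_log_atTop.comp h1)
    have h3 := (tendsto_inv_atTop_zero.comp h2).const_mul (-(1 / (2 * Real.pi)))
    rw [mul_zero] at h3
    exact h3
  have hint := integral_Ioi_of_hasDerivAt_of_nonneg' hd hnn ht
  have hg0 : g 0 = -(1 / (2 * Real.pi)) := by simp [g]
  have habs : ∀ ξ, ENNReal.ofReal (wM k ξ) ^ 2 = ENNReal.ofReal (g' |ξ|) := by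
    intro ξ
    rw [← ENNReal.ofReal_pow (wM_pos hk ξ).le]
    congr 1
    have := one_le_freqH hk ξ
    simp only [wM, wZ, g']
    rw [div_pow, mul_pow, Real.sq_sqrt (by positivity)]
    simp [freqL, freqH]
  simp_rw [habs]
  have hi2 : Integrable fun ξ => g' |ξ| := by
    -- A non-integrable function has integral 0 by convention, so the computed nonzero value proves
    -- integrability.
    refine Integrable.of_integral_ne_zero ?_
    rw [integral_comp_abs, hint, hg0]
    have : 0 < 1 / (2 * Real.pi) := by positivity
    simp
  rw [← ofReal_integral_eq_lintegral_ofReal hi2, integral_comp_abs, hint, hg0]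
  · rw [ENNReal.ofReal_le_one]
    have := Real.pi_gt_three
    have : 2 * (0 - -(1 / (2 * Real.pi))) = 1 / Real.pi := by field_simp; ring
    rw [this, div_le_one hpi]
    linarith
  · refine Filter.Eventually.of_forall fun ξ => ?_
    have h1 := hpos |ξ| (abs_nonneg ξ)
    simp only [g', Pi.zero_apply]
    positivity

/-! ### Weighted norms and products on the Fourier side. -/

/-- The weighted `L²` norm `‖w G‖_{L²}`. -/
def wnorm (w : ℝ → ℝ) (G : ℝ → ℂ) : ℝ≥0∞ := eLpNorm (fun ξ => (w ξ : ℂ) * G ξ) 2 volume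

lemma eLpNorm_two_sq {α E : Type*} [MeasurableSpace α] [NormedAddCommGroup E] (μ : Measure α)
    (f : α → E) : eLpNorm f 2 μ ^ 2 = ∫⁻ x, ‖f x‖ₑ ^ 2 ∂μ := by
  have := eLpNorm_nnreal_pow_eq_lintegral (f := f) (μ := μ) (p := 2) (by norm_num)
  simpa using this

lemma wnorm_sq {w : ℝ → ℝ} (hw : ∀ ξ, 0 ≤ w ξ) (G : ℝ → ℂ) :
    wnorm w G ^ 2 = ∫⁻ ξ, (ENNReal.ofReal (w ξ) * ‖G ξ‖ₑ) ^ 2 := by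
  rw [wnorm, eLpNorm_two_sq]
  refine lintegral_congr fun ξ => ?_
  rw [enorm_mul, ← ofReal_norm (w ξ : ℂ), Complex.norm_real, Real.norm_of_nonneg (hw ξ)]

/-- The constant is the square root of 9 · 4². Since R is only almost everywhere measurable, the
Young inequality is applied to a measurable version of its norm. -/
lemma wnorm_conv_le {k : ℝ} (hk : 0 < k) {u : ℝ → ℝ} (hu : Continuous u) (hu0 : ∀ ξ, 0 ≤ u ξ)
    (hmul : ∀ ξ η, u ξ ≤ 4 * (wM k ξ + wM k (ξ - η) + wM k η) * (u (ξ - η) * wZ k η))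
    {F G R : ℝ → ℂ} (hG : Measurable G) (hR : AEMeasurable R)
    (hF : ∀ ξ, ‖F ξ‖ₑ ≤ ∫⁻ η, ‖G (ξ - η)‖ₑ * ‖R η‖ₑ) :
    wnorm u F ≤ 12 * wnorm u G * wnorm (wZ k) R := by
  have hz : ∀ ξ, 0 ≤ wZ k ξ := fun ξ => (wZ_pos hk ξ).le
  have hRm : AEMeasurable (fun η => ‖R η‖ₑ) := hR.enorm
  have hR' : ∀ ξ, ∫⁻ η, ‖G (ξ - η)‖ₑ * ‖R η‖ₑ = ∫⁻ η, ‖G (ξ - η)‖ₑ * hRm.mk _ η := fun ξ =>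
    lintegral_congr_ae (by filter_upwards [hRm.ae_eq_mk] with η h; rw [h])
  have key := lintegral_weight_conv_sq_le (u := fun ξ => ENNReal.ofReal (u ξ))
    (v := fun ξ => ENNReal.ofReal (wZ k ξ)) (ν := fun ξ => ENNReal.ofReal (wM k ξ))
    (G := fun ξ => ‖G ξ‖ₑ) (R := hRm.mk _) (c := 4) hu.measurable.ennreal_ofReal
    (continuous_wZ hk).measurable.ennreal_ofReal (continuous_wM hk).measurable.ennreal_ofReal
    hG.enorm hRm.measurable_mk (by
      intro ξ η
      have m1 := (wM_pos hk ξ).le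
      have m2 := (wM_pos hk (ξ - η)).le
      have m3 := (wM_pos hk η).le
      rw [← ENNReal.ofReal_add m1 m2, ← ENNReal.ofReal_add (by positivity) m3,
        ← ENNReal.ofReal_mul (hu0 _), ← ENNReal.ofReal_ofNat, ← ENNReal.ofReal_mul (by norm_num),
        ← ENNReal.ofReal_mul (by positivity)]
      exact ENNReal.ofReal_le_ofReal (hmul ξ η))
  have hsq : wnorm u F ^ 2 ≤ (12 * wnorm u G * wnorm (wZ k) R) ^ 2 := by
    rw [wnorm_sq hu0, mul_pow, mul_pow, wnorm_sq hu0, wnorm_sq hz]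
    calc _ ≤ ∫⁻ ξ, (ENNReal.ofReal (u ξ) * ∫⁻ η, ‖G (ξ - η)‖ₑ * hRm.mk _ η) ^ 2 := by
          refine lintegral_mono fun ξ => ?_
          gcongr
          exact (hF ξ).trans (hR' ξ).le
      _ ≤ _ := key
      _ ≤ 9 * 4 ^ 2 * 1 * (∫⁻ ξ, (ENNReal.ofReal (u ξ) * ‖G ξ‖ₑ) ^ 2) *
          ∫⁻ ξ, (ENNReal.ofReal (wZ k ξ) * hRm.mk _ ξ) ^ 2 := by
          gcongr
          exact lintegral_wM_sq_le hk
      _ = _ := by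
        congr 1
        · norm_num
        · refine lintegral_congr_ae ?_
          filter_upwards [hRm.ae_eq_mk] with η h
          rw [h]
  exact (ENNReal.pow_le_pow_left_iff (by norm_num)).1 hsq

lemma wnorm_wK_conv_le {k : ℝ} (hk : 0 < k) {F G R : ℝ → ℂ} (hG : Measurable G)
    (hR : AEMeasurable R) (hF : ∀ ξ, ‖F ξ‖ₑ ≤ ∫⁻ η, ‖G (ξ - η)‖ₑ * ‖R η‖ₑ) :
    wnorm (wK k) F ≤ 12 * wnorm (wK k) G * wnorm (wZ k) R :=
  wnorm_conv_le hk (continuous_wK hk) (fun ξ => (wK_pos hk ξ).le) (wK_le_mul hk) hG hR hF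

lemma wnorm_wH_conv_le {k : ℝ} (hk : 0 < k) {F G R : ℝ → ℂ} (hG : Measurable G)
    (hR : AEMeasurable R) (hF : ∀ ξ, ‖F ξ‖ₑ ≤ ∫⁻ η, ‖G (ξ - η)‖ₑ * ‖R η‖ₑ) :
    wnorm (wH k) F ≤ 12 * wnorm (wH k) G * wnorm (wZ k) R :=
  wnorm_conv_le hk (continuous_wH hk) (fun ξ => (wH_pos hk ξ).le) (wH_le_mul hk) hG hR hF

/-- Cauchy–Schwarz against `wM`. Consequently a small `wZ` norm makes the inverse Fourier transform
uniformly small. -/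
lemma lintegral_enorm_le_wnorm {k : ℝ} (hk : 0 < k) {R : ℝ → ℂ} (hR : AEMeasurable R) :
    ∫⁻ ξ, ‖R ξ‖ₑ ≤ wnorm (wZ k) R := by
  have h : ∀ ξ, ‖R ξ‖ₑ = ENNReal.ofReal (wM k ξ) * (ENNReal.ofReal (wZ k ξ) * ‖R ξ‖ₑ) := by
    intro ξ
    rw [← mul_assoc, ← ENNReal.ofReal_mul (wM_pos hk ξ).le, wM,
      one_div_mul_cancel (wZ_pos hk ξ).ne', ENNReal.ofReal_one, one_mul]
  have hz := (continuous_wZ hk).measurable.ennreal_ofReal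
  have hm := (continuous_wM hk).measurable.ennreal_ofReal
  have := sq_lintegral_mul_le volume hm.aemeasurable (hz.aemeasurable.mul hR.enorm)
  rw [← ENNReal.pow_le_pow_left_iff (n := 2) (by norm_num), wnorm_sq fun ξ => (wZ_pos hk ξ).le]
  calc _ = (∫⁻ ξ, ENNReal.ofReal (wM k ξ) * (ENNReal.ofReal (wZ k ξ) * ‖R ξ‖ₑ)) ^ 2 := by
        congr 1; exact lintegral_congr h
    _ ≤ _ := this
    _ ≤ 1 * ∫⁻ ξ, (ENNReal.ofReal (wZ k ξ) * ‖R ξ‖ₑ) ^ 2 := by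
        gcongr ?_ * ?_
        · exact lintegral_wM_sq_le hk
        · rfl
    _ = _ := one_mul _

lemma integral_fourierInv_mul_eq_flip {f g : ℝ → ℂ} (hf : Integrable f) (hg : Integrable g) :
    ∫ x, 𝓕⁻ f x * g x = ∫ η, f η * 𝓕⁻ g η := by
  have := VectorFourier.integral_fourierIntegral_smul_eq_flip (L := -innerₗ ℝ) (e := Real.fourierChar)
    (μ := (volume : Measure ℝ)) (ν := (volume : Measure ℝ)) Real.continuous_fourierChar
    (by simp only [LinearMap.neg_apply, innerₗ_apply_apply]; fun_prop) hf hg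
  have hflip : (-innerₗ ℝ).flip = (-innerₗ ℝ : ℝ →ₗ[ℝ] ℝ →ₗ[ℝ] ℝ) := by
    ext; simp
  rw [hflip] at this
  exact this

lemma fourier_modulate (φ : ℝ → ℂ) (ξ η : ℝ) :
    𝓕⁻ (fun x => (Real.fourierChar (-(x * ξ)) : ℂ) * φ x) η = 𝓕 φ (ξ - η) := by
  rw [Real.fourierInv_eq_fourier_neg, Real.fourier_real_eq, Real.fourier_real_eq]
  refine integral_congr_ae (Filter.Eventually.of_forall fun x => ?_)
  simp only [Circle.smul_def, smul_eq_mul]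
  rw [← mul_assoc, ← Circle.coe_mul, ← AddChar.map_add_eq_mul]
  congr 3
  ring

/-- The convolution formula with f given on the Fourier side: modulating φ and moving the inverse
transform across by Fubini needs only that φ and f are integrable, with no inversion theorem. -/
lemma fourier_mul_fourierInv {φ f : ℝ → ℂ} (hφ : Integrable φ) (hf : Integrable f) (ξ : ℝ) :
    𝓕 (fun x => φ x * 𝓕⁻ f x) ξ = ∫ η, f η * 𝓕 φ (ξ - η) := by
  have hg : Integrable (fun x => (Real.fourierChar (-(x * ξ)) : ℂ) * φ x) := by
    refine hφ.bdd_mul (c := 1) ?_ (Filter.Eventually.of_forall fun x => (Circle.norm_coe _).le)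
    exact (Continuous.aestronglyMeasurable (by fun_prop))
  have := integral_fourierInv_mul_eq_flip hf hg
  simp_rw [fourier_modulate] at this
  rw [← this, Real.fourier_real_eq]
  refine integral_congr_ae (Filter.Eventually.of_forall fun x => ?_)
  simp only [Circle.smul_def, smul_eq_mul]
  ring

lemma enorm_fourier_mul_fourierInv_le {φ f : ℝ → ℂ} (hφ : Integrable φ) (hf : Integrable f)
    (ξ : ℝ) : ‖𝓕 (fun x => φ x * 𝓕⁻ f x) ξ‖ₑ ≤ ∫⁻ η, ‖𝓕 φ (ξ - η)‖ₑ * ‖f η‖ₑ := by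
  rw [fourier_mul_fourierInv hφ hf]
  refine (enorm_integral_le_lintegral_enorm _).trans (le_of_eq ?_)
  refine lintegral_congr fun η => ?_
  rw [enorm_mul, mul_comm]

lemma continuous_fourier {f : ℝ → ℂ} (hf : Integrable f) : Continuous (𝓕 f) :=
  VectorFourier.fourierIntegral_continuous Real.continuous_fourierChar
    (by simp only [innerₗ_apply_apply]; fun_prop) hf

lemma continuous_fourierInv {f : ℝ → ℂ} (hf : Integrable f) : Continuous (𝓕⁻ f) := by
  have : 𝓕⁻ f = fun x => 𝓕 f (-x) := funext fun x => Real.fourierInv_eq_fourier_neg f x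
  rw [this]
  exact (continuous_fourier hf).comp continuous_neg

lemma norm_fourierInv_le (f : ℝ → ℂ) (x : ℝ) : ‖𝓕⁻ f x‖ ≤ ∫ ξ, ‖f ξ‖ := by
  rw [Real.fourierInv_eq]
  refine (norm_integral_le_integral_norm _).trans (le_of_eq ?_)
  simp only [Circle.norm_smul]

lemma integrable_mul_fourierInv {φ f : ℝ → ℂ} (hφ : Integrable φ) (hf : Integrable f) :
    Integrable fun x => φ x * 𝓕⁻ f x := by
  refine hφ.mul_bdd (c := ∫ ξ, ‖f ξ‖) (continuous_fourierInv hf).aestronglyMeasurable ?_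
  exact Filter.Eventually.of_forall fun x => norm_fourierInv_le f x

/-- A continuous integrable function whose Fourier transform is integrable. -/
structure IsWiener (q : ℝ → ℂ) : Prop where
  continuous : Continuous q
  integrable : Integrable q
  fourier : Integrable (𝓕 q)

/-- Young's inequality L¹ ∗ L¹ ⊂ L¹ for the Fourier transforms. It makes the nonlinear term of the
Riccati equation eligible for pointwise Fourier inversion. -/
lemma IsWiener.mul_fourierInv {φ f : ℝ → ℂ} (hφ : IsWiener φ) (hf : Integrable f) :
    IsWiener fun x => φ x * 𝓕⁻ f x where
  continuous := hφ.continuous.mul (continuous_fourierInv hf)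
  integrable := integrable_mul_fourierInv hφ.integrable hf
  fourier := by
    refine ⟨(continuous_fourier (integrable_mul_fourierInv hφ.integrable hf)).aestronglyMeasurable, ?_⟩
    have hm : AEMeasurable (Function.uncurry fun ξ η : ℝ => ‖𝓕 φ (ξ - η)‖ₑ * ‖f η‖ₑ)
        (volume.prod volume) := by
      refine AEMeasurable.mul ?_ (hf.aemeasurable.comp_snd.enorm)
      exact ((continuous_fourier hφ.integrable).comp
        (continuous_fst.sub continuous_snd)).measurable.enorm.aemeasurable
    have h1 : ∀ η : ℝ, ∫⁻ ξ, ‖𝓕 φ (ξ - η)‖ₑ * ‖f η‖ₑ = (∫⁻ ξ, ‖𝓕 φ ξ‖ₑ) * ‖f η‖ₑ := fun η => by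
      rw [lintegral_mul_const'' _ (by
        exact ((continuous_fourier hφ.integrable).comp
          (continuous_id.sub continuous_const)).measurable.enorm.aemeasurable),
        lintegral_sub_right_eq_self (fun ξ => ‖𝓕 φ ξ‖ₑ) η]
    calc ∫⁻ ξ, ‖𝓕 (fun x => φ x * 𝓕⁻ f x) ξ‖ₑ
        ≤ ∫⁻ ξ, ∫⁻ η, ‖𝓕 φ (ξ - η)‖ₑ * ‖f η‖ₑ :=
          lintegral_mono fun ξ => enorm_fourier_mul_fourierInv_le hφ.integrable hf ξ
      _ = (∫⁻ ξ, ‖𝓕 φ ξ‖ₑ) * ∫⁻ η, ‖f η‖ₑ := by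
          rw [lintegral_lintegral_swap hm]
          simp_rw [h1]
          rw [lintegral_const_mul'' _ hf.aemeasurable.enorm]
      _ < ⊤ := ENNReal.mul_lt_top hφ.fourier.2 hf.2

lemma wnorm_wK_fourier_mul_le {k : ℝ} (hk : 0 < k) {φ f : ℝ → ℂ} (hφ : Integrable φ)
    (hf : Integrable f) :
    wnorm (wK k) (𝓕 fun x => φ x * 𝓕⁻ f x) ≤ 12 * wnorm (wK k) (𝓕 φ) * wnorm (wZ k) f :=
  wnorm_wK_conv_le hk (continuous_fourier hφ).measurable hf.aemeasurable
    (enorm_fourier_mul_fourierInv_le hφ hf)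

lemma wnorm_wH_fourier_mul_le {k : ℝ} (hk : 0 < k) {φ f : ℝ → ℂ} (hφ : Integrable φ)
    (hf : Integrable f) :
    wnorm (wH k) (𝓕 fun x => φ x * 𝓕⁻ f x) ≤ 12 * wnorm (wH k) (𝓕 φ) * wnorm (wZ k) f :=
  wnorm_wH_conv_le hk (continuous_fourier hφ).measurable hf.aemeasurable
    (enorm_fourier_mul_fourierInv_le hφ hf)

lemma wnorm_wK_fourier_mul_mul_le {k : ℝ} (hk : 0 < k) {φ f g : ℝ → ℂ} (hφ : Integrable φ)
    (hf : Integrable f) (hg : Integrable g) :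
    wnorm (wK k) (𝓕 fun x => φ x * 𝓕⁻ f x * 𝓕⁻ g x) ≤
      144 * wnorm (wK k) (𝓕 φ) * wnorm (wZ k) f * wnorm (wZ k) g := by
  refine (wnorm_wK_fourier_mul_le hk (integrable_mul_fourierInv hφ hf) hg).trans ?_
  calc _ ≤ 12 * (12 * wnorm (wK k) (𝓕 φ) * wnorm (wZ k) f) * wnorm (wZ k) g := by
        gcongr; exact wnorm_wK_fourier_mul_le hk hφ hf
    _ = _ := by ring

lemma wnorm_wH_fourier_mul_mul_le {k : ℝ} (hk : 0 < k) {φ f g : ℝ → ℂ} (hφ : Integrable φ)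
    (hf : Integrable f) (hg : Integrable g) :
    wnorm (wH k) (𝓕 fun x => φ x * 𝓕⁻ f x * 𝓕⁻ g x) ≤
      144 * wnorm (wH k) (𝓕 φ) * wnorm (wZ k) f * wnorm (wZ k) g := by
  refine (wnorm_wH_fourier_mul_le hk (integrable_mul_fourierInv hφ hf) hg).trans ?_
  calc _ ≤ 12 * (12 * wnorm (wH k) (𝓕 φ) * wnorm (wZ k) f) * wnorm (wZ k) g := by
        gcongr; exact wnorm_wH_fourier_mul_le hk hφ hf
    _ = _ := by ring

/-! ### The Riccati equation on the Fourier side. -/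

/-- The symbol of `∂ + a`. -/
def symb (a ξ : ℝ) : ℂ := a + 2 * Real.pi * Complex.I * ξ

/-- Stated with |a|, because the second Jost quotient is governed by a negative a. -/
lemma norm_symb_ge (a ξ : ℝ) (ha : a ≠ 0) : |a| * freqH |a| ξ ≤ 2 * ‖symb a ξ‖ := by
  have h1 : |a| ≤ ‖symb a ξ‖ := by
    simpa [symb] using Complex.abs_re_le_norm (symb a ξ)
  have h2 : 2 * Real.pi * |ξ| ≤ ‖symb a ξ‖ := by
    simpa [symb, abs_mul, abs_of_pos Real.pi_pos] using Complex.abs_im_le_norm (symb a ξ)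
  have : |a| * freqH |a| ξ = |a| + 2 * Real.pi * |ξ| := by
    have := abs_pos.2 ha
    unfold freqH; field_simp
  linarith

lemma norm_symb_pos (a ξ : ℝ) (ha : a ≠ 0) : 0 < ‖symb a ξ‖ := by
  have h := norm_symb_ge a ξ ha
  have := one_le_freqH (abs_pos.2 ha) ξ
  have : 0 < |a| * freqH |a| ξ := mul_pos (abs_pos.2 ha) (by linarith)
  linarith

lemma symb_ne_zero (a ξ : ℝ) (ha : a ≠ 0) : symb a ξ ≠ 0 := norm_pos_iff.1 (norm_symb_pos a ξ ha)

lemma continuous_symb (a : ℝ) : Continuous (symb a) := by unfold symb; fun_prop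

/-- Inverting ∂ + a gains one derivative, and `wZ` is `wK` times k·`freqH`, exactly the size of the
symbol. -/
lemma wZ_div_symb_le (a ξ : ℝ) (ha : a ≠ 0) : wZ |a| ξ / ‖symb a ξ‖ ≤ 2 * wK |a| ξ := by
  have h := norm_symb_ge a ξ ha
  have hk := abs_pos.2 ha
  have hp := norm_symb_pos a ξ ha
  have hs := sqrt_freqH_pos hk ξ
  have hl := one_le_freqL hk ξ
  have hh := one_le_freqH hk ξ
  rw [div_le_iff₀ hp, wZ, wK]
  have e : Real.sqrt (|a| * freqH |a| ξ) * Real.sqrt (|a| * freqH |a| ξ) = |a| * freqH |a| ξ :=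
    Real.mul_self_sqrt (by positivity)
  have e2 : 2 * (freqL |a| ξ / Real.sqrt (|a| * freqH |a| ξ)) * ‖symb a ξ‖
    = freqL |a| ξ / Real.sqrt (|a| * freqH |a| ξ) * (2 * ‖symb a ξ‖) := by ring
  rw [e2]
  calc _ = freqL |a| ξ / Real.sqrt (|a| * freqH |a| ξ) * (|a| * freqH |a| ξ) := by
        rw [div_mul_eq_mul_div, eq_div_iff hs.ne', mul_assoc, e]
    _ ≤ _ := by gcongr

lemma wnorm_const_mul (c : ℝ) (hc : 0 ≤ c) (w : ℝ → ℝ) (G : ℝ → ℂ) :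
    eLpNorm (fun ξ => (c * w ξ : ℂ) * G ξ) 2 volume = ENNReal.ofReal c * wnorm w G := by
  have : (fun ξ => (c * w ξ : ℂ) * G ξ) = (c : ℂ) • fun ξ => (w ξ : ℂ) * G ξ := by
    ext ξ; simp [mul_assoc]
  rw [this, eLpNorm_const_smul, wnorm, ← ofReal_norm, Complex.norm_real, Real.norm_of_nonneg hc]

lemma wnorm_div_symb_le {a : ℝ} (ha : a ≠ 0) (G : ℝ → ℂ) :
    wnorm (wZ |a|) (fun ξ => G ξ / symb a ξ) ≤ 2 * wnorm (wK |a|) G := by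
  have := wnorm_const_mul 2 (by norm_num) (wK |a|) G
  rw [ENNReal.ofReal_ofNat] at this
  rw [← this]
  refine eLpNorm_mono fun ξ => ?_
  have h := wZ_div_symb_le a ξ ha
  have hk := abs_pos.2 ha
  rw [norm_mul, norm_div, norm_mul, norm_mul, Complex.norm_real, Complex.norm_real,
    Complex.norm_real, Real.norm_of_nonneg (wZ_pos hk ξ).le, Real.norm_of_nonneg (wK_pos hk ξ).le]
  calc _ = wZ |a| ξ / ‖symb a ξ‖ * ‖G ξ‖ := by ring
    _ ≤ 2 * wK |a| ξ * ‖G ξ‖ := by gcongr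
    _ = _ := by simp

lemma wnorm_add_le {w : ℝ → ℝ} (hw : Continuous w) {F G : ℝ → ℂ} (hF : AEStronglyMeasurable F)
    (hG : AEStronglyMeasurable G) : wnorm w (fun ξ => F ξ + G ξ) ≤ wnorm w F + wnorm w G := by
  have hc : AEStronglyMeasurable fun ξ => (w ξ : ℂ) := (by fun_prop : Continuous fun ξ => (w ξ : ℂ)).aestronglyMeasurable
  refine le_trans (le_of_eq ?_) (eLpNorm_add_le (hc.mul hF) (hc.mul hG) (by norm_num))
  unfold wnorm
  congr 1
  ext ξ
  simp [mul_add]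

lemma integrable_of_wnorm {k : ℝ} (hk : 0 < k) {R : ℝ → ℂ} (hR : AEStronglyMeasurable R)
    (h : wnorm (wZ k) R < ⊤) : Integrable R :=
  ⟨hR, (lintegral_enorm_le_wnorm hk hR.aemeasurable).trans_lt h⟩

lemma norm_fourierInv_le_wnorm {k : ℝ} (hk : 0 < k) {R : ℝ → ℂ} (hR : Integrable R) {ρ : ℝ}
    (hρ : 0 ≤ ρ) (h : wnorm (wZ k) R ≤ ENNReal.ofReal ρ) (x : ℝ) : ‖𝓕⁻ R x‖ ≤ ρ := by
  refine (norm_fourierInv_le R x).trans ?_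
  rw [integral_norm_eq_lintegral_enorm hR.aestronglyMeasurable]
  exact ENNReal.toReal_le_of_le_ofReal hρ ((lintegral_enorm_le_wnorm hk hR.aemeasurable).trans h)

/-- `R` is an integrable function whose inverse Fourier transform `r` solves, on the Fourier side,
the Riccati equation `r' + a r = q₁ + q₂ r²`. -/
structure IsRiccati (a : ℝ) (q₁ q₂ R : ℝ → ℂ) : Prop where
  integrable : Integrable R
  eq : ∀ ξ, R ξ = (𝓕 q₁ ξ + 𝓕 (fun x => q₂ x * 𝓕⁻ R x * 𝓕⁻ R x) ξ) / symb a ξ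

lemma fourier_add_apply {f g : ℝ → ℂ} (hf : Integrable f) (hg : Integrable g) (ξ : ℝ) :
    𝓕 (fun x => f x + g x) ξ = 𝓕 f ξ + 𝓕 g ξ := by
  simp only [Real.fourier_eq, smul_add]
  exact integral_add ((Real.fourierIntegral_convergent_iff ξ).2 hf)
    ((Real.fourierIntegral_convergent_iff ξ).2 hg)

lemma fourier_const_mul_apply (c : ℂ) (f : ℝ → ℂ) (ξ : ℝ) :
    𝓕 (fun x => c * f x) ξ = c * 𝓕 f ξ := by
  have := congrFun (VectorFourier.fourierIntegral_const_smul Real.fourierChar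
    (volume : Measure ℝ) (innerₗ ℝ) f c) ξ
  exact this

lemma fourier_sub_apply {f g : ℝ → ℂ} (hf : Integrable f) (hg : Integrable g) (ξ : ℝ) :
    𝓕 (fun x => f x - g x) ξ = 𝓕 f ξ - 𝓕 g ξ := by
  have h := fourier_add_apply hf (hg.const_mul (-1)) ξ
  rw [fourier_const_mul_apply] at h
  rw [sub_eq_add_neg, ← neg_one_mul, ← h]
  exact congrArg (fun F : ℝ → ℂ => 𝓕 F ξ) (funext fun x => by ring)

lemma fourierInv_add_apply {f g : ℝ → ℂ} (hf : Integrable f) (hg : Integrable g) (ξ : ℝ) :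
    𝓕⁻ (fun x => f x + g x) ξ = 𝓕⁻ f ξ + 𝓕⁻ g ξ := by
  simp only [Real.fourierInv_eq_fourier_neg]
  exact fourier_add_apply hf hg _

lemma fourierInv_sub_apply {f g : ℝ → ℂ} (hf : Integrable f) (hg : Integrable g) (ξ : ℝ) :
    𝓕⁻ (fun x => f x - g x) ξ = 𝓕⁻ f ξ - 𝓕⁻ g ξ := by
  simp only [Real.fourierInv_eq_fourier_neg]
  exact fourier_sub_apply hf hg _

lemma wnorm_congr_ae {w : ℝ → ℝ} {F G : ℝ → ℂ} (h : F =ᵐ[volume] G) : wnorm w F = wnorm w G := by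
  refine eLpNorm_congr_ae ?_
  filter_upwards [h] with ξ hξ
  rw [hξ]

lemma integrable_quad {q : ℝ → ℂ} (hq : IsWiener q) {f g : ℝ → ℂ} (hf : Integrable f)
    (hg : Integrable g) : Integrable fun x => q x * 𝓕⁻ f x * 𝓕⁻ g x :=
  integrable_mul_fourierInv (integrable_mul_fourierInv hq.integrable hf) hg

theorem exists_isRiccati {a : ℝ} (ha : a ≠ 0) {q₁ q₂ : ℝ → ℂ} (h₁ : IsWiener q₁) (h₂ : IsWiener q₂)
    {D : ℝ} (hD0 : 0 ≤ D) (hD : D ≤ 1 / 100) (hK₁ : wnorm (wK |a|) (𝓕 q₁) ≤ ENNReal.ofReal D)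
    (hK₂ : wnorm (wK |a|) (𝓕 q₂) ≤ ENNReal.ofReal D) :
    ∃ R, IsRiccati a q₁ q₂ R ∧ wnorm (wZ |a|) R ≤ ENNReal.ofReal (4 * D) := by
  set k := |a| with hkdef
  have hk : 0 < k := abs_pos.2 ha
  let X := Lp ℂ 2 (volume : Measure ℝ)
  -- The `wZ`-weighted space is parametrised isometrically by L² through multiplication by `wM`, so
  -- that the contraction takes place in a complete space already at hand.
  let Rf : X → ℝ → ℂ := fun f ξ => (wM k ξ : ℂ) * f ξ
  have hRm : ∀ f : X, AEStronglyMeasurable (Rf f) := fun f =>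
    (by have := continuous_wM hk; fun_prop : Continuous fun ξ => (wM k ξ : ℂ)).aestronglyMeasurable.mul
      (Lp.aestronglyMeasurable f)
  have hZR : ∀ (f : X) ξ, (wZ k ξ : ℂ) * Rf f ξ = f ξ := fun f ξ => by
    have := (wZ_pos hk ξ).ne'
    have h' : (wZ k ξ : ℂ) ≠ 0 := by exact_mod_cast this
    simp only [Rf, wM]
    push_cast
    field_simp
  have hnorm : ∀ f : X, wnorm (wZ k) (Rf f) = ENNReal.ofReal ‖f‖ := fun f => by
    rw [wnorm]
    simp_rw [hZR]
    rw [Lp.norm_def, ENNReal.ofReal_toReal (Lp.eLpNorm_ne_top f)]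
  have hRi : ∀ f : X, Integrable (Rf f) := fun f =>
    integrable_of_wnorm hk (hRm f) (by rw [hnorm]; exact ENNReal.ofReal_lt_top)
  let G : X → ℝ → ℂ := fun f ξ =>
    𝓕 q₁ ξ + 𝓕 (fun x => q₂ x * 𝓕⁻ (Rf f) x * 𝓕⁻ (Rf f) x) ξ
  have hGc : ∀ f, Continuous (G f) := fun f =>
    (continuous_fourier h₁.integrable).add (continuous_fourier (integrable_quad h₂ (hRi f) (hRi f)))
  let N : X → ℝ → ℂ := fun f ξ => G f ξ / symb a ξ
  have hNc : ∀ f, Continuous (N f) := fun f =>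
    (hGc f).div (continuous_symb a) fun ξ => symb_ne_zero a ξ ha
  have hzc : Continuous fun ξ => (wZ k ξ : ℂ) := by
    have := continuous_wZ hk
    fun_prop
  have hNn : ∀ f, wnorm (wZ k) (N f) ≤ ENNReal.ofReal (2 * (D + 144 * D * ‖f‖ * ‖f‖)) := by
    intro f
    refine (wnorm_div_symb_le ha (G f)).trans ?_
    have e1 := wnorm_add_le (continuous_wK hk) (continuous_fourier h₁.integrable).aestronglyMeasurable
      (continuous_fourier (integrable_quad h₂ (hRi f) (hRi f))).aestronglyMeasurable
    have e2 := wnorm_wK_fourier_mul_mul_le hk h₂.integrable (hRi f) (hRi f)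
    rw [hnorm] at e2
    calc 2 * wnorm (wK k) (G f) ≤ 2 * (ENNReal.ofReal D +
          144 * ENNReal.ofReal D * ENNReal.ofReal ‖f‖ * ENNReal.ofReal ‖f‖) := by
          gcongr
          refine e1.trans (add_le_add hK₁ (e2.trans ?_))
          gcongr
      _ = _ := by
          rw [ENNReal.ofReal_mul (by norm_num), ENNReal.ofReal_add hD0 (by positivity),
            ENNReal.ofReal_mul (by positivity), ENNReal.ofReal_mul (by positivity),
            ENNReal.ofReal_mul (by norm_num), ENNReal.ofReal_ofNat, ENNReal.ofReal_ofNat]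
  have hmem : ∀ f, MemLp (fun ξ => (wZ k ξ : ℂ) * N f ξ) 2 volume := fun f =>
    ⟨(hzc.mul (hNc f)).aestronglyMeasurable, (hNn f).trans_lt ENNReal.ofReal_lt_top⟩
  let T : X → X := fun f => (hmem f).toLp _
  have hTn : ∀ f, ‖T f‖ ≤ 2 * (D + 144 * D * ‖f‖ * ‖f‖) := fun f => by
    rw [Lp.norm_toLp]
    exact ENNReal.toReal_le_of_le_ofReal (by positivity) (hNn f)
  have hTd : ∀ f g, ‖T f - T g‖ ≤ 288 * D * ‖f - g‖ * ‖f + g‖ := by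
    intro f g
    rw [← MemLp.toLp_sub, Lp.norm_toLp]
    refine ENNReal.toReal_le_of_le_ofReal (by positivity) ?_
    have hs : Rf (f - g) =ᵐ[volume] fun ξ => Rf f ξ - Rf g ξ := by
      filter_upwards [Lp.coeFn_sub f g] with ξ h
      simp only [Rf, h, Pi.sub_apply, mul_sub]
    have ha' : Rf (f + g) =ᵐ[volume] fun ξ => Rf f ξ + Rf g ξ := by
      filter_upwards [Lp.coeFn_add f g] with ξ h
      simp only [Rf, h, Pi.add_apply, mul_add]
    have hs2 : ∀ x, 𝓕⁻ (Rf (f - g)) x = 𝓕⁻ (Rf f) x - 𝓕⁻ (Rf g) x := fun x => by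
      rw [Real.fourierInv_congr_ae hs, fourierInv_sub_apply (hRi f) (hRi g)]
    have ha2 : ∀ x, 𝓕⁻ (Rf (f + g)) x = 𝓕⁻ (Rf f) x + 𝓕⁻ (Rf g) x := fun x => by
      rw [Real.fourierInv_congr_ae ha', fourierInv_add_apply (hRi f) (hRi g)]
    have hd : ((fun ξ => (wZ k ξ : ℂ) * N f ξ) - fun ξ => (wZ k ξ : ℂ) * N g ξ) =
        fun ξ => (wZ k ξ : ℂ) *
          (𝓕 (fun x => q₂ x * 𝓕⁻ (Rf (f - g)) x * 𝓕⁻ (Rf (f + g)) x) ξ / symb a ξ) := by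
      ext ξ
      -- The difference of squares factors, so the difference of the nonlinear terms is a single
      -- trilinear expression in q₂, f − g and f + g.
      have : (fun x => q₂ x * 𝓕⁻ (Rf (f - g)) x * 𝓕⁻ (Rf (f + g)) x) =
          fun x => q₂ x * 𝓕⁻ (Rf f) x * 𝓕⁻ (Rf f) x - q₂ x * 𝓕⁻ (Rf g) x * 𝓕⁻ (Rf g) x := by
        ext x
        rw [hs2, ha2]
        ring
      rw [this, fourier_sub_apply (integrable_quad h₂ (hRi f) (hRi f))
        (integrable_quad h₂ (hRi g) (hRi g))]
      simp only [Pi.sub_apply, N, G]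
      ring
    rw [hd]
    change wnorm (wZ k) (fun ξ => _ / symb a ξ) ≤ _
    refine (wnorm_div_symb_le ha _).trans ?_
    have e2 := wnorm_wK_fourier_mul_mul_le hk h₂.integrable (hRi (f - g)) (hRi (f + g))
    rw [hnorm, hnorm] at e2
    calc _ ≤ 2 * (144 * ENNReal.ofReal D * ENNReal.ofReal ‖f - g‖ * ENNReal.ofReal ‖f + g‖) := by
          gcongr
          refine e2.trans ?_
          gcongr
      _ = _ := by
          rw [ENNReal.ofReal_mul (by positivity), ENNReal.ofReal_mul (by positivity),
            ENNReal.ofReal_mul (by norm_num), ENNReal.ofReal_ofNat]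
          ring
  -- On this ball ‖f‖ ≤ 1/25, hence 144‖f‖² ≤ 1 and the image has norm at most 4D. The Lipschitz
  -- constant is at most 288 D · 8D ≤ 0.2304, below 1/2.
  set s : Set X := Metric.closedBall 0 (4 * D)
  have hmaps : Set.MapsTo T s s := by
    intro f hf
    rw [mem_closedBall_zero_iff] at hf ⊢
    refine (hTn f).trans ?_
    have : ‖f‖ * ‖f‖ ≤ 1 / 144 := by nlinarith [norm_nonneg f]
    nlinarith
  have hcontr : ContractingWith (1 / 2) (hmaps.restrict T s s) := by
    refine ⟨by norm_num, LipschitzWith.of_dist_le_mul fun f g => ?_⟩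
    have hf := mem_closedBall_zero_iff.1 f.2
    have hg := mem_closedBall_zero_iff.1 g.2
    rw [Subtype.dist_eq, Subtype.dist_eq, dist_eq_norm, dist_eq_norm]
    refine (hTd f g).trans ?_
    have h8 : ‖(f : X) + g‖ ≤ 8 * D := (norm_add_le _ _).trans (by linarith)
    have h9 : D * ‖(f : X) + g‖ ≤ 1 / 1000 := by
      nlinarith [norm_nonneg ((f : X) + g)]
    push_cast
    nlinarith [norm_nonneg ((f : X) - g)]
  obtain ⟨f, hfs, hfix, -⟩ := hcontr.exists_fixedPoint' Metric.isClosed_closedBall.isComplete hmaps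
    (x := 0) (by simp [s]; positivity) (edist_ne_top _ _)
  have hae : Rf f =ᵐ[volume] N f := by
    have h := (hmem f).coeFn_toLp
    have h' : (T f : ℝ → ℂ) =ᵐ[volume] f := by rw [hfix.eq]
    filter_upwards [h, h'] with ξ e1 e2
    have : (wZ k ξ : ℂ) ≠ 0 := by exact_mod_cast (wZ_pos hk ξ).ne'
    have e3 := hZR f ξ
    rw [← e2, show (T f : ℝ → ℂ) ξ = _ from e1] at e3
    exact mul_left_cancel₀ this e3
  have hinv : 𝓕⁻ (N f) = 𝓕⁻ (Rf f) := funext fun x => (Real.fourierInv_congr_ae hae x).symm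
  -- The fixed point is only an almost everywhere class. The representative `N f` is chosen so that
  -- the equation holds at every ξ.
  refine ⟨N f, ⟨(hRi f).congr hae, fun ξ => ?_⟩, ?_⟩
  · rw [hinv]
  · rw [← wnorm_congr_ae hae, hnorm]
    exact ENNReal.ofReal_le_ofReal (mem_closedBall_zero_iff.1 hfs)

lemma IsRiccati.continuous {a : ℝ} (ha : a ≠ 0) {q₁ q₂ R : ℝ → ℂ} (h₁ : IsWiener q₁)
    (h₂ : IsWiener q₂) (h : IsRiccati a q₁ q₂ R) : Continuous R := by
  have : R = fun ξ => (𝓕 q₁ ξ + 𝓕 (fun x => q₂ x * 𝓕⁻ R x * 𝓕⁻ R x) ξ) / symb a ξ := funext h.eq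
  rw [this]
  exact ((continuous_fourier h₁.integrable).add
    (continuous_fourier (integrable_quad h₂ h.integrable h.integrable))).div (continuous_symb a)
      fun ξ => symb_ne_zero a ξ ha

/-- Small solutions of the Riccati equation depend Lipschitz continuously on the data. -/
lemma IsRiccati.wnorm_sub_le {a : ℝ} (ha : a ≠ 0) {q₁ q₂ R q₁' q₂' R' : ℝ → ℂ} (h₁ : IsWiener q₁)
    (h₂ : IsWiener q₂) (h₁' : IsWiener q₁') (h₂' : IsWiener q₂') (h : IsRiccati a q₁ q₂ R)
    (h' : IsRiccati a q₁' q₂' R') (hK : wnorm (wK |a|) (𝓕 q₂) ≤ ENNReal.ofReal (1 / 100))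
    (hR : wnorm (wZ |a|) R ≤ ENNReal.ofReal (1 / 25))
    (hR' : wnorm (wZ |a|) R' ≤ ENNReal.ofReal (1 / 25)) :
    wnorm (wZ |a|) (fun ξ => R ξ - R' ξ) ≤ 4 * (wnorm (wK |a|) (𝓕 fun x => q₁ x - q₁' x) +
      wnorm (wK |a|) (𝓕 fun x => q₂ x - q₂' x)) := by
  set k := |a| with hkdef
  have hk : 0 < k := abs_pos.2 ha
  have hRc := h.continuous ha h₁ h₂
  have hRc' := h'.continuous ha h₁' h₂'
  set W := wnorm (wZ k) fun ξ => R ξ - R' ξ with hW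
  have hsum : wnorm (wZ k) (fun ξ => R ξ + R' ξ) ≤ ENNReal.ofReal (2 / 25) := by
    refine (wnorm_add_le (continuous_wZ hk) hRc.aestronglyMeasurable
      hRc'.aestronglyMeasurable).trans ((add_le_add hR hR').trans (le_of_eq ?_))
    rw [← ENNReal.ofReal_add (by norm_num) (by norm_num)]
    norm_num
  -- Finiteness is required before a multiple of W can be absorbed into the left side.
  have hWfin : W ≠ ⊤ := by
    have e := wnorm_add_le (continuous_wZ hk) hRc.aestronglyMeasurable
      (hRc'.const_smul (-1 : ℂ)).aestronglyMeasurable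
    have e' : wnorm (wZ k) ((-1 : ℂ) • R') = wnorm (wZ k) R' := by
      unfold wnorm
      refine eLpNorm_congr_norm_ae (Filter.Eventually.of_forall fun ξ => by simp)
    have e3 : W ≤ ENNReal.ofReal (1 / 25) + ENNReal.ofReal (1 / 25) := by
      refine le_trans (le_of_eq ?_) (e.trans (add_le_add hR (e'.le.trans hR')))
      rw [hW]
      congr 1
      ext ξ
      simp [sub_eq_add_neg]
    exact ne_top_of_le_ne_top (by simp) e3
  have hdi : Integrable fun ξ => R ξ - R' ξ := h.integrable.sub h'.integrable
  have hai : Integrable fun ξ => R ξ + R' ξ := h.integrable.add h'.integrable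
  have hs2 : ∀ x, 𝓕⁻ (fun ξ => R ξ - R' ξ) x = 𝓕⁻ R x - 𝓕⁻ R' x := fun x =>
    fourierInv_sub_apply h.integrable h'.integrable x
  have ha2 : ∀ x, 𝓕⁻ (fun ξ => R ξ + R' ξ) x = 𝓕⁻ R x + 𝓕⁻ R' x := fun x =>
    fourierInv_add_apply h.integrable h'.integrable x
  have hq2 : Integrable fun x => q₂ x - q₂' x := h₂.integrable.sub h₂'.integrable
  have hi1 : Integrable fun x => q₁ x - q₁' x := h₁.integrable.sub h₁'.integrable
  have hi2 : Integrable fun x => (q₂ x - q₂' x) * 𝓕⁻ R' x * 𝓕⁻ R' x :=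
    integrable_mul_fourierInv (integrable_mul_fourierInv hq2 h'.integrable) h'.integrable
  have hi3 := integrable_quad h₂ hdi hai
  -- The splitting q₂r² − q₂'r'² = (q₂ − q₂')r'² + q₂(r − r')(r + r') isolates the change of data
  -- from a term proportional to r − r'.
  have hrep : (fun ξ => R ξ - R' ξ) = fun ξ => (𝓕 (fun x => q₁ x - q₁' x) ξ +
      (𝓕 (fun x => (q₂ x - q₂' x) * 𝓕⁻ R' x * 𝓕⁻ R' x) ξ +
      𝓕 (fun x => q₂ x * 𝓕⁻ (fun ξ => R ξ - R' ξ) x * 𝓕⁻ (fun ξ => R ξ + R' ξ) x) ξ)) /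
        symb a ξ := by
    ext ξ
    rw [← fourier_add_apply hi2 hi3, fourier_sub_apply h₁.integrable h₁'.integrable, h.eq ξ,
      h'.eq ξ, ← sub_div]
    congr 1
    have e := fourier_sub_apply (integrable_quad h₂ h.integrable h.integrable)
      (integrable_quad h₂' h'.integrable h'.integrable) ξ
    rw [show (𝓕 q₁ ξ + 𝓕 (fun x => q₂ x * 𝓕⁻ R x * 𝓕⁻ R x) ξ - (𝓕 q₁' ξ +
      𝓕 (fun x => q₂' x * 𝓕⁻ R' x * 𝓕⁻ R' x) ξ)) = 𝓕 q₁ ξ - 𝓕 q₁' ξ +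
      (𝓕 (fun x => q₂ x * 𝓕⁻ R x * 𝓕⁻ R x) ξ - 𝓕 (fun x => q₂' x * 𝓕⁻ R' x * 𝓕⁻ R' x) ξ) by ring,
      ← e]
    refine congrArg (fun F : ℝ → ℂ => 𝓕 q₁ ξ - 𝓕 q₁' ξ + 𝓕 F ξ) (funext fun x => ?_)
    rw [hs2, ha2]
    ring
  have e1 := wnorm_wK_fourier_mul_mul_le hk hq2 h'.integrable h'.integrable
  have e2 := wnorm_wK_fourier_mul_mul_le hk h₂.integrable hdi hai
  have key : W ≤ 2 * (wnorm (wK k) (𝓕 fun x => q₁ x - q₁' x) +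
      (144 * wnorm (wK k) (𝓕 fun x => q₂ x - q₂' x) * ENNReal.ofReal (1 / 25) *
        ENNReal.ofReal (1 / 25) + 144 * ENNReal.ofReal (1 / 100) * W * ENNReal.ofReal (2 / 25))) := by
    rw [hW, hrep]
    refine (wnorm_div_symb_le ha _).trans ?_
    rw [← hkdef]
    gcongr
    refine (wnorm_add_le (continuous_wK hk) (continuous_fourier hi1).aestronglyMeasurable
      ((continuous_fourier hi2).add (continuous_fourier hi3)).aestronglyMeasurable).trans ?_
    gcongr
    refine (wnorm_add_le (continuous_wK hk) (continuous_fourier hi2).aestronglyMeasurable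
      (continuous_fourier hi3).aestronglyMeasurable).trans ?_
    refine add_le_add (e1.trans ?_) (e2.trans ?_)
    · gcongr
    · rw [← hrep]
      gcongr
  -- The coefficient of W on the right of `key` is 2 · 144 · (1/100) · (2/25) = 0.2304 < 1, so it
  -- can be absorbed.
  set A := wnorm (wK k) (𝓕 fun x => q₁ x - q₁' x)
  set B := wnorm (wK k) (𝓕 fun x => q₂ x - q₂' x)
  by_cases hA : A = ⊤
  · simp [hA]
  by_cases hB : B = ⊤
  · simp [hB]
  clear_value A B W
  clear hW hrep e1 e2
  lift W to NNReal using hWfin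
  lift A to NNReal using hA
  lift B to NNReal using hB
  simp only [ENNReal.ofReal] at key
  norm_cast at key ⊢
  rw [← NNReal.coe_le_coe] at key ⊢
  push_cast at key ⊢
  simp only [Real.coe_toNNReal', one_div] at key
  norm_num at key
  have := A.coe_nonneg
  have := B.coe_nonneg
  have := W.coe_nonneg
  linarith

/-- The inverse Fourier transform of a solution satisfies the Riccati equation pointwise. -/
lemma IsRiccati.hasDerivAt {a : ℝ} (ha : a ≠ 0) {q₁ q₂ R : ℝ → ℂ} (h₁ : IsWiener q₁)
    (h₂ : IsWiener q₂) (h : IsRiccati a q₁ q₂ R) (x : ℝ) :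
    HasDerivAt (𝓕⁻ R) (q₁ x + q₂ x * 𝓕⁻ R x ^ 2 - a * 𝓕⁻ R x) x := by
  have hw := (h₂.mul_fourierInv h.integrable).mul_fourierInv h.integrable
  set g : ℝ → ℂ := fun x => q₁ x + q₂ x * 𝓕⁻ R x * 𝓕⁻ R x with hg
  have hgi : Integrable g := h₁.integrable.add hw.integrable
  have hgF : 𝓕 g = fun ξ => symb a ξ * R ξ := by
    ext ξ
    rw [h.eq ξ, mul_div_cancel₀ _ (symb_ne_zero a ξ ha)]
    exact fourier_add_apply h₁.integrable hw.integrable ξ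
  have hgFi : Integrable (𝓕 g) := by
    have : 𝓕 g = fun ξ => 𝓕 q₁ ξ + 𝓕 (fun x => q₂ x * 𝓕⁻ R x * 𝓕⁻ R x) ξ :=
      funext fun ξ => fourier_add_apply h₁.integrable hw.integrable ξ
    rw [this]
    exact h₁.fourier.add hw.fourier
  have hinv : 𝓕⁻ (𝓕 g) = g :=
    (h₁.continuous.add hw.continuous).fourierInv_fourier_eq hgi hgFi
  -- Integrability of ξR, which permits differentiation of the inverse transform, is read off the
  -- equation itself: `symb a ξ` · R is the integrable function 𝓕 g.
  have hξ : (fun ξ : ℝ => (2 * Real.pi * Complex.I * ξ) * R ξ) = fun ξ => 𝓕 g ξ - a * R ξ := by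
    ext ξ
    rw [hgF]
    simp only [symb]
    ring
  have hξi : Integrable fun ξ : ℝ => (2 * Real.pi * Complex.I * ξ) * R ξ := by
    rw [hξ]
    exact hgFi.sub (h.integrable.const_mul _)
  have hxi : Integrable fun ξ : ℝ => ξ • R ξ := by
    have := hξi.const_mul (2 * Real.pi * Complex.I)⁻¹
    refine this.congr (Filter.Eventually.of_forall fun ξ => ?_)
    have h0 : (2 * Real.pi * Complex.I : ℂ) ≠ 0 := by simp [Real.pi_ne_zero]
    simp only [Complex.real_smul]
    field_simp
  have hd := Real.hasDerivAt_fourier h.integrable hxi (-x)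
  have hd2 := HasDerivAt.scomp x hd (hasDerivAt_neg x)
  have e1 : (𝓕 R) ∘ (fun y => -y) = 𝓕⁻ R := funext fun y => (Real.fourierInv_eq_fourier_neg R y).symm
  have e1' : (𝓕 R) ∘ (Neg.neg) = 𝓕⁻ R := e1
  rw [e1'] at hd2
  refine hd2.congr_deriv ?_
  have e2 : (fun ξ : ℝ => (-2 * Real.pi * Complex.I * ξ : ℂ) • R ξ) =
      fun ξ : ℝ => (-1) * ((2 * Real.pi * Complex.I * ξ) * R ξ) := by
    ext ξ; simp only [smul_eq_mul]; ring
  rw [e2, fourier_const_mul_apply, hξ, fourier_sub_apply hgFi (h.integrable.const_mul _),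
    fourier_const_mul_apply, ← Real.fourierInv_eq_fourier_neg, ← Real.fourierInv_eq_fourier_neg,
    hinv]
  simp only [hg, neg_smul, one_smul]
  ring

lemma tendsto_fourierInv_cocompact (R : ℝ → ℂ) :
    Filter.Tendsto (𝓕⁻ R) (Filter.cocompact ℝ) (nhds 0) := by
  rw [Real.fourierInv_eq_fourier_comp_neg]
  exact Real.zero_at_infty_fourier _

/-! ### Conjugation and unimodular factors. -/

lemma fourier_conj_apply (f : ℝ → ℂ) (ξ : ℝ) :
    𝓕 (fun x => (starRingEnd ℂ) (f x)) ξ = (starRingEnd ℂ) (𝓕 f (-ξ)) := by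
  rw [Real.fourier_real_eq, Real.fourier_real_eq, ← integral_conj]
  refine integral_congr_ae (Filter.Eventually.of_forall fun x => ?_)
  simp only [Circle.smul_def, smul_eq_mul, map_mul]
  rw [← Circle.coe_inv_eq_conj, ← AddChar.map_neg_eq_inv]
  congr 3
  ring

lemma integrable_conj {f : ℝ → ℂ} (hf : Integrable f) :
    Integrable fun x => (starRingEnd ℂ) (f x) :=
  hf.mono (Complex.continuous_conj.comp_aestronglyMeasurable hf.aestronglyMeasurable)
    (Filter.Eventually.of_forall fun _ => (RCLike.norm_conj _).le)

lemma wnorm_fourier_conj {w : ℝ → ℝ} (hw : Continuous w) (hev : ∀ ξ, w (-ξ) = w ξ) {f : ℝ → ℂ}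
    (hf : Integrable f) : wnorm w (𝓕 fun x => (starRingEnd ℂ) (f x)) = wnorm w (𝓕 f) := by
  have hc : Continuous fun ξ => (w ξ : ℂ) * 𝓕 f ξ := by
    have := continuous_fourier hf
    fun_prop
  have := eLpNorm_comp_measurePreserving (p := 2) hc.aestronglyMeasurable
    (Measure.measurePreserving_neg (volume : Measure ℝ))
  rw [wnorm, wnorm, ← this]
  refine eLpNorm_congr_norm_ae (Filter.Eventually.of_forall fun ξ => ?_)
  simp only [Function.comp_apply, norm_mul, hev, fourier_conj_apply, RCLike.norm_conj]

lemma wnorm_fourier_const_mul {w : ℝ → ℝ} {c : ℂ} (hc : ‖c‖ = 1) (f : ℝ → ℂ) :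
    wnorm w (𝓕 fun x => c * f x) = wnorm w (𝓕 f) := by
  refine eLpNorm_congr_norm_ae (Filter.Eventually.of_forall fun ξ => ?_)
  simp [fourier_const_mul_apply, hc]

lemma IsWiener.conj {q : ℝ → ℂ} (hq : IsWiener q) : IsWiener fun x => (starRingEnd ℂ) (q x) where
  continuous := Complex.continuous_conj.comp hq.continuous
  integrable := integrable_conj hq.integrable
  fourier := by
    have h : 𝓕 (fun x => (starRingEnd ℂ) (q x)) = fun ξ => (starRingEnd ℂ) (𝓕 q (-ξ)) :=
      funext fun ξ => fourier_conj_apply q ξ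
    rw [h]
    exact integrable_conj hq.fourier.comp_neg

lemma IsWiener.const_mul {q : ℝ → ℂ} (hq : IsWiener q) (c : ℂ) : IsWiener fun x => c * q x where
  continuous := hq.continuous.const_mul c
  integrable := hq.integrable.const_mul c
  fourier := by
    have h : 𝓕 (fun x => c * q x) = fun ξ => c * 𝓕 q ξ :=
      funext fun ξ => fourier_const_mul_apply c q ξ
    rw [h]
    exact hq.fourier.const_mul c

/-! ### Wronskian and zero-curvature identities. -/

lemma one_add_ne_zero_of_norm_le {z : ℂ} (hz : ‖z‖ ≤ 1 / 2) : 1 + z ≠ 0 := by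
  intro h
  have : z = -1 := by linear_combination h
  rw [this] at hz
  norm_num at hz

lemma norm_inv_one_add_le {z : ℂ} (hz : ‖z‖ ≤ 1 / 2) : ‖(1 + z)⁻¹‖ ≤ 2 := by
  have h1 : 1 - ‖z‖ ≤ ‖1 + z‖ := by
    have := norm_sub_norm_le (1 : ℂ) (-z)
    simpa using this
  rw [norm_inv]
  exact inv_le_of_inv_le₀ (by norm_num) (by linarith)

lemma norm_mul_le_half {z w : ℂ} (hz : ‖z‖ ≤ 1 / 2) (hw : ‖w‖ ≤ 1 / 2) : ‖z * w‖ ≤ 1 / 2 := by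
  rw [norm_mul]
  nlinarith [norm_nonneg z, norm_nonneg w]

/-- A continuous function bounded by `1 / 2` and vanishing at infinity. -/
structure IsDecaying (r : ℝ → ℂ) : Prop where
  continuous : Continuous r
  bound : ∀ x, ‖r x‖ ≤ 1 / 2
  zero : Filter.Tendsto r (Filter.cocompact ℝ) (nhds 0)

lemma integrable_mul_decaying {f r : ℝ → ℂ} (hf : Integrable f) (hr : IsDecaying r) :
    Integrable fun x => f x * r x :=
  hf.mul_bdd (c := 1 / 2) hr.continuous.aestronglyMeasurable
    (Filter.Eventually.of_forall hr.bound)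

lemma integrable_div_one_add {f r p : ℝ → ℂ} (hf : Integrable f) (hr : IsDecaying r)
    (hp : IsDecaying p) : Integrable fun x => f x / (1 + p x * r x) := by
  have hb : ∀ x, ‖p x * r x‖ ≤ 1 / 2 := fun x => norm_mul_le_half (hp.bound x) (hr.bound x)
  have hc : Continuous fun x => (1 + p x * r x)⁻¹ :=
    (continuous_const.add (hp.continuous.mul hr.continuous)).inv₀
      fun x => one_add_ne_zero_of_norm_le (hb x)
  exact hf.mul_bdd (c := 2) hc.aestronglyMeasurable
    (Filter.Eventually.of_forall fun x => norm_inv_one_add_le (hb x))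

lemma integral_eq_zero_of_tendsto_cocompact {f f' : ℝ → ℂ} {m : ℂ}
    (hd : ∀ x, HasDerivAt f (f' x) x) (hi : Integrable f')
    (hm : Filter.Tendsto f (Filter.cocompact ℝ) (nhds m)) : ∫ x, f' x = 0 := by
  rw [integral_of_hasDerivAt_of_tendsto hd hi (hm.mono_left atBot_le_cocompact)
    (hm.mono_left atTop_le_cocompact), sub_self]

/-- The logarithmic derivative of the Wronskian of Jost solutions for two potentials. -/
lemma integral_wronskian {ε κ : ℝ} {q q' r p : ℝ → ℂ} (hq : Integrable q)
    (hq' : Integrable q')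
    (hr : IsDecaying r) (hp : IsDecaying p)
    (hdr : ∀ x, HasDerivAt r (q x - ε * (starRingEnd ℂ) (q x) * r x ^ 2 - 2 * κ * r x) x)
    (hdp : ∀ x, HasDerivAt p (-ε * (starRingEnd ℂ) (q' x) + q' x * p x ^ 2 + 2 * κ * p x) x) :
    ∫ x, (ε * (starRingEnd ℂ) (q x) * r x - q' x * p x) =
      ∫ x, ((q x - q' x) * p x + ε * (starRingEnd ℂ) (q x - q' x) * r x) / (1 + p x * r x) := by
  have hb : ∀ x, ‖p x * r x‖ ≤ 1 / 2 := fun x => norm_mul_le_half (hp.bound x) (hr.bound x)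
  have hcj : Integrable fun x => (starRingEnd ℂ) (q x) := integrable_conj hq
  have hcj2 : Integrable fun x => (starRingEnd ℂ) (q x - q' x) := integrable_conj (hq.sub hq')
  have i1 : Integrable fun x => ε * (starRingEnd ℂ) (q x) * r x - q' x * p x :=
    (integrable_mul_decaying (hcj.const_mul _) hr).sub (integrable_mul_decaying hq' hp)
  have i2 : Integrable fun x => ((q x - q' x) * p x + ε * (starRingEnd ℂ) (q x - q' x) * r x) /
      (1 + p x * r x) :=
    integrable_div_one_add ((integrable_mul_decaying (hq.sub hq') hp).add
      (integrable_mul_decaying (hcj2.const_mul _) hr)) hr hp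
  -- In the derivative of pr the terms ±2κpr cancel, which is why r and p use opposite signs of κ.
  -- The bound |pr| < 1 keeps 1 + pr in the slit plane, so the principal logarithm is smooth and
  -- vanishes at both ends of the line.
  have hd : ∀ x, HasDerivAt (fun x => Complex.log (1 + p x * r x))
      (((q x - q' x) * p x + ε * (starRingEnd ℂ) (q x - q' x) * r x) / (1 + p x * r x) -
        (ε * (starRingEnd ℂ) (q x) * r x - q' x * p x)) x := by
    intro x
    have hne := one_add_ne_zero_of_norm_le (hb x)
    have hsl : 1 + p x * r x ∈ Complex.slitPlane :=
      Complex.mem_slitPlane_of_norm_lt_one ((hb x).trans_lt (by norm_num))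
    refine (((hdp x).mul (hdr x)).const_add 1).clog_real hsl |>.congr_deriv ?_
    simp only [Pi.mul_apply]
    rw [div_sub' hne, div_left_inj' hne]
    simp only [map_sub]
    ring
  have ht : Filter.Tendsto (fun x => Complex.log (1 + p x * r x)) (Filter.cocompact ℝ)
      (nhds (Complex.log (1 + 0 * 0))) :=
    ((hp.zero.mul hr.zero).const_add 1).clog (by simp)
  have := integral_eq_zero_of_tendsto_cocompact hd (i2.sub i1) ht
  rw [integral_sub i2 i1] at this
  linear_combination -this

/-- Data of a zero-curvature equation for the potential `q` with time derivative `v`. -/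
structure ZeroCurvature (ε κ : ℝ) (q v A B C : ℝ → ℂ) : Prop where
  deriv_A : ∀ x, HasDerivAt A (q x * C x - ε * (starRingEnd ℂ) (q x) * B x) x
  deriv_B : ∀ x, HasDerivAt B (v x - 2 * κ * B x - 2 * A x * q x) x
  deriv_C : ∀ x, HasDerivAt C
    (ε * (starRingEnd ℂ) (v x) + 2 * κ * C x + 2 * ε * A x * (starRingEnd ℂ) (q x)) x
  tendsto_A : ∃ A₀, Filter.Tendsto A (Filter.cocompact ℝ) (nhds A₀)
  tendsto_B : Filter.Tendsto B (Filter.cocompact ℝ) (nhds 0)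
  tendsto_C : Filter.Tendsto C (Filter.cocompact ℝ) (nhds 0)

/-- The integrand is the derivative of (A(pr − 1) + Bp + Cr)/(1 + pr), which tends to −A₀ at both
ends. The integral is the formal time derivative of the energy. -/
lemma ZeroCurvature.integral_eq_zero {ε κ : ℝ} {q v A B C r p : ℝ → ℂ}
    (h : ZeroCurvature ε κ q v A B C) (hv : Integrable v)
    (hr : IsDecaying r) (hp : IsDecaying p)
    (hdr : ∀ x, HasDerivAt r (q x - ε * (starRingEnd ℂ) (q x) * r x ^ 2 - 2 * κ * r x) x)
    (hdp : ∀ x, HasDerivAt p (-ε * (starRingEnd ℂ) (q x) + q x * p x ^ 2 + 2 * κ * p x) x) :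
    ∫ x, (v x * p x + ε * (starRingEnd ℂ) (v x) * r x) / (1 + p x * r x) = 0 := by
  have hb : ∀ x, ‖p x * r x‖ ≤ 1 / 2 := fun x => norm_mul_le_half (hp.bound x) (hr.bound x)
  have hcj : Integrable fun x => (starRingEnd ℂ) (v x) := integrable_conj hv
  have hi : Integrable fun x => (v x * p x + ε * (starRingEnd ℂ) (v x) * r x) / (1 + p x * r x) :=
    integrable_div_one_add ((integrable_mul_decaying hv hp).add
      (integrable_mul_decaying (hcj.const_mul _) hr)) hr hp
  obtain ⟨A₀, hA₀⟩ := h.tendsto_A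
  refine integral_eq_zero_of_tendsto_cocompact
    (f := fun x => (A x * (p x * r x - 1) + B x * p x + C x * r x) / (1 + p x * r x))
    (m := (A₀ * (0 * 0 - 1) + 0 * 0 + 0 * 0) / (1 + 0 * 0)) (fun x => ?_) hi ?_
  · have hne := one_add_ne_zero_of_norm_le (hb x)
    refine (((((h.deriv_A x).mul (((hdp x).mul (hdr x)).sub_const 1)).add
      ((h.deriv_B x).mul (hdp x))).add ((h.deriv_C x).mul (hdr x))).div
      (((hdp x).mul (hdr x)).const_add 1) hne).congr_deriv ?_
    simp only [Pi.mul_apply, Pi.add_apply]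
    rw [div_eq_div_iff (pow_ne_zero 2 hne) hne]
    ring
  · have hpr := hp.zero.mul hr.zero
    exact (((hA₀.mul (hpr.sub_const 1)).add (h.tendsto_B.mul hp.zero)).add
      (h.tendsto_C.mul hr.zero)).div (hpr.const_add 1) (by simp)

/-! ### Conservation of the Jost energy along a Lax flow. -/

lemma SchwartzMap.isWiener (f : 𝓢(ℝ, ℂ)) : IsWiener f where
  continuous := f.continuous
  integrable := f.integrable
  fourier := by
    rw [← SchwartzMap.fourier_coe]
    exact (𝓕 f).integrable

/-- The logarithm is dominated by a square root. This lets continuity in L² pass to the `wK` norm.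
-/
lemma wK_le_const {k : ℝ} (hk : 0 < k) (ξ : ℝ) : wK k ξ ≤ 2 / Real.sqrt k := by
  have h1 := one_le_freqH hk ξ
  have hs := Real.sqrt_pos.2 hk
  have hsh : 0 < Real.sqrt (freqH k ξ) := Real.sqrt_pos.2 (by linarith)
  have hl : freqL k ξ ≤ 2 * Real.sqrt (freqH k ξ) := by
    have := Real.log_le_sub_one_of_pos hsh
    have h2 : Real.log (freqH k ξ) = 2 * Real.log (Real.sqrt (freqH k ξ)) := by
      rw [Real.log_sqrt (by linarith)]; ring
    unfold freqL
    linarith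
  rw [wK, Real.sqrt_mul hk.le, div_le_div_iff₀ (by positivity) hs]
  nlinarith

lemma wnorm_wK_le_L2 {k : ℝ} (hk : 0 < k) (G : ℝ → ℂ) :
    wnorm (wK k) G ≤ ENNReal.ofReal (2 / Real.sqrt k) * eLpNorm G 2 volume := by
  have h := wnorm_const_mul (2 / Real.sqrt k) (by positivity) (fun _ => 1) G
  have h1 : wnorm (fun _ => 1) G = eLpNorm G 2 volume := by simp [wnorm]
  rw [← h1, ← h]
  refine eLpNorm_mono fun ξ => ?_
  have h2 := wK_le_const hk ξ
  rw [norm_mul, norm_mul, Complex.norm_real, Real.norm_of_nonneg (wK_pos hk ξ).le]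
  gcongr
  rw [← Complex.ofReal_mul, Complex.norm_real, Real.norm_of_nonneg (by positivity), mul_one]
  exact h2

lemma tendsto_eLpNorm_fourier_sub {q : ℝ → 𝓢(ℝ, ℂ)} (hq : Continuous q) (t : ℝ) :
    Filter.Tendsto (fun s => eLpNorm (𝓕 fun x => q s x - q t x) 2 volume) (nhds t) (nhds 0) := by
  have h1 : ∀ s, eLpNorm (𝓕 fun x => q s x - q t x) 2 volume =
      ENNReal.ofReal ‖(q s - q t).toLp 2 (volume : Measure ℝ)‖ := fun s => by
    rw [← SchwartzMap.norm_fourier_toL2_eq, SchwartzMap.norm_toLp,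
      ENNReal.ofReal_toReal ((𝓕 (q s - q t)).eLpNorm_lt_top 2 volume).ne]
    congr 1
  simp_rw [h1]
  have hc : Continuous fun s => ‖(q s - q t).toLp 2 (volume : Measure ℝ)‖ :=
    ((SchwartzMap.continuous_toLp (p := 2)).comp (hq.sub continuous_const)).norm
  have h2 := (ENNReal.continuous_ofReal.comp hc).tendsto t
  have h0 : ENNReal.ofReal ‖(q t - q t).toLp 2 (volume : Measure ℝ)‖ = 0 := by
    rw [sub_self, ← SchwartzMap.toLpCLM_apply (𝕜 := ℝ), map_zero, norm_zero, ENNReal.ofReal_zero]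
  rw [← h0]
  exact h2

/-- A curve of Schwartz functions with time derivative `v` which satisfies, at every time, a zero
curvature equation with spectral parameter `κ`. -/
structure IsLaxFlow (ε κ : ℝ) (q : ℝ → 𝓢(ℝ, ℂ)) (v : ℝ → ℝ → ℂ) : Prop where
  continuous : Continuous q
  hasDerivAt : ∀ t x, HasDerivAt (fun s => q s x) (v t x) t
  measurable : ∀ t, AEStronglyMeasurable (v t)
  bound : ∀ t, ∃ M, ∀ s ∈ Set.Icc (t - 1) (t + 1), ∀ x, ‖v s x‖ ≤ M * (1 + x ^ 2)⁻¹
  zeroCurvature : ∀ t, ∃ A B C, ZeroCurvature ε κ (q t) (v t) A B C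

/-- `R` and `P` are small solutions of the two Riccati equations associated with `q`. -/
structure IsJostPair (ε κ : ℝ) (q R P : ℝ → ℂ) : Prop where
  left : IsRiccati (2 * κ) q (fun x => -ε * (starRingEnd ℂ) (q x)) R
  right : IsRiccati (-(2 * κ)) (fun x => -ε * (starRingEnd ℂ) (q x)) q P
  left_le : wnorm (wZ (2 * κ)) R ≤ ENNReal.ofReal (1 / 25)
  right_le : wnorm (wZ (2 * κ)) P ≤ ENNReal.ofReal (1 / 25)

lemma isDecaying_of_isRiccati {k : ℝ} (hk : 0 < k) {R : ℝ → ℂ} (hi : Integrable R)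
    (hR : wnorm (wZ k) R ≤ ENNReal.ofReal (1 / 25)) : IsDecaying (𝓕⁻ R) where
  continuous := continuous_fourierInv hi
  bound := fun x => (norm_fourierInv_le_wnorm hk hi (by norm_num) hR x).trans (by norm_num)
  zero := tendsto_fourierInv_cocompact R

section JostPair

variable {ε κ : ℝ} {q R P : ℝ → ℂ}

lemma IsJostPair.decaying_left (h : IsJostPair ε κ q R P) (hκ : 0 < κ) : IsDecaying (𝓕⁻ R) :=
  isDecaying_of_isRiccati (by positivity : 0 < 2 * κ) h.left.integrable h.left_le

lemma IsJostPair.decaying_right (h : IsJostPair ε κ q R P) (hκ : 0 < κ) : IsDecaying (𝓕⁻ P) :=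
  isDecaying_of_isRiccati (by positivity : 0 < 2 * κ) h.right.integrable h.right_le

lemma IsJostPair.hasDerivAt_left (h : IsJostPair ε κ q R P) (hκ : 0 < κ) (hq : IsWiener q) (x : ℝ) :
    HasDerivAt (𝓕⁻ R) (q x - ε * (starRingEnd ℂ) (q x) * 𝓕⁻ R x ^ 2 - 2 * κ * 𝓕⁻ R x) x := by
  refine (h.left.hasDerivAt (by positivity) hq (hq.conj.const_mul _) x).congr_deriv ?_
  push_cast
  ring

lemma IsJostPair.hasDerivAt_right (h : IsJostPair ε κ q R P) (hκ : 0 < κ) (hq : IsWiener q)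
    (x : ℝ) :
    HasDerivAt (𝓕⁻ P) (-ε * (starRingEnd ℂ) (q x) + q x * 𝓕⁻ P x ^ 2 + 2 * κ * 𝓕⁻ P x) x := by
  refine (h.right.hasDerivAt (neg_ne_zero.2 (by positivity)) (hq.conj.const_mul _) hq x).congr_deriv ?_
  push_cast
  ring

end JostPair

/-- The leading-order logarithm of the transmission coefficient, `∫ ε q̄ r`. -/
def jostEnergy (ε : ℝ) (q R : ℝ → ℂ) : ℂ := ∫ x, ε * (starRingEnd ℂ) (q x) * 𝓕⁻ R x

/-- The Wronskian identity for the pair (q, q') is compared with the one for (q', q'), which says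
that the energy of q' computed from r' equals the one computed from p'. The result is exact and
contains q − q' as an explicit factor. -/
lemma jostEnergy_sub {ε κ : ℝ} (hκ : 0 < κ) {q R P q' R' P' : ℝ → ℂ} (hq : IsWiener q)
    (hq' : IsWiener q') (h : IsJostPair ε κ q R P) (h' : IsJostPair ε κ q' R' P') :
    jostEnergy ε q R - jostEnergy ε q' R' =
      ∫ x, ((q x - q' x) * 𝓕⁻ P' x + ε * (starRingEnd ℂ) (q x - q' x) * 𝓕⁻ R x) /
        (1 + 𝓕⁻ P' x * 𝓕⁻ R x) := by
  have e1 := integral_wronskian hq.integrable hq'.integrable (h.decaying_left hκ)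
    (h'.decaying_right hκ) (h.hasDerivAt_left hκ hq) (h'.hasDerivAt_right hκ hq')
  have e2 := integral_wronskian hq'.integrable hq'.integrable (h'.decaying_left hκ)
    (h'.decaying_right hκ) (h'.hasDerivAt_left hκ hq') (h'.hasDerivAt_right hκ hq')
  simp only [sub_self, zero_mul, map_zero, mul_zero, add_zero, zero_div, integral_zero] at e2
  have i1 := integrable_mul_decaying ((integrable_conj hq.integrable).const_mul (ε : ℂ))
    (h.decaying_left hκ)
  have i1' := integrable_mul_decaying ((integrable_conj hq'.integrable).const_mul (ε : ℂ))
    (h'.decaying_left hκ)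
  have i2 := integrable_mul_decaying hq'.integrable (h'.decaying_right hκ)
  rw [← e1, jostEnergy, jostEnergy, integral_sub i1 i2]
  rw [integral_sub i1' i2] at e2
  linear_combination -e2

lemma norm_quotient_le {δ p r : ℂ} {ε : ℝ} (hε : |ε| = 1) (hp : ‖p‖ ≤ 1 / 2) (hr : ‖r‖ ≤ 1 / 2) :
    ‖(δ * p + ε * (starRingEnd ℂ) δ * r) / (1 + p * r)‖ ≤ 2 * ‖δ‖ := by
  have hi := norm_inv_one_add_le (norm_mul_le_half hp hr)
  rw [div_eq_mul_inv, norm_mul]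
  have h1 : ‖δ * p + ε * (starRingEnd ℂ) δ * r‖ ≤ ‖δ‖ := by
    refine (norm_add_le _ _).trans ?_
    rw [norm_mul, norm_mul, norm_mul, RCLike.norm_conj, Complex.norm_real, Real.norm_eq_abs, hε]
    nlinarith [norm_nonneg δ]
  nlinarith [norm_nonneg (1 + p * r)⁻¹, norm_nonneg δ]

/-- The explicit factor q(s) − q(t) in `jostEnergy_sub` carries the whole difference quotient, so
mere continuity of r in time suffices for the limit, and the limit is the integral that zero
curvature annihilates. -/
theorem IsLaxFlow.hasDerivWithinAt_jostEnergy {ε κ : ℝ} (hε : |ε| = 1) (hκ : 0 < κ)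
    {q : ℝ → 𝓢(ℝ, ℂ)} {v : ℝ → ℝ → ℂ} (hflow : IsLaxFlow ε κ q v) {J : Set ℝ} {R P : ℝ → ℝ → ℂ}
    (hK : ∀ t ∈ J, wnorm (wK (2 * κ)) (𝓕 (q t : ℝ → ℂ)) ≤ ENNReal.ofReal (1 / 100))
    (hRP : ∀ t ∈ J, IsJostPair ε κ (q t) (R t) (P t)) {t : ℝ} (ht : t ∈ J) :
    HasDerivWithinAt (fun t => jostEnergy ε (q t) (R t)) 0 J t := by
  have hk : (0:ℝ) < 2 * κ := by positivity
  have hkabs : |2 * κ| = 2 * κ := abs_of_pos hk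
  have hp := (hRP t ht).decaying_right hκ
  set p := 𝓕⁻ (P t) with hpdef
  have hr : ∀ s ∈ J, IsDecaying (𝓕⁻ (R s)) := fun s hs => (hRP s hs).decaying_left hκ
  obtain ⟨M, hM⟩ := hflow.bound t
  have hvi : Integrable (v t) := by
    refine (integrable_inv_one_add_sq.const_mul M).mono' (hflow.measurable t)
      (Filter.Eventually.of_forall fun x => hM t ⟨by linarith, by linarith⟩ x)
  obtain ⟨A, B, C, hzc⟩ := hflow.zeroCurvature t
  have hzero := hzc.integral_eq_zero hvi (hr t ht) hp
    ((hRP t ht).hasDerivAt_left hκ (q t).isWiener) ((hRP t ht).hasDerivAt_right hκ (q t).isWiener)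
  rw [hasDerivWithinAt_iff_tendsto_slope, ← hzero]
  have hJ : ∀ᶠ s in nhdsWithin t (J \ {t}), s ∈ J :=
    Filter.mem_of_superset self_mem_nhdsWithin Set.sdiff_subset
  have hne : ∀ᶠ s in nhdsWithin t (J \ {t}), s ≠ t :=
    Filter.mem_of_superset self_mem_nhdsWithin fun s hs => hs.2
  have hnear : ∀ᶠ s in nhdsWithin t (J \ {t}), s ∈ Set.Icc (t - 1) (t + 1) :=
    nhdsWithin_le_nhds (Icc_mem_nhds (by linarith) (by linarith))
  have hslope : ∀ᶠ s in nhdsWithin t (J \ {t}),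
      ∫ x, (((s - t : ℝ) : ℂ)⁻¹ * (q s x - q t x) * p x + ε * (starRingEnd ℂ)
        (((s - t : ℝ) : ℂ)⁻¹ * (q s x - q t x)) * 𝓕⁻ (R s) x) / (1 + p x * 𝓕⁻ (R s) x) =
      slope (fun t => jostEnergy ε (q t) (R t)) t s := by
    filter_upwards [hJ] with s hs
    rw [slope_def_module, jostEnergy_sub hκ (q s).isWiener (q t).isWiener (hRP s hs) (hRP t ht),
      ← integral_smul]
    refine integral_congr_ae (Filter.Eventually.of_forall fun x => ?_)
    simp only [Complex.real_smul, map_mul, map_inv₀, Complex.conj_ofReal, Complex.ofReal_inv]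
    ring
  refine Filter.Tendsto.congr' hslope ?_
  refine tendsto_integral_filter_of_dominated_convergence (fun x => 2 * (M * (1 + x ^ 2)⁻¹)) ?_ ?_
    ((integrable_inv_one_add_sq.const_mul M).const_mul 2) ?_
  · filter_upwards [hJ] with s hs
    have c1 := (hr s hs).continuous
    have c2 := hp.continuous
    have c3 := (q s).continuous
    have c4 := (q t).continuous
    refine Continuous.aestronglyMeasurable (Continuous.div (by fun_prop) (by fun_prop) fun x => ?_)
    exact one_add_ne_zero_of_norm_le (norm_mul_le_half (hp.bound x) ((hr s hs).bound x))
  · filter_upwards [hJ, hne, hnear] with s hs hst hsn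
    refine Filter.Eventually.of_forall fun x => ?_
    refine (norm_quotient_le hε (hp.bound x) ((hr s hs).bound x)).trans ?_
    gcongr
    -- The mean value inequality in time turns the bound on the time derivative into an integrable
    -- majorant for the difference quotients.
    have hmv := (convex_Icc (t - 1) (t + 1)).norm_image_sub_le_of_norm_hasDerivWithin_le
      (f := fun s => q s x) (C := M * (1 + x ^ 2)⁻¹)
      (fun s _ => (hflow.hasDerivAt s x).hasDerivWithinAt) (fun s hs => hM s hs x)
      (x := t) (y := s) ⟨by linarith, by linarith⟩ hsn
    rw [norm_mul, norm_inv, Complex.norm_real]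
    have h0 : 0 < ‖s - t‖ := norm_pos_iff.2 (sub_ne_zero.2 hst)
    rw [inv_mul_le_iff₀ h0, mul_comm]
    exact hmv
  · refine Filter.Eventually.of_forall fun x => ?_
    have hδ : Filter.Tendsto (fun s => ((s - t : ℝ) : ℂ)⁻¹ * (q s x - q t x))
        (nhdsWithin t (J \ {t})) (nhds (v t x)) := by
      have h1 := hasDerivWithinAt_iff_tendsto_slope.1
        ((hflow.hasDerivAt t x).hasDerivWithinAt (s := J))
      refine h1.congr fun s => ?_
      rw [slope_def_module, Complex.real_smul, Complex.ofReal_inv]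
    -- The Lipschitz estimate for the Riccati equation, the boundedness of `wK` and Plancherel
    -- reduce this to continuity of q in L².
    have hrt : Filter.Tendsto (fun s => 𝓕⁻ (R s) x) (nhdsWithin t (J \ {t}))
        (nhds (𝓕⁻ (R t) x)) := by
      rw [tendsto_iff_edist_tendsto_0]
      have hup : Filter.Tendsto (fun s => 8 * (ENNReal.ofReal (2 / Real.sqrt (2 * κ)) *
          eLpNorm (𝓕 fun x => q s x - q t x) 2 volume)) (nhdsWithin t (J \ {t})) (nhds 0) := by
        have := (tendsto_eLpNorm_fourier_sub hflow.continuous t).mono_left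
          (nhdsWithin_le_nhds (s := J \ {t}))
        have h2 := ENNReal.Tendsto.const_mul (a := ENNReal.ofReal (2 / Real.sqrt (2 * κ))) this
          (Or.inr ENNReal.ofReal_ne_top)
        have h3 := ENNReal.Tendsto.const_mul (a := 8) h2 (Or.inr (by simp))
        simpa using h3
      refine tendsto_of_tendsto_of_tendsto_of_le_of_le' tendsto_const_nhds hup
        (Filter.Eventually.of_forall fun _ => zero_le) ?_
      filter_upwards [hJ] with s hs
      have hd : Integrable fun x => q s x - q t x :=
        (q s).integrable.sub (q t).integrable
      have hRs := (hRP s hs).left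
      have hRt := (hRP t ht).left
      have hK2 : wnorm (wK |2 * κ|) (𝓕 fun x => -ε * (starRingEnd ℂ) (q s x)) ≤
          ENNReal.ofReal (1 / 100) := by
        rw [wnorm_fourier_const_mul (by simp [hε]), wnorm_fourier_conj
          (continuous_wK (by rw [hkabs]; exact hk)) (wK_neg _) (q s).integrable, hkabs]
        exact hK s hs
      have hlip := hRs.wnorm_sub_le hk.ne' (q s).isWiener ((q s).isWiener.conj.const_mul _)
        (q t).isWiener ((q t).isWiener.conj.const_mul _) hRt hK2
        (by rw [hkabs]; exact (hRP s hs).left_le) (by rw [hkabs]; exact (hRP t ht).left_le)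
      rw [hkabs] at hlip
      have hB : wnorm (wK (2 * κ)) (𝓕 fun x => -ε * (starRingEnd ℂ) (q s x) -
          -ε * (starRingEnd ℂ) (q t x)) = wnorm (wK (2 * κ)) (𝓕 fun x => q s x - q t x) := by
        rw [← wnorm_fourier_conj (continuous_wK hk) (wK_neg _) hd,
          ← wnorm_fourier_const_mul (c := -ε) (by simp [hε]) fun x => (starRingEnd ℂ) (q s x - q t x)]
        congr 2
        ext x
        simp only [map_sub]
        ring
      rw [hB] at hlip
      rw [edist_eq_enorm_sub, ← fourierInv_sub_apply hRs.integrable hRt.integrable]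
      have hle : ‖𝓕⁻ (fun ξ => R s ξ - R t ξ) x‖ₑ ≤
          wnorm (wZ (2 * κ)) fun ξ => R s ξ - R t ξ := by
        refine le_trans ?_ (lintegral_enorm_le_wnorm hk
          (hRs.integrable.sub hRt.integrable).aestronglyMeasurable.aemeasurable)
        rw [Real.fourierInv_eq]
        refine (enorm_integral_le_lintegral_enorm _).trans (le_of_eq ?_)
        refine lintegral_congr fun ξ => ?_
        rw [← ofReal_norm, ← ofReal_norm, Circle.norm_smul]
      refine hle.trans (hlip.trans ?_)
      rw [← two_mul, ← mul_assoc]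
      norm_num only
      gcongr
      exact wnorm_wK_le_L2 hk _
    have hne0 := one_add_ne_zero_of_norm_le (norm_mul_le_half (hp.bound x) ((hr t ht).bound x))
    exact ((hδ.mul_const _).add ((((Complex.continuous_conj.tendsto _).comp hδ).const_mul _).mul
      hrt)).div ((hrt.const_mul _).const_add 1) hne0

theorem IsLaxFlow.jostEnergy_eq {ε κ : ℝ} (hε : |ε| = 1) (hκ : 0 < κ)
    {q : ℝ → 𝓢(ℝ, ℂ)} {v : ℝ → ℝ → ℂ} (hflow : IsLaxFlow ε κ q v) {J : Set ℝ} (hJ : Convex ℝ J)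
    {R P : ℝ → ℝ → ℂ}
    (hK : ∀ t ∈ J, wnorm (wK (2 * κ)) (𝓕 (q t : ℝ → ℂ)) ≤ ENNReal.ofReal (1 / 100))
    (hRP : ∀ t ∈ J, IsJostPair ε κ (q t) (R t) (P t)) {s t : ℝ} (hs : s ∈ J) (ht : t ∈ J) :
    jostEnergy ε (q s) (R s) = jostEnergy ε (q t) (R t) := by
  have := hJ.norm_image_sub_le_of_norm_hasDerivWithin_le (C := 0)
    (f := fun t => jostEnergy ε (q t) (R t)) (f' := fun _ => 0)
    (fun t ht => hflow.hasDerivWithinAt_jostEnergy hε hκ hK hRP ht) (by simp) ht hs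
  simpa [sub_eq_zero] using this

/-! ### The two equations as Lax flows. -/

/-- The Schwartz seminorms of orders (0,0) and (2,0) are continuous along the curve, hence bounded
on the compact interval. -/
lemma exists_decay_bound {f : ℝ → 𝓢(ℝ, ℂ)} (hf : Continuous f) (t : ℝ) :
    ∃ M, 0 ≤ M ∧ ∀ s ∈ Set.Icc (t - 1) (t + 1), ∀ x, ‖f s x‖ ≤ M * (1 + x ^ 2)⁻¹ := by
  have hc : ∀ p : ℕ × ℕ, Continuous fun s => SchwartzMap.seminorm ℝ p.1 p.2 (f s) := fun p =>
    ((schwartz_withSeminorms ℝ ℝ ℂ).continuous_seminorm p).comp hf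
  obtain ⟨M₀, hM₀⟩ := (isCompact_Icc (a := t - 1) (b := t + 1)).bddAbove_image (hc (0, 0)).continuousOn
  obtain ⟨M₂, hM₂⟩ := (isCompact_Icc (a := t - 1) (b := t + 1)).bddAbove_image (hc (2, 0)).continuousOn
  have key : ∀ s ∈ Set.Icc (t - 1) (t + 1), ∀ x, ‖f s x‖ * (1 + x ^ 2) ≤ M₀ + M₂ := by
    intro s hs x
    have h0 := hM₀ (Set.mem_image_of_mem _ hs)
    have h2 := hM₂ (Set.mem_image_of_mem _ hs)
    have e0 := SchwartzMap.norm_le_seminorm ℝ (f s) x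
    have e2 := SchwartzMap.norm_pow_mul_le_seminorm ℝ (f s) 2 x
    rw [Real.norm_eq_abs, sq_abs] at e2
    simp only at h0 h2
    nlinarith
  refine ⟨M₀ + M₂, ?_, fun s hs x => ?_⟩
  · have := key t ⟨by linarith, by linarith⟩ 0
    refine le_trans ?_ this
    positivity
  · rw [← div_eq_mul_inv, le_div_iff₀ (by positivity)]
    exact key s hs x

lemma norm_cube_le {z : ℂ} {M d : ℝ} (hd : 0 < d) (hd1 : d ≤ 1) (hz : ‖z‖ ≤ M * d) (w : ℂ) {N : ℝ}
    (hw : ‖w‖ ≤ N * d) : ‖((‖z‖ ^ 2 : ℝ) : ℂ) * w‖ ≤ M ^ 2 * N * d := by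
  rw [norm_mul, Complex.norm_real, Real.norm_of_nonneg (by positivity)]
  have h1 : 0 ≤ M * d := (norm_nonneg z).trans hz
  have hM : 0 ≤ M := nonneg_of_mul_nonneg_left h1 hd
  have h2 : ‖z‖ ≤ M := hz.trans (mul_le_of_le_one_right hM hd1)
  calc ‖z‖ ^ 2 * ‖w‖ ≤ M ^ 2 * (N * d) := by gcongr
    _ = _ := by ring

/-- The derivative as a Schwartz function. -/
def schwartzDeriv : 𝓢(ℝ, ℂ) →L[ℝ] 𝓢(ℝ, ℂ) := SchwartzMap.derivCLM ℝ ℂ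

lemma hasDerivAt_schwartz (f : 𝓢(ℝ, ℂ)) (x : ℝ) : HasDerivAt f (schwartzDeriv f x) x :=
  f.hasDerivAt x

lemma coe_schwartzDeriv (f : 𝓢(ℝ, ℂ)) : (schwartzDeriv f : ℝ → ℂ) = deriv f := by
  ext x
  exact SchwartzMap.derivCLM_apply ℝ f x

lemma iteratedDeriv_two_schwartz (f : 𝓢(ℝ, ℂ)) (x : ℝ) :
    iteratedDeriv 2 (fun y => f y) x = schwartzDeriv (schwartzDeriv f) x := by
  rw [iteratedDeriv_succ, iteratedDeriv_one, coe_schwartzDeriv, coe_schwartzDeriv]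

lemma iteratedDeriv_three_schwartz (f : 𝓢(ℝ, ℂ)) (x : ℝ) :
    iteratedDeriv 3 (fun y => f y) x = schwartzDeriv (schwartzDeriv (schwartzDeriv f)) x := by
  rw [iteratedDeriv_succ, iteratedDeriv_succ, iteratedDeriv_one, coe_schwartzDeriv,
    coe_schwartzDeriv, coe_schwartzDeriv]

lemma hasDerivAt_conj {f : ℝ → ℂ} {f' : ℂ} {x : ℝ} (h : HasDerivAt f f' x) :
    HasDerivAt (fun y => (starRingEnd ℂ) (f y)) ((starRingEnd ℂ) f') x := h.star

lemma tendsto_conj_cocompact {f : ℝ → ℂ} (h : Filter.Tendsto f (Filter.cocompact ℝ) (nhds 0)) :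
    Filter.Tendsto (fun x => (starRingEnd ℂ) (f x)) (Filter.cocompact ℝ) (nhds 0) := by
  have := (Complex.continuous_conj.tendsto 0).comp h
  rwa [map_zero] at this

lemma tendsto_cubic_zero {l : Filter ℝ} {a b c d e : ℝ → ℂ} (ha : Filter.Tendsto a l (nhds 0))
    (hb : Filter.Tendsto b l (nhds 0)) (hc : Filter.Tendsto c l (nhds 0))
    (hd : Filter.Tendsto d l (nhds 0)) (he : Filter.Tendsto e l (nhds 0)) (β γ δ : ℂ) :
    Filter.Tendsto (fun x => -a x + β * b x + γ * c x + δ * (d x * e x * c x)) l (nhds 0) := by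
  have := ((ha.neg.add (hb.const_mul β)).add (hc.const_mul γ)).add
    (((hd.mul he).mul hc).const_mul δ)
  simpa only [mul_zero, neg_zero, add_zero] using this

lemma ofReal_norm_sq (z : ℂ) : ((‖z‖ ^ 2 : ℝ) : ℂ) = z * (starRingEnd ℂ) z := by
  rw [Complex.mul_conj, Complex.normSq_eq_norm_sq]

lemma abs_sign_cast (σ : ℤˣ) : |((σ : ℤ) : ℝ)| = 1 := by
  rcases Int.units_eq_one_or σ with h | h <;> simp [h]

lemma one_add_sq_inv_pos (x : ℝ) : 0 < (1 + x ^ 2)⁻¹ := by positivity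

lemma one_add_sq_inv_le_one (x : ℝ) : (1 + x ^ 2)⁻¹ ≤ 1 :=
  inv_le_one_of_one_le₀ (by nlinarith [sq_nonneg x])

/-- The witnesses A, B, C are the AKNS time matrix of degree 2 in κ. The spatial problem is the same
as for Hirota mKdV, so one energy serves both equations. -/
theorem IsSchwartzSolutionNLS.isLaxFlow {σ : ℤˣ} {q : ℝ → 𝓢(ℝ, ℂ)}
    (h : IsSchwartzSolutionNLS σ q) (κ : ℝ) :
    IsLaxFlow ((σ : ℤ) : ℝ) κ q fun t x => deriv (fun s => q s x) t := by
  have heq : ∀ t x, deriv (fun s => q s x) t = -Complex.I * schwartzDeriv (schwartzDeriv (q t)) x +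
      ((σ : ℤ) : ℂ) * (2 * Complex.I) * (((‖q t x‖ ^ 2 : ℝ) : ℂ) * q t x) := by
    intro t x
    have := h.equation t x
    rw [iteratedDeriv_two_schwartz] at this
    linear_combination Complex.I * this + (deriv (fun s => q s x) t) * Complex.I_mul_I
  refine ⟨h.continuous, fun t x => (h.differentiableAt t x).hasDerivAt, fun t => ?_, fun t => ?_,
    fun t => ?_⟩
  · simp_rw [heq]
    have := (q t).continuous
    have := (schwartzDeriv (schwartzDeriv (q t))).continuous
    exact Continuous.aestronglyMeasurable (by fun_prop)
  · obtain ⟨M, hM0, hM⟩ := exists_decay_bound h.continuous t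
    obtain ⟨M₂, hM₂0, hM₂⟩ := exists_decay_bound
      (schwartzDeriv.continuous.comp (schwartzDeriv.continuous.comp h.continuous)) t
    refine ⟨M₂ + 2 * (M ^ 2 * M), fun s hs x => ?_⟩
    rw [heq]
    have e1 := hM₂ s hs x
    have e2 := norm_cube_le (one_add_sq_inv_pos x) (one_add_sq_inv_le_one x) (hM s hs x) (q s x)
      (hM s hs x)
    have hσ : ‖((σ : ℤ) : ℂ)‖ = 1 := by
      rcases Int.units_eq_one_or σ with h | h <;> simp [h]
    refine (norm_add_le _ _).trans ?_
    rw [norm_mul, norm_mul (((σ : ℤ) : ℂ) * (2 * Complex.I)), norm_mul ((σ : ℤ) : ℂ), hσ]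
    simp only [norm_neg, Complex.norm_I, norm_mul, Complex.norm_ofNat, one_mul, mul_one] at e2 ⊢
    simp only [Function.comp_apply] at e1
    linarith
  · set f := q t with hf
    have d0 := hasDerivAt_schwartz f
    have d1 := hasDerivAt_schwartz (schwartzDeriv f)
    have c0 := fun x => hasDerivAt_conj (d0 x)
    have c1 := fun x => hasDerivAt_conj (d1 x)
    have t0 := f.tendsto_cocompact
    have t1 := (schwartzDeriv f).tendsto_cocompact
    have s0 := tendsto_conj_cocompact t0
    have s1 := tendsto_conj_cocompact t1
    refine ⟨fun x => -2 * Complex.I * κ ^ 2 + Complex.I * ((σ : ℤ) : ℝ) * (f x * (starRingEnd ℂ) (f x)),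
      fun x => -Complex.I * schwartzDeriv f x + 2 * Complex.I * κ * f x,
      fun x => ((σ : ℤ) : ℝ) * (Complex.I * (starRingEnd ℂ) (schwartzDeriv f x) +
        2 * Complex.I * κ * (starRingEnd ℂ) (f x)), fun x => ?_, fun x => ?_, fun x => ?_, ?_, ?_, ?_⟩
    · refine ((((d0 x).mul (c0 x)).const_mul (Complex.I * ((σ : ℤ) : ℝ))).const_add
        (-2 * Complex.I * (κ : ℂ) ^ 2)).congr_deriv ?_
      ring
    · refine (((d1 x).const_mul (-Complex.I)).add ((d0 x).const_mul (2 * Complex.I * κ))).congr_deriv ?_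
      rw [heq, ofReal_norm_sq]
      push_cast
      ring
    · refine ((((c1 x).const_mul Complex.I).add
        ((c0 x).const_mul (2 * Complex.I * κ))).const_mul (((σ : ℤ) : ℝ) : ℂ)).congr_deriv ?_
      rw [heq, ofReal_norm_sq]
      simp only [map_add, map_mul, map_neg, Complex.conj_I, map_ofNat, Complex.conj_conj, map_intCast]
      push_cast
      ring
    · exact ⟨_, ((t0.mul s0).const_mul _).const_add _⟩
    · simpa using (t1.const_mul (-Complex.I)).add (t0.const_mul (2 * Complex.I * κ))
    · simpa using ((s1.const_mul Complex.I).add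
        (s0.const_mul (2 * Complex.I * κ))).const_mul (((σ : ℤ) : ℝ) : ℂ)

/-- Here the AKNS time matrix has degree 3 in κ. -/
theorem IsSchwartzSolutionHmKdV.isLaxFlow {σ : ℤˣ} {q : ℝ → 𝓢(ℝ, ℂ)}
    (h : IsSchwartzSolutionHmKdV σ q) (κ : ℝ) :
    IsLaxFlow ((σ : ℤ) : ℝ) κ q fun t x => deriv (fun s => q s x) t := by
  have heq : ∀ t x, deriv (fun s => q s x) t =
      -schwartzDeriv (schwartzDeriv (schwartzDeriv (q t))) x +
      ((σ : ℤ) : ℂ) * 6 * (((‖q t x‖ ^ 2 : ℝ) : ℂ) * schwartzDeriv (q t) x) := by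
    intro t x
    have := h.equation t x
    rw [iteratedDeriv_three_schwartz] at this
    rw [this, coe_schwartzDeriv (q t)]
    ring
  refine ⟨h.continuous, fun t x => (h.differentiableAt t x).hasDerivAt, fun t => ?_, fun t => ?_,
    fun t => ?_⟩
  · simp_rw [heq]
    have := (q t).continuous
    have := (schwartzDeriv (q t)).continuous
    have := (schwartzDeriv (schwartzDeriv (schwartzDeriv (q t)))).continuous
    exact Continuous.aestronglyMeasurable (by fun_prop)
  · obtain ⟨M, hM0, hM⟩ := exists_decay_bound h.continuous t
    obtain ⟨M₁, hM₁0, hM₁⟩ := exists_decay_bound (schwartzDeriv.continuous.comp h.continuous) t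
    obtain ⟨M₃, hM₃0, hM₃⟩ := exists_decay_bound (schwartzDeriv.continuous.comp
      (schwartzDeriv.continuous.comp (schwartzDeriv.continuous.comp h.continuous))) t
    refine ⟨M₃ + 6 * (M ^ 2 * M₁), fun s hs x => ?_⟩
    rw [heq]
    have e1 := hM₃ s hs x
    have e2 := norm_cube_le (one_add_sq_inv_pos x) (one_add_sq_inv_le_one x) (hM s hs x)
      (schwartzDeriv (q s) x) (hM₁ s hs x)
    have hσ : ‖((σ : ℤ) : ℂ)‖ = 1 := by
      rcases Int.units_eq_one_or σ with h | h <;> simp [h]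
    refine (norm_add_le _ _).trans ?_
    rw [norm_mul (((σ : ℤ) : ℂ) * 6), norm_mul ((σ : ℤ) : ℂ), hσ]
    simp only [norm_neg, norm_mul, Complex.norm_ofNat, one_mul] at e2 ⊢
    simp only [Function.comp_apply] at e1
    linarith
  · set f := q t with hf
    have d0 := hasDerivAt_schwartz f
    have d1 := hasDerivAt_schwartz (schwartzDeriv f)
    have d2 := hasDerivAt_schwartz (schwartzDeriv (schwartzDeriv f))
    have c0 := fun x => hasDerivAt_conj (d0 x)
    have c1 := fun x => hasDerivAt_conj (d1 x)
    have c2 := fun x => hasDerivAt_conj (d2 x)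
    have t0 := f.tendsto_cocompact
    have t1 := (schwartzDeriv f).tendsto_cocompact
    have t2 := (schwartzDeriv (schwartzDeriv f)).tendsto_cocompact
    have s0 := tendsto_conj_cocompact t0
    have s1 := tendsto_conj_cocompact t1
    have s2 := tendsto_conj_cocompact t2
    refine ⟨fun x => 4 * κ ^ 3 + ((σ : ℤ) : ℝ) * (-2 * κ * (f x * (starRingEnd ℂ) (f x)) +
        (schwartzDeriv f x * (starRingEnd ℂ) (f x) - f x * (starRingEnd ℂ) (schwartzDeriv f x))),
      fun x => -schwartzDeriv (schwartzDeriv f) x + 2 * κ * schwartzDeriv f x + -4 * κ ^ 2 * f x +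
        2 * ((σ : ℤ) : ℝ) * (f x * (starRingEnd ℂ) (f x) * f x),
      fun x => ((σ : ℤ) : ℝ) * (-(starRingEnd ℂ) (schwartzDeriv (schwartzDeriv f) x) +
        -2 * κ * (starRingEnd ℂ) (schwartzDeriv f x) + -4 * κ ^ 2 * (starRingEnd ℂ) (f x) +
        2 * ((σ : ℤ) : ℝ) * (f x * (starRingEnd ℂ) (f x) * (starRingEnd ℂ) (f x))),
      fun x => ?_, fun x => ?_, fun x => ?_, ?_, ?_, ?_⟩
    · refine ((((((d0 x).mul (c0 x)).const_mul (-2 * (κ : ℂ))).add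
        (((d1 x).mul (c0 x)).sub ((d0 x).mul (c1 x)))).const_mul (((σ : ℤ) : ℝ) : ℂ)).const_add
        (4 * (κ : ℂ) ^ 3)).congr_deriv ?_
      ring
    · refine (((((d2 x).neg).add ((d1 x).const_mul (2 * (κ : ℂ)))).add
        ((d0 x).const_mul (-4 * (κ : ℂ) ^ 2))).add
        ((((d0 x).mul (c0 x)).mul (d0 x)).const_mul (2 * (((σ : ℤ) : ℝ) : ℂ)))).congr_deriv ?_
      rw [heq, ofReal_norm_sq]
      simp only [Pi.mul_apply]
      push_cast
      ring
    · refine ((((((c2 x).neg).add ((c1 x).const_mul (-2 * (κ : ℂ)))).add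
        ((c0 x).const_mul (-4 * (κ : ℂ) ^ 2))).add
        ((((d0 x).mul (c0 x)).mul (c0 x)).const_mul
          (2 * (((σ : ℤ) : ℝ) : ℂ)))).const_mul (((σ : ℤ) : ℝ) : ℂ)).congr_deriv ?_
      rw [heq, ofReal_norm_sq]
      simp only [Pi.mul_apply, map_add, map_mul, map_neg, map_ofNat, Complex.conj_conj, map_intCast]
      push_cast
      ring
    · exact ⟨_, ((((t0.mul s0).const_mul _).add ((t1.mul s0).sub (t0.mul s1))).const_mul _).const_add _⟩
    · exact tendsto_cubic_zero t2 t1 t0 t0 s0 _ _ _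
    · simpa only [mul_zero] using
        (tendsto_cubic_zero s2 s1 s0 t0 s0 (-2 * κ) (-4 * κ ^ 2) (2 * ((σ : ℤ) : ℝ))).const_mul
          (((σ : ℤ) : ℝ) : ℂ)

/-! ### The quadratic energy and its quartic error. -/

/-- The quadratic part of the conserved energy. -/
def quadEnergy (κ : ℝ) (q : ℝ → ℂ) : ℝ≥0∞ :=
  ∫⁻ ξ, ENNReal.ofReal (2 * κ / ‖symb (2 * κ) ξ‖ ^ 2) * ‖𝓕 q ξ‖ₑ ^ 2

lemma fourierInv_conj (q : ℝ → ℂ) (ξ : ℝ) :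
    𝓕⁻ (fun x => (starRingEnd ℂ) (q x)) ξ = (starRingEnd ℂ) (𝓕 q ξ) := by
  rw [Real.fourierInv_eq_fourier_neg, fourier_conj_apply, neg_neg]

lemma inv_norm_symb_le {k : ℝ} (hk : 0 < k) (ξ : ℝ) : ‖symb k ξ‖⁻¹ ≤ 2 * wH k ξ * wH k ξ := by
  have h := norm_symb_ge k ξ hk.ne'
  rw [abs_of_pos hk] at h
  have hp := norm_symb_pos k ξ hk.ne'
  have hh := one_le_freqH hk ξ
  have h2 : Real.sqrt (k * freqH k ξ) * Real.sqrt (k * freqH k ξ) = k * freqH k ξ :=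
    Real.mul_self_sqrt (by positivity)
  have e : 2 * wH k ξ * wH k ξ = 2 / (k * freqH k ξ) := by
    rw [wH, mul_assoc, div_mul_div_comm, h2]
    ring
  rw [e, inv_eq_one_div, div_le_div_iff₀ hp (by positivity)]
  linarith

/-- Since 1/|`symb`| is at most 2·`wH`², this is Cauchy–Schwarz with one factor `wH` given to each
function. -/
lemma lintegral_mul_inv_symb_le {k : ℝ} (hk : 0 < k) {F G : ℝ → ℂ} (hF : AEMeasurable F)
    (hG : AEMeasurable G) :
    ∫⁻ ξ, ‖F ξ * (G ξ / symb k ξ)‖ₑ ≤ 2 * (wnorm (wH k) F * wnorm (wH k) G) := by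
  have hw : ∀ ξ, 0 ≤ wH k ξ := fun ξ => (wH_pos hk ξ).le
  have hm := (continuous_wH hk).measurable.ennreal_ofReal.aemeasurable (μ := volume)
  have hcs := sq_lintegral_mul_le volume (f := fun ξ => ENNReal.ofReal (wH k ξ) * ‖F ξ‖ₑ)
    (g := fun ξ => ENNReal.ofReal (wH k ξ) * ‖G ξ‖ₑ) (hm.mul hF.enorm) (hm.mul hG.enorm)
  rw [← wnorm_sq hw, ← wnorm_sq hw, ← mul_pow, ENNReal.pow_le_pow_left_iff (by norm_num)] at hcs
  have hmeas : AEMeasurable fun ξ => (ENNReal.ofReal (wH k ξ) * ‖F ξ‖ₑ) *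
      (ENNReal.ofReal (wH k ξ) * ‖G ξ‖ₑ) := (hm.mul hF.enorm).mul (hm.mul hG.enorm)
  calc _ ≤ ∫⁻ ξ, 2 * ((ENNReal.ofReal (wH k ξ) * ‖F ξ‖ₑ) * (ENNReal.ofReal (wH k ξ) * ‖G ξ‖ₑ)) := by
        refine lintegral_mono fun ξ => ?_
        have h1 : ‖(symb k ξ)⁻¹‖ₑ ≤ 2 * ENNReal.ofReal (wH k ξ) * ENNReal.ofReal (wH k ξ) := by
          rw [← ofReal_norm, norm_inv, ← ENNReal.ofReal_ofNat, ← ENNReal.ofReal_mul (by norm_num),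
            ← ENNReal.ofReal_mul (mul_nonneg (by norm_num) (hw ξ))]
          exact ENNReal.ofReal_le_ofReal (inv_norm_symb_le hk ξ)
        rw [enorm_mul, div_eq_mul_inv, enorm_mul]
        calc _ ≤ ‖F ξ‖ₑ * (‖G ξ‖ₑ * (2 * ENNReal.ofReal (wH k ξ) * ENNReal.ofReal (wH k ξ))) := by
              gcongr
          _ = _ := by ring
    _ = 2 * ∫⁻ ξ, (ENNReal.ofReal (wH k ξ) * ‖F ξ‖ₑ) * (ENNReal.ofReal (wH k ξ) * ‖G ξ‖ₑ) :=
        lintegral_const_mul'' _ hmeas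
    _ ≤ _ := by gcongr

lemma wnorm_wH_le_wK {k : ℝ} (hk : 0 < k) (G : ℝ → ℂ) :
    wnorm (wH k) G ≤ wnorm (wK k) G := by
  refine eLpNorm_mono fun ξ => ?_
  have h := one_le_freqL hk ξ
  have hs := sqrt_freqH_pos hk ξ
  rw [norm_mul, norm_mul, Complex.norm_real, Complex.norm_real,
    Real.norm_of_nonneg (wH_pos hk ξ).le, Real.norm_of_nonneg (wK_pos hk ξ).le]
  gcongr
  unfold wH wK
  gcongr

/-- The two equations exchange q with −ε q̄ and 2κ with −2κ. The weighted norms do not notice either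
change, so one existence theorem gives both quotients. -/
lemma exists_isJostPair {ε κ : ℝ} (hε : |ε| = 1) (hκ : 0 < κ) {q : ℝ → ℂ} (hq : IsWiener q)
    (hK : wnorm (wK (2 * κ)) (𝓕 q) ≤ ENNReal.ofReal (1 / 100)) :
    ∃ R P, IsJostPair ε κ q R P ∧ wnorm (wZ (2 * κ)) R ≤ 4 * wnorm (wK (2 * κ)) (𝓕 q) := by
  have hk : (0:ℝ) < 2 * κ := by positivity
  have hkabs : |2 * κ| = 2 * κ := abs_of_pos hk
  have hkabs' : |-(2 * κ)| = 2 * κ := by rw [abs_neg, hkabs]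
  have hfin : wnorm (wK (2 * κ)) (𝓕 q) ≠ ⊤ := ne_top_of_le_ne_top ENNReal.ofReal_ne_top hK
  set D := (wnorm (wK (2 * κ)) (𝓕 q)).toReal with hD
  have hDe : wnorm (wK (2 * κ)) (𝓕 q) = ENNReal.ofReal D := (ENNReal.ofReal_toReal hfin).symm
  have hD0 : 0 ≤ D := ENNReal.toReal_nonneg
  have hD1 : D ≤ 1 / 100 := ENNReal.toReal_le_of_le_ofReal (by norm_num) hK
  have hq2 : IsWiener fun x => -ε * (starRingEnd ℂ) (q x) := hq.conj.const_mul _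
  have hK2 : wnorm (wK (2 * κ)) (𝓕 fun x => -ε * (starRingEnd ℂ) (q x)) ≤ ENNReal.ofReal D := by
    rw [wnorm_fourier_const_mul (by simp [hε]), wnorm_fourier_conj (continuous_wK hk) (wK_neg _)
      hq.integrable, hDe]
  have h25 : ENNReal.ofReal (4 * D) ≤ ENNReal.ofReal (1 / 25) :=
    ENNReal.ofReal_le_ofReal (by linarith)
  obtain ⟨R, hR, hRn⟩ := exists_isRiccati hk.ne' hq hq2 hD0 hD1 (by rw [hkabs, hDe])
    (by rw [hkabs]; exact hK2)
  obtain ⟨P, hP, hPn⟩ := exists_isRiccati (neg_ne_zero.2 hk.ne') hq2 hq hD0 hD1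
    (by rw [hkabs']; exact hK2) (by rw [hkabs', hDe])
  rw [hkabs] at hRn
  rw [hkabs'] at hPn
  refine ⟨R, P, ⟨hR, hP, hRn.trans h25, hPn.trans h25⟩, hRn.trans (le_of_eq ?_)⟩
  rw [hDe, ENNReal.ofReal_mul (by norm_num), ENNReal.ofReal_ofNat]

/-- The conserved quantity is the quadratic energy up to a quartic error. -/
lemma jostEnergy_expansion {ε κ : ℝ} (hε : |ε| = 1) (hκ : 0 < κ) {q R P : ℝ → ℂ} (hq : IsWiener q)
    (hK : wnorm (wK (2 * κ)) (𝓕 q) ≤ ENNReal.ofReal (1 / 100)) (h : IsJostPair ε κ q R P)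
    (hR : wnorm (wZ (2 * κ)) R ≤ 4 * wnorm (wK (2 * κ)) (𝓕 q)) :
    ∃ (a : ℝ) (e : ℂ), 0 ≤ a ∧ quadEnergy κ q = ENNReal.ofReal a ∧
      ε * (jostEnergy ε q R).re = a + e.re ∧
      ‖e‖ₑ ≤ 4608 * (wnorm (wH (2 * κ)) (𝓕 q) ^ 2 * wnorm (wK (2 * κ)) (𝓕 q) ^ 2) := by
  have hk : (0:ℝ) < 2 * κ := by positivity
  have hQc := continuous_fourier hq.integrable
  have hri := (h.left.integrable)
  have hq2 : IsWiener fun x => -ε * (starRingEnd ℂ) (q x) := hq.conj.const_mul _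
  have hw := (hq2.mul_fourierInv hri).mul_fourierInv hri
  set G := 𝓕 (fun x => -ε * (starRingEnd ℂ) (q x) * 𝓕⁻ R x * 𝓕⁻ R x) with hG
  have hGc : Continuous G := continuous_fourier hw.integrable
  have hHfin : wnorm (wH (2 * κ)) (𝓕 q) ≠ ⊤ := ne_top_of_le_ne_top ENNReal.ofReal_ne_top
    ((wnorm_wH_le_wK hk _).trans hK)
  have hconjH : wnorm (wH (2 * κ)) (fun ξ => (starRingEnd ℂ) (𝓕 q ξ)) = wnorm (wH (2 * κ)) (𝓕 q) :=
    eLpNorm_congr_norm_ae (Filter.Eventually.of_forall fun ξ => by simp)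
  have hGn : wnorm (wH (2 * κ)) G ≤ 2304 * (wnorm (wH (2 * κ)) (𝓕 q) *
      wnorm (wK (2 * κ)) (𝓕 q) ^ 2) := by
    refine (wnorm_wH_fourier_mul_mul_le hk hq2.integrable hri hri).trans ?_
    rw [wnorm_fourier_const_mul (by simp [hε]), wnorm_fourier_conj (continuous_wH hk) (wH_neg _)
      hq.integrable]
    calc _ ≤ 144 * wnorm (wH (2 * κ)) (𝓕 q) * (4 * wnorm (wK (2 * κ)) (𝓕 q)) *
          (4 * wnorm (wK (2 * κ)) (𝓕 q)) := by gcongr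
      _ = _ := by ring
  have hcm : AEMeasurable fun ξ => (starRingEnd ℂ) (𝓕 q ξ) :=
    (Complex.continuous_conj.comp hQc).measurable.aemeasurable
  have hb1 := lintegral_mul_inv_symb_le hk hcm hQc.measurable.aemeasurable
  have hb2 := lintegral_mul_inv_symb_le hk hcm hGc.measurable.aemeasurable
  rw [hconjH] at hb1 hb2
  have hsc := continuous_symb (2 * κ)
  have hsne := fun ξ => symb_ne_zero (2 * κ) ξ hk.ne'
  have i1 : Integrable fun ξ => (starRingEnd ℂ) (𝓕 q ξ) * (𝓕 q ξ / symb (2 * κ) ξ) :=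
    ⟨((Complex.continuous_conj.comp hQc).mul (hQc.div hsc hsne)).aestronglyMeasurable,
      hb1.trans_lt (ENNReal.mul_lt_top (by simp)
        (ENNReal.mul_lt_top hHfin.lt_top hHfin.lt_top))⟩
  have hGfin : wnorm (wH (2 * κ)) G ≠ ⊤ := ne_top_of_le_ne_top (ENNReal.mul_ne_top (by simp)
    (ENNReal.mul_ne_top hHfin (ENNReal.pow_ne_top
      (ne_top_of_le_ne_top ENNReal.ofReal_ne_top hK)))) hGn
  have i2 : Integrable fun ξ => (starRingEnd ℂ) (𝓕 q ξ) * (G ξ / symb (2 * κ) ξ) :=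
    ⟨((Complex.continuous_conj.comp hQc).mul (hGc.div hsc hsne)).aestronglyMeasurable,
      hb2.trans_lt (ENNReal.mul_lt_top (by simp)
        (ENNReal.mul_lt_top hHfin.lt_top hGfin.lt_top))⟩
  -- By duality for the Fourier transform the energy pairs the conjugate of q̂ with R. Substituting
  -- the Riccati equation for R, its linear term gives the quadratic energy and its nonlinear term
  -- the error.
  have hE : jostEnergy ε q R = ε * ((∫ ξ, (starRingEnd ℂ) (𝓕 q ξ) * (𝓕 q ξ / symb (2 * κ) ξ)) +
      ∫ ξ, (starRingEnd ℂ) (𝓕 q ξ) * (G ξ / symb (2 * κ) ξ)) := by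
    rw [← integral_add i1 i2, jostEnergy]
    simp_rw [mul_assoc]
    rw [integral_const_mul]
    congr 1
    have := integral_fourierInv_mul_eq_flip hri (integrable_conj hq.integrable)
    simp_rw [fourierInv_conj] at this
    rw [show (∫ x, (starRingEnd ℂ) (q x) * 𝓕⁻ R x) = ∫ x, 𝓕⁻ R x * (starRingEnd ℂ) (q x) from
      integral_congr_ae (Filter.Eventually.of_forall fun x => mul_comm _ _), this]
    refine integral_congr_ae (Filter.Eventually.of_forall fun ξ => ?_)
    simp only
    rw [h.left.eq ξ]
    ring
  set e := ∫ ξ, (starRingEnd ℂ) (𝓕 q ξ) * (G ξ / symb (2 * κ) ξ) with he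
  -- The real part of 1/(2κ + 2πiξ) is the Lorentzian, which is nonnegative. Its imaginary part
  -- decays more slowly and is discarded.
  have hre : ∀ ξ, ((starRingEnd ℂ) (𝓕 q ξ) * (𝓕 q ξ / symb (2 * κ) ξ)).re =
      2 * κ / ‖symb (2 * κ) ξ‖ ^ 2 * ‖𝓕 q ξ‖ ^ 2 := by
    intro ξ
    have h1 : (starRingEnd ℂ) (𝓕 q ξ) * (𝓕 q ξ / symb (2 * κ) ξ) =
        ((‖𝓕 q ξ‖ ^ 2 : ℝ) : ℂ) * (symb (2 * κ) ξ)⁻¹ := by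
      rw [ofReal_norm_sq, div_eq_mul_inv]; ring
    rw [h1, Complex.re_ofReal_mul, Complex.inv_re, Complex.normSq_eq_norm_sq]
    have : (symb (2 * κ) ξ).re = 2 * κ := by simp [symb]
    rw [this]; ring
  have hnn : ∀ ξ, 0 ≤ 2 * κ / ‖symb (2 * κ) ξ‖ ^ 2 * ‖𝓕 q ξ‖ ^ 2 := fun ξ => by positivity
  have i1r : Integrable fun ξ => 2 * κ / ‖symb (2 * κ) ξ‖ ^ 2 * ‖𝓕 q ξ‖ ^ 2 :=
    i1.re.congr (Filter.Eventually.of_forall hre)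
  refine ⟨∫ ξ, 2 * κ / ‖symb (2 * κ) ξ‖ ^ 2 * ‖𝓕 q ξ‖ ^ 2, e, integral_nonneg hnn, ?_, ?_, ?_⟩
  · rw [ofReal_integral_eq_lintegral_ofReal i1r (Filter.Eventually.of_forall hnn), quadEnergy]
    refine lintegral_congr fun ξ => ?_
    rw [ENNReal.ofReal_mul (by positivity), ENNReal.ofReal_pow (norm_nonneg _), ofReal_norm]
  · have h1 : (∫ ξ, (starRingEnd ℂ) (𝓕 q ξ) * (𝓕 q ξ / symb (2 * κ) ξ)).re =
        ∫ ξ, 2 * κ / ‖symb (2 * κ) ξ‖ ^ 2 * ‖𝓕 q ξ‖ ^ 2 := by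
      rw [← integral_congr_ae (Filter.Eventually.of_forall hre)]
      exact (integral_re i1).symm
    have h2 : ε * ε = 1 := by
      rw [← abs_mul_abs_self, hε, one_mul]
    rw [hE, Complex.re_ofReal_mul, Complex.add_re, h1, ← mul_assoc, h2, one_mul]
  · refine (enorm_integral_le_lintegral_enorm _).trans (hb2.trans ?_)
    calc _ ≤ 2 * (wnorm (wH (2 * κ)) (𝓕 q) * (2304 * (wnorm (wH (2 * κ)) (𝓕 q) *
          wnorm (wK (2 * κ)) (𝓕 q) ^ 2))) := by gcongr
      _ = _ := by ring

/-- Almost conservation of the quadratic energy along a Lax flow. -/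
theorem IsLaxFlow.quadEnergy_le {ε κ : ℝ} (hε : |ε| = 1) (hκ : 0 < κ)
    {q : ℝ → 𝓢(ℝ, ℂ)} {v : ℝ → ℝ → ℂ} (hflow : IsLaxFlow ε κ q v) {J : Set ℝ} (hJ : Convex ℝ J)
    (hK : ∀ t ∈ J, wnorm (wK (2 * κ)) (𝓕 (q t : ℝ → ℂ)) ≤ ENNReal.ofReal (1 / 100))
    {s t : ℝ} (hs : s ∈ J) (ht : t ∈ J) :
    quadEnergy κ (q t) ≤ quadEnergy κ (q s) +
      4608 * (wnorm (wH (2 * κ)) (𝓕 (q s : ℝ → ℂ)) ^ 2 * wnorm (wK (2 * κ)) (𝓕 (q s : ℝ → ℂ)) ^ 2) +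
      4608 * (wnorm (wH (2 * κ)) (𝓕 (q t : ℝ → ℂ)) ^ 2 *
        wnorm (wK (2 * κ)) (𝓕 (q t : ℝ → ℂ)) ^ 2) := by
  -- Jost quotients are available only for times in J; elsewhere the value 0 is an arbitrary filler
  -- that makes the choice total.
  have hex : ∀ t, ∃ R P, t ∈ J → IsJostPair ε κ (q t) R P ∧
      wnorm (wZ (2 * κ)) R ≤ 4 * wnorm (wK (2 * κ)) (𝓕 (q t : ℝ → ℂ)) := fun t => by
    by_cases ht : t ∈ J
    · obtain ⟨R, P, h⟩ := exists_isJostPair hε hκ (q t).isWiener (hK t ht)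
      exact ⟨R, P, fun _ => h⟩
    · exact ⟨0, 0, fun h => absurd h ht⟩
  choose R P hRP using hex
  have hcons := hflow.jostEnergy_eq hε hκ hJ hK (fun t ht => (hRP t ht).1) hs ht
  obtain ⟨a, e, ha, haq, hae, hen⟩ := jostEnergy_expansion hε hκ (q s).isWiener (hK s hs)
    (hRP s hs).1 (hRP s hs).2
  obtain ⟨a', e', ha', haq', hae', hen'⟩ := jostEnergy_expansion hε hκ (q t).isWiener (hK t ht)
    (hRP t ht).1 (hRP t ht).2
  rw [hcons, hae'] at hae
  rw [haq, haq']
  have h1 : a' ≤ a + ‖e‖ + ‖e'‖ := by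
    have := Complex.re_le_norm e
    have := (abs_le.1 (Complex.abs_re_le_norm e')).1
    linarith
  calc ENNReal.ofReal a' ≤ ENNReal.ofReal (a + ‖e‖ + ‖e'‖) := ENNReal.ofReal_le_ofReal h1
    _ = ENNReal.ofReal a + ‖e‖ₑ + ‖e'‖ₑ := by
        rw [ENNReal.ofReal_add (by positivity) (norm_nonneg _), ENNReal.ofReal_add ha (norm_nonneg _),
          ofReal_norm, ofReal_norm]
    _ ≤ _ := by gcongr

/-! ### Dyadic decomposition of the energies. -/

lemma fourierHat_eq (f : ℝ → ℂ) (ξ : ℝ) :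
    fourierHat f ξ = ((1 / Real.sqrt (2 * Real.pi) : ℝ) : ℂ) * 𝓕 f (ξ / (2 * Real.pi)) := by
  rw [fourierHat, Real.fourier_real_eq_integral_exp_smul]
  congr 1
  refine integral_congr_ae (Filter.Eventually.of_forall fun x => ?_)
  simp only [smul_eq_mul]
  congr 2
  have : (Real.pi : ℂ) ≠ 0 := by exact_mod_cast Real.pi_ne_zero
  push_cast
  field_simp

lemma enorm_fourierHat_sq (f : ℝ → ℂ) (ξ : ℝ) :
    ‖fourierHat f ξ‖ₑ ^ 2 = ENNReal.ofReal (2 * Real.pi)⁻¹ * ‖𝓕 f (ξ / (2 * Real.pi))‖ₑ ^ 2 := by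
  have hpi : (0:ℝ) < 2 * Real.pi := by positivity
  rw [fourierHat_eq, enorm_mul, mul_pow, ← ofReal_norm (((1 / Real.sqrt (2 * Real.pi) : ℝ) : ℂ)),
    ← ENNReal.ofReal_pow (norm_nonneg _), Complex.norm_real, Real.norm_eq_abs, sq_abs, div_pow,
    Real.sq_sqrt hpi.le, one_pow, one_div]

/-- Change of variables between the two normalizations of the Fourier transform. -/
lemma lintegral_fourier_eq (f : ℝ → ℂ) (W : ℝ → ℝ≥0∞) :
    ∫⁻ ξ, W ξ * ‖𝓕 f ξ‖ₑ ^ 2 = ∫⁻ ξ, W (ξ / (2 * Real.pi)) * ‖fourierHat f ξ‖ₑ ^ 2 := by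
  have hpi : (0:ℝ) < 2 * Real.pi := by positivity
  have hne : (2 * Real.pi)⁻¹ ≠ 0 := by positivity
  have hc : ENNReal.ofReal (2 * Real.pi)⁻¹ ≠ ⊤ := ENNReal.ofReal_ne_top
  have h1 := congrArg (fun μ => ∫⁻ ξ, W ξ * ‖𝓕 f ξ‖ₑ ^ 2 ∂μ) (Real.smul_map_volume_mul_left hne)
  have h2 := lintegral_map_equiv (μ := volume) (fun ξ => W ξ * ‖𝓕 f ξ‖ₑ ^ 2)
    (Homeomorph.mulLeft₀ (2 * Real.pi)⁻¹ hne).toMeasurableEquiv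
  have h3 : ⇑(Homeomorph.mulLeft₀ (2 * Real.pi)⁻¹ hne).toMeasurableEquiv =
    fun x => (2 * Real.pi)⁻¹ * x := rfl
  rw [h3] at h2
  rw [← h1, lintegral_smul_measure, h2, smul_eq_mul, abs_of_nonneg (by positivity),
    ← lintegral_const_mul' _ _ hc]
  refine lintegral_congr fun ξ => ?_
  rw [enorm_fourierHat_sq, div_eq_inv_mul]
  ring

/-- The rescaled energy of the low frequencies. -/
def lowEnergy (κ₀ : ℝ) (f : ℝ → ℂ) : ℝ≥0∞ := ENNReal.ofReal κ₀⁻¹ * lowFreqNorm κ₀ f ^ 2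

/-- The rescaled energy of the `k`-th dyadic shell. -/
def dyadicEnergy (κ₀ : ℝ) (f : ℝ → ℂ) (k : ℕ) : ℝ≥0∞ :=
  ENNReal.ofReal (κ₀ * 2 ^ k)⁻¹ * dyadicNorm κ₀ (2 ^ k) f ^ 2

/-- The `k`-th dyadic shell `2 ^ k κ₀ < |ξ| ≤ 2 ^ (k + 1) κ₀`. -/
def shell (κ₀ : ℝ) (k : ℕ) : Set ℝ := {ξ : ℝ | 2 ^ k * κ₀ < |ξ| ∧ |ξ| ≤ 2 * 2 ^ k * κ₀}

lemma measurableSet_shell (κ₀ : ℝ) (k : ℕ) : MeasurableSet (shell κ₀ k) :=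
  (measurableSet_lt measurable_const continuous_abs.measurable).inter
    (measurableSet_le continuous_abs.measurable measurable_const)

lemma measurableSet_low (κ₀ : ℝ) : MeasurableSet {ξ : ℝ | |ξ| ≤ κ₀} :=
  measurableSet_le continuous_abs.measurable measurable_const

lemma univ_subset_low_union_shells {κ₀ : ℝ} (hκ : 0 < κ₀) :
    (Set.univ : Set ℝ) ⊆ {ξ : ℝ | |ξ| ≤ κ₀} ∪ ⋃ k, shell κ₀ k := by
  intro ξ _
  rcases le_or_gt |ξ| κ₀ with h | h
  · exact Or.inl h
  · obtain ⟨n, h1, h2⟩ := exists_nat_pow_near (x := |ξ| / κ₀) (y := (2:ℝ))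
      (by rw [le_div_iff₀ hκ]; linarith) (by norm_num)
    rw [le_div_iff₀ hκ] at h1
    rw [div_lt_iff₀ hκ] at h2
    refine Or.inr (Set.mem_iUnion.2 ?_)
    -- Shells are open on the inside, whereas `exists_nat_pow_near` gives intervals closed there. A
    -- point with |ξ| = 2^n κ₀ therefore belongs to the preceding shell.
    rcases h1.lt_or_eq with h1 | h1
    · exact ⟨n, h1, by rw [pow_succ] at h2; linarith⟩
    · rcases n with _ | n
      · simp at h1; linarith
      · refine ⟨n, ?_, ?_⟩
        · rw [← h1, pow_succ]
          have : 0 < 2 ^ n * κ₀ := by positivity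
          linarith
        · rw [← h1, pow_succ]; linarith

lemma lowEnergy_eq (κ₀ : ℝ) (f : ℝ → ℂ) :
    lowEnergy κ₀ f = ∫⁻ ξ in {ξ : ℝ | |ξ| ≤ κ₀}, ENNReal.ofReal κ₀⁻¹ * ‖fourierHat f ξ‖ₑ ^ 2 := by
  rw [lowEnergy, lowFreqNorm, eLpNorm_two_sq, lintegral_const_mul' _ _ ENNReal.ofReal_ne_top]

lemma dyadicEnergy_eq (κ₀ : ℝ) (f : ℝ → ℂ) (k : ℕ) :
    dyadicEnergy κ₀ f k =
      ∫⁻ ξ in shell κ₀ k, ENNReal.ofReal (κ₀ * 2 ^ k)⁻¹ * ‖fourierHat f ξ‖ₑ ^ 2 := by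
  rw [dyadicEnergy, dyadicNorm, eLpNorm_two_sq, lintegral_const_mul' _ _ ENNReal.ofReal_ne_top]
  rfl

lemma ofReal_le_mul_of_mul_le {w s : ℝ} {a : ℝ≥0∞} (hs : 0 < s) (h : ENNReal.ofReal (w * s) ≤ a) :
    ENNReal.ofReal w ≤ a * ENNReal.ofReal s⁻¹ := by
  calc ENNReal.ofReal w = ENNReal.ofReal (w * s) * ENNReal.ofReal s⁻¹ := by
        rw [← ENNReal.ofReal_mul' (by positivity), mul_assoc, mul_inv_cancel₀ hs.ne', mul_one]
    _ ≤ _ := by gcongr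

lemma mul_le_ofReal_of_le_mul {w s : ℝ} {a : ℝ≥0∞} (hs : 0 < s) (h : a ≤ ENNReal.ofReal (w * s)) :
    a * ENNReal.ofReal s⁻¹ ≤ ENNReal.ofReal w := by
  calc _ ≤ ENNReal.ofReal (w * s) * ENNReal.ofReal s⁻¹ := by gcongr
    _ = ENNReal.ofReal w := by
        rw [← ENNReal.ofReal_mul' (by positivity), mul_assoc, mul_inv_cancel₀ hs.ne', mul_one]

/-- The energies already contain 1/κ₀ and 1/(κ₀2^k), so a weight has to be compared only after
multiplication by its scale. For an upper bound it is enough that the sets cover the line. -/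
lemma lintegral_weight_le_dyadic {κ₀ : ℝ} (hκ : 0 < κ₀) (f : ℝ → ℂ) {w : ℝ → ℝ} {a : ℝ≥0∞}
    {b : ℕ → ℝ≥0∞} (ha : ∀ ξ, |ξ| ≤ κ₀ → ENNReal.ofReal (w ξ * κ₀) ≤ a)
    (hb : ∀ k, ∀ ξ ∈ shell κ₀ k, ENNReal.ofReal (w ξ * (κ₀ * 2 ^ k)) ≤ b k)
    (ha' : a ≠ ⊤) (hb' : ∀ k, b k ≠ ⊤) :
    ∫⁻ ξ, ENNReal.ofReal (w ξ) * ‖fourierHat f ξ‖ₑ ^ 2 ≤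
      a * lowEnergy κ₀ f + ∑' k, b k * dyadicEnergy κ₀ f k := by
  calc _ ≤ ∫⁻ ξ in {ξ : ℝ | |ξ| ≤ κ₀} ∪ ⋃ k, shell κ₀ k,
        ENNReal.ofReal (w ξ) * ‖fourierHat f ξ‖ₑ ^ 2 := by
        rw [← setLIntegral_univ]
        exact lintegral_mono_set (univ_subset_low_union_shells hκ)
    _ ≤ _ := lintegral_union_le _ _ _
    _ ≤ _ := by
      refine add_le_add ?_ ((lintegral_iUnion_le _ _).trans (ENNReal.tsum_le_tsum fun k => ?_))
      · rw [lowEnergy_eq, ← lintegral_const_mul' _ _ ha']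
        refine setLIntegral_mono' (measurableSet_low κ₀) fun ξ hξ => ?_
        rw [← mul_assoc]
        gcongr
        exact ofReal_le_mul_of_mul_le hκ (ha ξ hξ)
      · rw [dyadicEnergy_eq, ← lintegral_const_mul' _ _ (hb' k)]
        refine setLIntegral_mono' (measurableSet_shell κ₀ k) fun ξ hξ => ?_
        rw [← mul_assoc]
        gcongr
        exact ofReal_le_mul_of_mul_le (by positivity) (hb k ξ hξ)

lemma low_le_lintegral_weight {κ₀ : ℝ} (hκ : 0 < κ₀) (f : ℝ → ℂ) {w : ℝ → ℝ} {a : ℝ≥0∞}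
    (ha : ∀ ξ, |ξ| ≤ κ₀ → a ≤ ENNReal.ofReal (w ξ * κ₀)) (ha' : a ≠ ⊤) :
    a * lowEnergy κ₀ f ≤ ∫⁻ ξ, ENNReal.ofReal (w ξ) * ‖fourierHat f ξ‖ₑ ^ 2 := by
  rw [lowEnergy_eq, ← lintegral_const_mul' _ _ ha']
  refine (setLIntegral_mono' (measurableSet_low κ₀) fun ξ hξ => ?_).trans (setLIntegral_le_lintegral _ _)
  rw [← mul_assoc]
  gcongr
  exact mul_le_ofReal_of_le_mul hκ (ha ξ hξ)

lemma dyadic_le_lintegral_weight {κ₀ : ℝ} (hκ : 0 < κ₀) (f : ℝ → ℂ) {w : ℝ → ℝ} {b : ℝ≥0∞} {k : ℕ}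
    (hb : ∀ ξ ∈ shell κ₀ k, b ≤ ENNReal.ofReal (w ξ * (κ₀ * 2 ^ k))) (hb' : b ≠ ⊤) :
    b * dyadicEnergy κ₀ f k ≤ ∫⁻ ξ, ENNReal.ofReal (w ξ) * ‖fourierHat f ξ‖ₑ ^ 2 := by
  rw [dyadicEnergy_eq, ← lintegral_const_mul' _ _ hb']
  refine (setLIntegral_mono' (measurableSet_shell κ₀ k) fun ξ hξ => ?_).trans
    (setLIntegral_le_lintegral _ _)
  rw [← mul_assoc]
  gcongr
  exact mul_le_ofReal_of_le_mul (by positivity) (hb ξ hξ)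

lemma wnorm_wH_sq_eq {κ : ℝ} (hκ : 0 < κ) (f : ℝ → ℂ) :
    wnorm (wH (2 * κ)) (𝓕 f) ^ 2 =
      ∫⁻ ξ, ENNReal.ofReal (1 / (2 * κ + |ξ|)) * ‖fourierHat f ξ‖ₑ ^ 2 := by
  have h2 : 0 < 2 * κ := by positivity
  rw [wnorm_sq (fun ξ => (wH_pos h2 ξ).le)]
  simp only [mul_pow]
  rw [lintegral_fourier_eq f (fun ξ => ENNReal.ofReal (wH (2 * κ) ξ) ^ 2)]
  refine lintegral_congr fun ξ => ?_
  have := one_le_freqH h2 (ξ / (2 * Real.pi))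
  rw [← ENNReal.ofReal_pow (wH_pos h2 _).le, wH, div_pow, Real.sq_sqrt (by positivity), freqH,
    abs_div, abs_of_pos (by positivity : 0 < 2 * Real.pi)]
  congr 2
  field_simp

lemma wnorm_wK_sq_eq {κ : ℝ} (hκ : 0 < κ) (f : ℝ → ℂ) :
    wnorm (wK (2 * κ)) (𝓕 f) ^ 2 =
      ∫⁻ ξ, ENNReal.ofReal ((1 + Real.log (1 + |ξ| / (2 * κ))) ^ 2 / (2 * κ + |ξ|)) *
        ‖fourierHat f ξ‖ₑ ^ 2 := by
  have h2 : 0 < 2 * κ := by positivity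
  rw [wnorm_sq (fun ξ => (wK_pos h2 ξ).le)]
  simp only [mul_pow]
  rw [lintegral_fourier_eq f (fun ξ => ENNReal.ofReal (wK (2 * κ) ξ) ^ 2)]
  refine lintegral_congr fun ξ => ?_
  have := one_le_freqH h2 (ξ / (2 * Real.pi))
  have e : freqH (2 * κ) (ξ / (2 * Real.pi)) = 1 + |ξ| / (2 * κ) := by
    rw [freqH, abs_div, abs_of_pos (by positivity : 0 < 2 * Real.pi)]
    field_simp
  rw [← ENNReal.ofReal_pow (wK_pos h2 _).le, wK, div_pow, Real.sq_sqrt (by positivity), freqL, e]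
  congr 3
  field_simp

lemma quadEnergy_eq {κ : ℝ} (f : ℝ → ℂ) :
    quadEnergy κ f =
      ∫⁻ ξ, ENNReal.ofReal (2 * κ / (4 * κ ^ 2 + |ξ| ^ 2)) * ‖fourierHat f ξ‖ₑ ^ 2 := by
  rw [quadEnergy, lintegral_fourier_eq f (fun ξ => ENNReal.ofReal (2 * κ / ‖symb (2 * κ) ξ‖ ^ 2))]
  refine lintegral_congr fun ξ => ?_
  congr 3
  have e : symb (2 * κ) (ξ / (2 * Real.pi)) = ((2 * κ : ℝ) : ℂ) + (ξ : ℂ) * Complex.I := by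
    have : (Real.pi : ℂ) ≠ 0 := by exact_mod_cast Real.pi_ne_zero
    rw [symb]
    push_cast
    field_simp
  rw [e, ← Complex.normSq_eq_norm_sq, Complex.normSq_add_mul_I, sq_abs]
  ring

lemma inv_two_pow_eq (n : ℕ) : (2⁻¹ : ℝ≥0∞) ^ n = ENNReal.ofReal ((1 / 2) ^ n) := by
  rw [ENNReal.ofReal_pow (by norm_num), one_div, ENNReal.ofReal_inv_of_pos (by norm_num)]
  simp

/-- Natural subtraction truncates, so one of m − k and k − m is always 0. The numbers a = 2^{-(m-k)}
and b = 2^{k-m} treat the shells below and above scale m together. -/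
lemma two_pow_factor (m k : ℕ) : ∃ a b : ℝ, (1 / 2 : ℝ) ^ (m - k) = a ∧ (2:ℝ) ^ (k - m) = b ∧
    (1 / 2 : ℝ) ^ (k - m) = b⁻¹ ∧ (2:ℝ) ^ k = a * 2 ^ m * b ∧ 0 < a ∧ a ≤ 1 ∧ 1 ≤ b ∧
    (a = 1 ∨ b = 1) := by
  refine ⟨_, _, rfl, rfl, by rw [one_div, inv_pow], ?_, by positivity,
    pow_le_one₀ (by norm_num) (by norm_num), one_le_pow₀ (by norm_num), ?_⟩
  · rw [one_div, inv_pow, eq_comm, mul_assoc, inv_mul_eq_iff_eq_mul₀ (by positivity), ← pow_add,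
      ← pow_add]
    congr 1; omega
  · rcases le_total m k with h | h
    · left; simp [Nat.sub_eq_zero_of_le h]
    · right; simp [Nat.sub_eq_zero_of_le h]

lemma shell_mul_le {s x : ℝ} (hs : 0 < s) (m k : ℕ) (hx : 2 ^ k * s < x) :
    1 / (2 * (s * 2 ^ m) + x) * (s * 2 ^ k) ≤ (1 / 2) ^ (m - k) := by
  obtain ⟨a, b, e1, e2, e3, e4, ha, ha1, hb1, hab⟩ := two_pow_factor m k
  have hP : (0:ℝ) < 2 ^ m := by positivity
  have hK : (0:ℝ) < 2 ^ k := by positivity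
  have hx0 : 0 < x := lt_trans (by positivity) hx
  rw [e1, div_mul_eq_mul_div, div_le_iff₀ (by positivity)]
  rcases hab with rfl | rfl
  · have : 0 < s * 2 ^ m := by positivity
    linarith
  · have : 0 < s * (a * 2 ^ m) := by positivity
    have : 0 < a * x := by positivity
    rw [e4]
    linarith

lemma wnorm_wH_sq_le_dyadic {κ₀ : ℝ} (hκ : 0 < κ₀) (f : ℝ → ℂ) (m : ℕ) :
    wnorm (wH (2 * (κ₀ * 2 ^ m))) (𝓕 f) ^ 2 ≤
      2⁻¹ ^ m * lowEnergy κ₀ f + ∑' k, 2⁻¹ ^ (m - k) * dyadicEnergy κ₀ f k := by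
  rw [wnorm_wH_sq_eq (by positivity)]
  refine lintegral_weight_le_dyadic hκ f (fun ξ _ => ?_) (fun k ξ hξ => ?_) (by simp) (by simp)
  · rw [inv_two_pow_eq]
    refine ENNReal.ofReal_le_ofReal ?_
    have := abs_nonneg ξ
    have hP : (0:ℝ) < 2 ^ m := by positivity
    rw [div_mul_eq_mul_div, div_le_iff₀ (by positivity), one_div, inv_pow, le_inv_mul_iff₀ hP]
    nlinarith
  · rw [inv_two_pow_eq]
    exact ENNReal.ofReal_le_ofReal (shell_mul_le hκ m k hξ.1)

/-- Shells below scale m decay geometrically. On those above, the weight after rescaling costs only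
the square of the logarithm, at most (k − m + 2)². -/
lemma wnorm_wK_sq_le_dyadic {κ₀ : ℝ} (hκ : 0 < κ₀) (f : ℝ → ℂ) (m : ℕ) :
    wnorm (wK (2 * (κ₀ * 2 ^ m))) (𝓕 f) ^ 2 ≤
      4 * 2⁻¹ ^ m * lowEnergy κ₀ f +
        ∑' k, 2⁻¹ ^ (m - k) * ((k - m : ℕ) + 2) ^ 2 * dyadicEnergy κ₀ f k := by
  rw [wnorm_wK_sq_eq (by positivity)]
  refine lintegral_weight_le_dyadic hκ f (fun ξ hξ => ?_) (fun k ξ hξ => ?_)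
    (ENNReal.mul_ne_top (by simp) (by simp)) (fun k => ENNReal.mul_ne_top (by simp) (by
      exact_mod_cast ENNReal.natCast_ne_top ((k - m + 2) ^ 2)))
  · have e : 4 * (2⁻¹ : ℝ≥0∞) ^ m = ENNReal.ofReal (4 * (1 / 2) ^ m) := by
      rw [inv_two_pow_eq, ENNReal.ofReal_mul (by norm_num)]; simp
    rw [e]
    refine ENNReal.ofReal_le_ofReal ?_
    have h0 := abs_nonneg ξ
    have hP : (1:ℝ) ≤ 2 ^ m := one_le_pow₀ (by norm_num)
    have hl : 0 ≤ Real.log (1 + |ξ| / (2 * (κ₀ * 2 ^ m))) :=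
      Real.log_nonneg (by have : 0 ≤ |ξ| / (2 * (κ₀ * 2 ^ m)) := by positivity
                          linarith)
    have hl1 : Real.log (1 + |ξ| / (2 * (κ₀ * 2 ^ m))) ≤ 1 := by
      refine (Real.log_le_sub_one_of_pos (by positivity)).trans ?_
      rw [add_sub_cancel_left, div_le_one (by positivity)]
      nlinarith
    rw [div_mul_eq_mul_div, div_le_iff₀ (by positivity), one_div, inv_pow]
    have hi : (2 ^ m : ℝ)⁻¹ * 2 ^ m = 1 := inv_mul_cancel₀ (by positivity)
    have hi0 : (0:ℝ) < (2 ^ m : ℝ)⁻¹ := by positivity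
    calc _ ≤ (1 + 1) ^ 2 * κ₀ := by gcongr
      _ = 4 * ((2 ^ m : ℝ)⁻¹ * 2 ^ m) * κ₀ := by rw [hi]; ring
      _ ≤ 4 * (2 ^ m : ℝ)⁻¹ * (2 * (κ₀ * 2 ^ m) + |ξ|) := by
          have : 0 ≤ (2 ^ m : ℝ)⁻¹ * |ξ| := by positivity
          have : 0 ≤ (2 ^ m : ℝ)⁻¹ * 2 ^ m * κ₀ := by positivity
          linarith
  · have e : (2⁻¹ : ℝ≥0∞) ^ (m - k) * ((k - m : ℕ) + 2) ^ 2 =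
        ENNReal.ofReal ((1 / 2) ^ (m - k) * ((k - m : ℕ) + 2) ^ 2) := by
      rw [inv_two_pow_eq, ENNReal.ofReal_mul (by positivity),
        ENNReal.ofReal_pow (p := (k - m : ℕ) + 2) (by positivity),
        ENNReal.ofReal_add (by positivity) (by norm_num)]
      simp
    rw [e]
    refine ENNReal.ofReal_le_ofReal ?_
    have h0 := abs_nonneg ξ
    have hH := shell_mul_le hκ m k hξ.1
    obtain ⟨a, b, e1, e2, e3, e4, ha, ha1, hb1, hab⟩ := two_pow_factor m k
    have hP : (0:ℝ) < 2 ^ m := by positivity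
    have hl : 0 ≤ Real.log (1 + |ξ| / (2 * (κ₀ * 2 ^ m))) :=
      Real.log_nonneg (by have : 0 ≤ |ξ| / (2 * (κ₀ * 2 ^ m)) := by positivity
                          linarith)
    have hl1 : Real.log (1 + |ξ| / (2 * (κ₀ * 2 ^ m))) ≤ (k - m : ℕ) + 1 := by
      have : 1 + |ξ| / (2 * (κ₀ * 2 ^ m)) ≤ 2 ^ (k - m + 1) := by
        have : |ξ| / (2 * (κ₀ * 2 ^ m)) ≤ b := by
          rw [div_le_iff₀ (by positivity)]
          refine hξ.2.trans ?_
          rw [e4]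
          have : a * (2 ^ m * b * κ₀) ≤ 1 * (2 ^ m * b * κ₀) := by gcongr
          linarith
        rw [pow_succ, e2]; linarith
      refine (Real.log_le_log (by positivity) this).trans ?_
      rw [Real.log_pow]
      push_cast
      have : Real.log 2 ≤ 1 := (Real.log_two_lt_d9.le).trans (by norm_num)
      exact mul_le_of_le_one_right (by positivity) this
    calc _ = (1 + Real.log (1 + |ξ| / (2 * (κ₀ * 2 ^ m)))) ^ 2 *
          (1 / (2 * (κ₀ * 2 ^ m) + |ξ|) * (κ₀ * 2 ^ k)) := by ring
      _ ≤ (1 + ((k - m : ℕ) + 1)) ^ 2 * (1 / 2) ^ (m - k) := by gcongr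
      _ = _ := by ring

/-- The Lorentzian decays geometrically on both sides of |ξ| ≈ κ₀2^m, in contrast to `wH`. This is
why the main term loses no power of m in either norm. -/
lemma quadEnergy_le_dyadic {κ₀ : ℝ} (hκ : 0 < κ₀) (f : ℝ → ℂ) (m : ℕ) :
    quadEnergy (κ₀ * 2 ^ m) f ≤
      2⁻¹ ^ m * lowEnergy κ₀ f +
        ∑' k, 2 * (2⁻¹ ^ (m - k) * 2⁻¹ ^ (k - m)) * dyadicEnergy κ₀ f k := by
  rw [quadEnergy_eq]
  refine lintegral_weight_le_dyadic hκ f (fun ξ hξ => ?_) (fun k ξ hξ => ?_) (by simp)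
    (fun k => ENNReal.mul_ne_top (by simp) (ENNReal.mul_ne_top (by simp) (by simp)))
  · rw [inv_two_pow_eq]
    refine ENNReal.ofReal_le_ofReal ?_
    have hP : (0:ℝ) < 2 ^ m := by positivity
    rw [div_mul_eq_mul_div, div_le_iff₀ (by positivity), one_div, inv_pow, le_inv_mul_iff₀ hP]
    have : 0 ≤ (κ₀ * 2 ^ m) ^ 2 := by positivity
    have : 0 ≤ |ξ| ^ 2 := by positivity
    linarith
  · have e : 2 * ((2⁻¹ : ℝ≥0∞) ^ (m - k) * 2⁻¹ ^ (k - m)) =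
        ENNReal.ofReal (2 * ((1 / 2) ^ (m - k) * (1 / 2) ^ (k - m))) := by
      rw [inv_two_pow_eq, inv_two_pow_eq, ENNReal.ofReal_mul (by positivity),
        ENNReal.ofReal_mul (by positivity)]
      simp
    rw [e]
    refine ENNReal.ofReal_le_ofReal ?_
    have h1 := hξ.1
    obtain ⟨a, b, e1, e2, e3, e4, ha, ha1, hb1, hab⟩ := two_pow_factor m k
    have hP : (0:ℝ) < 2 ^ m := by positivity
    have hx : 0 ≤ |ξ| ^ 2 := by positivity
    rw [e1, e3, div_mul_eq_mul_div, div_le_iff₀ (by positivity)]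
    -- For shells at or above scale m the denominator is bounded below through |ξ|², for the others
    -- through κ².
    rcases hab with rfl | rfl
    · have hx2 : (2 ^ k * κ₀) ^ 2 ≤ |ξ| ^ 2 := by gcongr
      rw [e4] at hx2 ⊢
      have h2 : (1 * 2 ^ m * b * κ₀) ^ 2 = b * (2 ^ m * κ₀ * (2 ^ m * κ₀ * b)) := by ring
      have h3 : 2 ^ m * κ₀ * (2 ^ m * κ₀ * b) ≤ b⁻¹ * |ξ| ^ 2 := by
        rw [le_inv_mul_iff₀ (by positivity), ← h2]; exact hx2
      have h4 : 0 ≤ b⁻¹ * (κ₀ * 2 ^ m) ^ 2 := by positivity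
      linarith
    · rw [e4, inv_one]
      have h4 : 0 ≤ a * (κ₀ * 2 ^ m) ^ 2 := by positivity
      have h5 : 0 ≤ a * |ξ| ^ 2 := by positivity
      linarith

lemma dyadicEnergy_le_quadEnergy {κ₀ : ℝ} (hκ : 0 < κ₀) (f : ℝ → ℂ) (m : ℕ) :
    dyadicEnergy κ₀ f m ≤ 4 * quadEnergy (κ₀ * 2 ^ m) f := by
  rw [quadEnergy_eq, mul_comm (4 : ℝ≥0∞), ← ENNReal.div_le_iff (by simp) (by simp),
    ENNReal.div_eq_inv_mul]
  refine dyadic_le_lintegral_weight hκ f (fun ξ hξ => ?_) (by simp)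
  have e : (4⁻¹ : ℝ≥0∞) = ENNReal.ofReal 4⁻¹ := by
    rw [ENNReal.ofReal_inv_of_pos (by norm_num)]; simp
  rw [e]
  refine ENNReal.ofReal_le_ofReal ?_
  have hP : (0:ℝ) < 2 ^ m := by positivity
  have hx : |ξ| ^ 2 ≤ (2 * 2 ^ m * κ₀) ^ 2 := by gcongr; exact hξ.2
  rw [div_mul_eq_mul_div, le_div_iff₀ (by positivity)]
  linarith

lemma lowEnergy_le_quadEnergy {κ₀ : ℝ} (hκ : 0 < κ₀) (f : ℝ → ℂ) :
    lowEnergy κ₀ f ≤ 4 * quadEnergy κ₀ f := by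
  rw [quadEnergy_eq, mul_comm (4 : ℝ≥0∞), ← ENNReal.div_le_iff (by simp) (by simp),
    ENNReal.div_eq_inv_mul]
  refine low_le_lintegral_weight hκ f (fun ξ hξ => ?_) (by simp)
  have e : (4⁻¹ : ℝ≥0∞) = ENNReal.ofReal 4⁻¹ := by
    rw [ENNReal.ofReal_inv_of_pos (by norm_num)]; simp
  rw [e]
  refine ENNReal.ofReal_le_ofReal ?_
  have hx : |ξ| ^ 2 ≤ κ₀ ^ 2 := by gcongr
  rw [div_mul_eq_mul_div, le_div_iff₀ (by positivity)]
  nlinarith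

/-! ### Discrete summation with polynomial weights. -/

/-- The convergent series `∑ (j + 1) ^ 5 / 2 ^ j`. -/
def geomConst : ℝ≥0∞ := ∑' j : ℕ, ((j : ℝ≥0∞) + 1) ^ 5 * 2⁻¹ ^ j

lemma geomConst_ne_top : geomConst ≠ ⊤ := by
  have hs : Summable fun j : ℕ => ((j : ℝ) + 1) ^ 5 * (1 / 2) ^ j := by
    have h := summable_pow_mul_geometric_of_norm_lt_one 5 (r := (1 / 2 : ℝ)) (by norm_num)
    have h1 := ((summable_nat_add_iff 1).2 h).mul_left 2
    refine h1.congr fun j => ?_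
    push_cast
    rw [pow_succ (1 / 2 : ℝ) j]; ring
  have e : geomConst = ∑' j : ℕ, ENNReal.ofReal (((j : ℝ) + 1) ^ 5 * (1 / 2) ^ j) := by
    refine tsum_congr fun j => ?_
    rw [inv_two_pow_eq, ENNReal.ofReal_mul (by positivity),
      ENNReal.ofReal_pow (p := (j : ℝ) + 1) (by positivity),
      ENNReal.ofReal_add (by positivity) (by norm_num)]
    simp
  rw [e]
  exact hs.tsum_ofReal_ne_top

lemma geomConst_term_le (j : ℕ) : ((j : ℝ≥0∞) + 1) ^ 5 * 2⁻¹ ^ j ≤ geomConst :=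
  ENNReal.le_tsum j

lemma one_le_geomConst : 1 ≤ geomConst := by simpa using geomConst_term_le 0

lemma one_le_natCast_add_one (j : ℕ) : (1 : ℝ≥0∞) ≤ (j : ℝ≥0∞) + 1 := le_add_self

lemma geomConst_term_le' {n : ℕ} (hn : n ≤ 5) (j : ℕ) :
    ((j : ℝ≥0∞) + 1) ^ n * 2⁻¹ ^ j ≤ geomConst :=
  (mul_le_mul_left (pow_le_pow_right₀ (one_le_natCast_add_one j) hn) _).trans (geomConst_term_le j)

lemma tsum_split (F : ℕ → ℝ≥0∞) (m : ℕ) :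
    ∑' k, F k = ∑ j ∈ Finset.range (m + 1), F (m - j) + ∑' j, F (m + 1 + j) := by
  have h : ∑ j ∈ Finset.range (m + 1), F j + ∑' j, F (j + (m + 1)) = ∑' k, F k :=
    Summable.sum_add_tsum_nat_add' ENNReal.summable
  rw [← h, ← Finset.sum_range_reflect F (m + 1)]
  simp only [Nat.add_sub_cancel, add_comm (m + 1)]

lemma sum_le_geomConst (m : ℕ) :
    ∑ j ∈ Finset.range m, ((j : ℝ≥0∞) + 1) ^ 5 * 2⁻¹ ^ j ≤ geomConst :=
  ENNReal.sum_le_tsum _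

lemma tsum_shift_le_geomConst : ∑' j : ℕ, (((j + 1 : ℕ) : ℝ≥0∞) + 1) ^ 5 * 2⁻¹ ^ (j + 1) ≤ geomConst :=
  ENNReal.tsum_comp_le_tsum_of_injective (add_left_injective 1)
    (fun j : ℕ => ((j : ℝ≥0∞) + 1) ^ 5 * 2⁻¹ ^ j)

lemma tsum_gap_le (m : ℕ) :
    ∑' k : ℕ, (((m - k : ℕ) : ℝ≥0∞) + 1) ^ 5 * (((k - m : ℕ) : ℝ≥0∞) + 1) ^ 5 *
      (2⁻¹ ^ (m - k) * 2⁻¹ ^ (k - m)) ≤ 2 * geomConst := by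
  rw [tsum_split _ m, two_mul]
  refine add_le_add ((Finset.sum_le_sum fun j hj => ?_).trans (sum_le_geomConst (m + 1)))
    ((ENNReal.tsum_le_tsum fun j => ?_).trans tsum_shift_le_geomConst)
  · have h : j ≤ m := by simpa [Nat.lt_succ_iff] using hj
    rw [Nat.sub_sub_self h, Nat.sub_eq_zero_of_le (Nat.sub_le m j)]
    simp
  · rw [show m - (m + 1 + j) = 0 by omega, show m + 1 + j - m = j + 1 by omega]
    simp

/-- Polynomial weights move from m to k at the price of a power of the truncated gap m − k, which
the geometric factor absorbs. For k ≥ m nothing is lost. -/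
lemma natCast_le_gap_mul (m k : ℕ) :
    ((m : ℝ≥0∞) + 1) ≤ (((m - k : ℕ) : ℝ≥0∞) + 1) * ((k : ℝ≥0∞) + 1) := by
  have h : m + 1 ≤ (m - k + 1) * (k + 1) := by
    have : m ≤ (m - k) + k := by omega
    nlinarith [Nat.zero_le ((m - k) * k)]
  exact_mod_cast h

lemma natCast_gap_sq_le (m k : ℕ) :
    (((k - m : ℕ) : ℝ≥0∞) + 2) ^ 2 ≤ 4 * ((k : ℝ≥0∞) + 1) ^ 2 := by
  have h : (k - m + 2) ^ 2 ≤ 4 * (k + 1) ^ 2 := by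
    have : k - m + 2 ≤ 2 * (k + 1) := by omega
    calc _ ≤ (2 * (k + 1)) ^ 2 := Nat.pow_le_pow_left this 2
      _ = _ := by ring
  exact_mod_cast h

lemma tsum_inv_sq_tail_le (m : ℕ) :
    ∑' j : ℕ, ((m : ℝ≥0∞) + 1) * ((((m + 1 + j : ℕ) : ℝ≥0∞) + 1) ^ 2)⁻¹ ≤ 1 := by
  have hterm : ∀ j : ℕ, ((m : ℝ≥0∞) + 1) * ((((m + 1 + j : ℕ) : ℝ≥0∞) + 1) ^ 2)⁻¹ =
      ENNReal.ofReal (((m : ℝ) + 1) * (((m : ℝ) + 1 + j + 1) ^ 2)⁻¹) := fun j => by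
    rw [ENNReal.ofReal_mul (by positivity), ENNReal.ofReal_inv_of_pos (by positivity),
      ENNReal.ofReal_pow (p := (m : ℝ) + 1 + j + 1) (by positivity)]
    have h1 : ENNReal.ofReal ((m : ℝ) + 1) = (m : ℝ≥0∞) + 1 := by
      exact_mod_cast ENNReal.ofReal_natCast (m + 1)
    have h2 : ENNReal.ofReal ((m : ℝ) + 1 + j + 1) = ((m + 1 + j : ℕ) : ℝ≥0∞) + 1 := by
      exact_mod_cast ENNReal.ofReal_natCast (m + 1 + j + 1)
    rw [h1, h2]
  refine ENNReal.tsum_le_of_sum_range_le fun n => ?_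
  simp only [hterm]
  rw [← ENNReal.ofReal_sum_of_nonneg fun j _ => by positivity, ← ENNReal.ofReal_one]
  refine ENNReal.ofReal_le_ofReal ?_
  have hsum : ∑ j ∈ Finset.range n, ((m : ℝ) + 1) * (((m : ℝ) + 1 + j + 1) ^ 2)⁻¹ ≤
      1 - ((m : ℝ) + 1) / (m + 1 + n) := by
    induction n with
    | zero => simp; rw [div_self (by positivity)]
    | succ n ih =>
      rw [Finset.sum_range_succ]
      refine (add_le_add_left ih _).trans ?_
      have hx : (0:ℝ) < (m : ℝ) + 1 := by positivity
      have hy : (0:ℝ) < (m : ℝ) + 1 + n := by positivity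
      push_cast
      have : ((m : ℝ) + 1) * (((m : ℝ) + 1 + n + 1) ^ 2)⁻¹ ≤
          ((m : ℝ) + 1) / (m + 1 + n) - ((m : ℝ) + 1) / (m + 1 + (n + 1)) := by
        rw [div_eq_mul_inv, div_eq_mul_inv, ← mul_sub]
        refine mul_le_mul_of_nonneg_left ?_ hx.le
        rw [inv_sub_inv hy.ne' (by positivity), inv_eq_one_div,
          div_le_div_iff₀ (by positivity) (by positivity)]
        nlinarith
      linarith
  have : (0:ℝ) ≤ ((m : ℝ) + 1) / (m + 1 + n) := by positivity
  linarith

/-- Above scale m the kernel does not decay, and summability comes only from 1/(k+1)², whose tail is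
of order 1/(m+1). This tail accounts for the explicit factor m + 1. -/
lemma tsum_gap_inv_sq_le (m : ℕ) :
    ∑' k : ℕ, ((m : ℝ≥0∞) + 1) * ((((m - k : ℕ) : ℝ≥0∞) + 1) ^ 4 * 2⁻¹ ^ (m - k) *
      (((k : ℝ≥0∞) + 1) ^ 2)⁻¹) ≤ 2 * geomConst := by
  rw [tsum_split _ m, two_mul]
  refine add_le_add ((Finset.sum_le_sum fun j hj => ?_).trans (sum_le_geomConst (m + 1)))
    (((ENNReal.tsum_le_tsum fun j => ?_).trans (tsum_inv_sq_tail_le m)).trans one_le_geomConst)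
  · have h : j ≤ m := by simpa [Nat.lt_succ_iff] using hj
    rw [Nat.sub_sub_self h]
    have h1 := natCast_le_gap_mul m (m - j)
    rw [Nat.sub_sub_self h] at h1
    set a : ℝ≥0∞ := ((m - j : ℕ) : ℝ≥0∞) + 1
    have ha : 1 ≤ a := one_le_natCast_add_one _
    have h2 : a * (a ^ 2)⁻¹ ≤ 1 := by
      rw [← div_eq_mul_inv]
      refine ENNReal.div_le_of_le_mul ?_
      rw [one_mul, sq]
      exact le_mul_of_one_le_right zero_le ha
    calc _ ≤ (((j : ℝ≥0∞) + 1) * a) * (((j : ℝ≥0∞) + 1) ^ 4 * 2⁻¹ ^ j * (a ^ 2)⁻¹) := by gcongr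
      _ = ((j : ℝ≥0∞) + 1) ^ 5 * 2⁻¹ ^ j * (a * (a ^ 2)⁻¹) := by ring
      _ ≤ _ := mul_le_of_le_one_right zero_le h2
  · rw [show m - (m + 1 + j) = 0 by omega]
    simp

/-- The k + 1 terms with m ≤ k each contribute at most (k+1)², which produces the third power. The
terms m > k are geometric. -/
lemma tsum_sq_gap_le (k : ℕ) :
    ∑' m : ℕ, ((m : ℝ≥0∞) + 1) ^ 2 * 2⁻¹ ^ (m - k) ≤ 2 * geomConst * ((k : ℝ≥0∞) + 1) ^ 3 := by
  rw [tsum_split _ k, two_mul, add_mul]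
  refine add_le_add ?_ ?_
  · calc _ ≤ ∑ j ∈ Finset.range (k + 1), ((k : ℝ≥0∞) + 1) ^ 2 := by
          refine Finset.sum_le_sum fun j hj => ?_
          rw [Nat.sub_eq_zero_of_le (Nat.sub_le k j), pow_zero, mul_one]
          gcongr
          exact Nat.sub_le k j
      _ = 1 * ((k : ℝ≥0∞) + 1) ^ 3 := by
          rw [Finset.sum_const, Finset.card_range, nsmul_eq_mul]; push_cast; ring
      _ ≤ _ := by gcongr; exact one_le_geomConst
  · calc _ ≤ ∑' j : ℕ, (((j + 1 : ℕ) : ℝ≥0∞) + 1) ^ 5 * 2⁻¹ ^ (j + 1) * ((k : ℝ≥0∞) + 1) ^ 3 := by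
          refine ENNReal.tsum_le_tsum fun j => ?_
          have h1 := natCast_le_gap_mul (k + 1 + j) k
          rw [show k + 1 + j - k = j + 1 by omega] at h1 ⊢
          calc _ ≤ ((((j + 1 : ℕ) : ℝ≥0∞) + 1) * ((k : ℝ≥0∞) + 1)) ^ 2 * 2⁻¹ ^ (j + 1) := by gcongr
            _ = (((j + 1 : ℕ) : ℝ≥0∞) + 1) ^ 2 * 2⁻¹ ^ (j + 1) * ((k : ℝ≥0∞) + 1) ^ 2 := by ring
            _ ≤ _ := by
              gcongr
              · exact one_le_natCast_add_one _
              · norm_num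
              · exact one_le_natCast_add_one _
              · norm_num
      _ ≤ _ := by
          rw [ENNReal.tsum_mul_right]
          gcongr
          exact tsum_shift_le_geomConst

section sup

variable {L M : ℝ≥0∞} {B : ℕ → ℝ≥0∞}

lemma pow_mul_quad_le_of_sup (hL : L ≤ M) (hB : ∀ k : ℕ, ((k : ℝ≥0∞) + 1) ^ 4 * B k ≤ M) (m : ℕ) :
    ((m : ℝ≥0∞) + 1) ^ 4 *
      (2⁻¹ ^ m * L + ∑' k, 2 * (2⁻¹ ^ (m - k) * 2⁻¹ ^ (k - m)) * B k) ≤ 5 * geomConst * M := by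
  rw [mul_add, ← ENNReal.tsum_mul_left, ← mul_assoc]
  have h1 : ((m : ℝ≥0∞) + 1) ^ 4 * 2⁻¹ ^ m * L ≤ geomConst * M :=
    mul_le_mul' (geomConst_term_le' (by norm_num) m) hL
  have h2 : ∑' k : ℕ, ((m : ℝ≥0∞) + 1) ^ 4 * (2 * (2⁻¹ ^ (m - k) * 2⁻¹ ^ (k - m)) * B k) ≤
      2 * geomConst * (2 * M) := by
    refine le_trans (ENNReal.tsum_le_tsum fun k => ?_)
      ((ENNReal.tsum_mul_right).le.trans (mul_le_mul_left (tsum_gap_le m) (2 * M)))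
    have ha := one_le_natCast_add_one (m - k)
    have hb := one_le_natCast_add_one (k - m)
    calc _ ≤ ((((m - k : ℕ) : ℝ≥0∞) + 1) * ((k : ℝ≥0∞) + 1)) ^ 4 *
          (2 * (2⁻¹ ^ (m - k) * 2⁻¹ ^ (k - m)) * B k) := by
            gcongr; exact natCast_le_gap_mul m k
      _ = (((m - k : ℕ) : ℝ≥0∞) + 1) ^ 4 * 1 * (2⁻¹ ^ (m - k) * 2⁻¹ ^ (k - m)) *
          (2 * (((k : ℝ≥0∞) + 1) ^ 4 * B k)) := by ring
      _ ≤ _ := by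
        gcongr
        · norm_num
        · exact one_le_pow₀ hb
        · exact hB k
  calc _ ≤ geomConst * M + 2 * geomConst * (2 * M) := add_le_add h1 h2
    _ = _ := by ring

lemma sq_mul_le_of_sup (hB : ∀ k : ℕ, ((k : ℝ≥0∞) + 1) ^ 4 * B k ≤ M) (k : ℕ) :
    ((k : ℝ≥0∞) + 1) ^ 2 * B k ≤ M * (((k : ℝ≥0∞) + 1) ^ 2)⁻¹ := by
  rw [← div_eq_mul_inv]
  have h0 : ((k : ℝ≥0∞) + 1) ^ 2 ≠ 0 := by simp
  have ht : ((k : ℝ≥0∞) + 1) ^ 2 ≠ ⊤ := by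
    exact_mod_cast ENNReal.natCast_ne_top ((k + 1) ^ 2)
  rw [ENNReal.le_div_iff_mul_le (Or.inl h0) (Or.inl ht)]
  calc _ = ((k : ℝ≥0∞) + 1) ^ 4 * B k := by ring
    _ ≤ M := hB k

/-- The tail over k > m costs one of the four powers. The `wK` factor below retains the remaining
one. -/
lemma pow_mul_wH_le_of_sup (hL : L ≤ M) (hB : ∀ k : ℕ, ((k : ℝ≥0∞) + 1) ^ 4 * B k ≤ M) (m : ℕ) :
    ((m : ℝ≥0∞) + 1) ^ 3 * (2⁻¹ ^ m * L + ∑' k, 2⁻¹ ^ (m - k) * B k) ≤ 3 * geomConst * M := by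
  rw [mul_add, ← ENNReal.tsum_mul_left, ← mul_assoc]
  have h1 : ((m : ℝ≥0∞) + 1) ^ 3 * 2⁻¹ ^ m * L ≤ geomConst * M :=
    mul_le_mul' (geomConst_term_le' (by norm_num) m) hL
  have h2 : ∑' k : ℕ, ((m : ℝ≥0∞) + 1) ^ 3 * (2⁻¹ ^ (m - k) * B k) ≤ 2 * geomConst * M := by
    refine le_trans (ENNReal.tsum_le_tsum fun k => ?_)
      ((ENNReal.tsum_mul_right).le.trans (mul_le_mul_left (tsum_gap_inv_sq_le m) M))
    have ha := one_le_natCast_add_one (m - k)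
    calc _ = ((m : ℝ≥0∞) + 1) * ((m : ℝ≥0∞) + 1) ^ 2 * (2⁻¹ ^ (m - k) * B k) := by ring
      _ ≤ ((m : ℝ≥0∞) + 1) * ((((m - k : ℕ) : ℝ≥0∞) + 1) * ((k : ℝ≥0∞) + 1)) ^ 2 *
          (2⁻¹ ^ (m - k) * B k) := by gcongr; exact natCast_le_gap_mul m k
      _ = ((m : ℝ≥0∞) + 1) * ((((m - k : ℕ) : ℝ≥0∞) + 1) ^ 2 * 2⁻¹ ^ (m - k) *
          (((k : ℝ≥0∞) + 1) ^ 2 * B k)) := by ring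
      _ ≤ ((m : ℝ≥0∞) + 1) * ((((m - k : ℕ) : ℝ≥0∞) + 1) ^ 4 * 2⁻¹ ^ (m - k) *
          (M * (((k : ℝ≥0∞) + 1) ^ 2)⁻¹)) := by
        refine mul_le_mul_right (mul_le_mul' ?_ (sq_mul_le_of_sup hB k)) _
        gcongr
        norm_num
      _ = _ := by ring
  calc _ ≤ geomConst * M + 2 * geomConst * M := add_le_add h1 h2
    _ = _ := by ring

lemma mul_wK_le_of_sup (hL : L ≤ M) (hB : ∀ k : ℕ, ((k : ℝ≥0∞) + 1) ^ 4 * B k ≤ M) (m : ℕ) :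
    ((m : ℝ≥0∞) + 1) *
      (4 * 2⁻¹ ^ m * L + ∑' k, 2⁻¹ ^ (m - k) * ((k - m : ℕ) + 2) ^ 2 * B k) ≤
      12 * geomConst * M := by
  rw [mul_add, ← ENNReal.tsum_mul_left]
  have h1 : ((m : ℝ≥0∞) + 1) * (4 * 2⁻¹ ^ m * L) ≤ 4 * geomConst * M := by
    calc _ = 4 * (((m : ℝ≥0∞) + 1) ^ 1 * 2⁻¹ ^ m) * L := by ring
      _ ≤ _ := by gcongr; exact geomConst_term_le' (by norm_num) m
  have h2 : ∑' k : ℕ, ((m : ℝ≥0∞) + 1) * (2⁻¹ ^ (m - k) * ((k - m : ℕ) + 2) ^ 2 * B k) ≤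
      2 * geomConst * (4 * M) := by
    refine le_trans (ENNReal.tsum_le_tsum fun k => ?_)
      ((ENNReal.tsum_mul_right).le.trans (mul_le_mul_left (tsum_gap_inv_sq_le m) (4 * M)))
    have ha := one_le_natCast_add_one (m - k)
    calc _ ≤ ((m : ℝ≥0∞) + 1) * (2⁻¹ ^ (m - k) * (4 * ((k : ℝ≥0∞) + 1) ^ 2) * B k) := by
          gcongr; exact natCast_gap_sq_le m k
      _ = ((m : ℝ≥0∞) + 1) * (1 * 2⁻¹ ^ (m - k) * (4 * (((k : ℝ≥0∞) + 1) ^ 2 * B k))) := by ring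
      _ ≤ ((m : ℝ≥0∞) + 1) * ((((m - k : ℕ) : ℝ≥0∞) + 1) ^ 4 * 2⁻¹ ^ (m - k) *
          (4 * (M * (((k : ℝ≥0∞) + 1) ^ 2)⁻¹))) := by
        refine mul_le_mul_right (mul_le_mul' ?_
          (mul_le_mul_right (sq_mul_le_of_sup hB k) 4)) _
        gcongr
        exact one_le_pow₀ ha
      _ = _ := by ring
  calc _ ≤ 4 * geomConst * M + 2 * geomConst * (4 * M) := add_le_add h1 h2
    _ = _ := by ring

end sup

section sum

variable (L : ℝ≥0∞) (B : ℕ → ℝ≥0∞)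

lemma mul_wK_le_of_sum (m : ℕ) :
    ((m : ℝ≥0∞) + 1) *
      (4 * 2⁻¹ ^ m * L + ∑' k, 2⁻¹ ^ (m - k) * ((k - m : ℕ) + 2) ^ 2 * B k) ≤
      4 * geomConst * (L + ∑' k : ℕ, ((k : ℝ≥0∞) + 1) ^ 3 * B k) := by
  rw [mul_add, ← ENNReal.tsum_mul_left, mul_add, ← ENNReal.tsum_mul_left]
  refine add_le_add ?_ (ENNReal.tsum_le_tsum fun k => ?_)
  · calc _ = 4 * (((m : ℝ≥0∞) + 1) ^ 1 * 2⁻¹ ^ m) * L := by ring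
      _ ≤ _ := by gcongr; exact geomConst_term_le' (by norm_num) m
  · calc _ ≤ (((m - k : ℕ) : ℝ≥0∞) + 1) * ((k : ℝ≥0∞) + 1) *
          (2⁻¹ ^ (m - k) * (4 * ((k : ℝ≥0∞) + 1) ^ 2) * B k) := by
          gcongr
          · exact natCast_le_gap_mul m k
          · exact natCast_gap_sq_le m k
      _ = 4 * ((((m - k : ℕ) : ℝ≥0∞) + 1) ^ 1 * 2⁻¹ ^ (m - k)) *
          (((k : ℝ≥0∞) + 1) ^ 3 * B k) := by ring
      _ ≤ _ := by gcongr; exact geomConst_term_le' (by norm_num) _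

/-- The order of summation is exchanged, and each shell k collects the weight of `tsum_sq_gap_le`.
-/
lemma tsum_sq_mul_wH_le :
    ∑' m : ℕ, ((m : ℝ≥0∞) + 1) ^ 2 * (2⁻¹ ^ m * L + ∑' k, 2⁻¹ ^ (m - k) * B k) ≤
      2 * geomConst * (L + ∑' k : ℕ, ((k : ℝ≥0∞) + 1) ^ 3 * B k) := by
  simp only [mul_add]
  rw [ENNReal.tsum_add, ← ENNReal.tsum_mul_left]
  refine add_le_add ?_ ?_
  · simp only [← mul_assoc]
    rw [ENNReal.tsum_mul_right]
    gcongr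
    calc _ ≤ ∑' m : ℕ, ((m : ℝ≥0∞) + 1) ^ 5 * 2⁻¹ ^ m := by
          refine ENNReal.tsum_le_tsum fun m => ?_
          gcongr
          · exact one_le_natCast_add_one m
          · norm_num
      _ = 1 * geomConst := (one_mul _).symm
      _ ≤ _ := by gcongr; norm_num
  · simp only [← ENNReal.tsum_mul_left]
    rw [ENNReal.tsum_comm]
    refine ENNReal.tsum_le_tsum fun k => ?_
    simp only [← mul_assoc]
    rw [ENNReal.tsum_mul_right]
    gcongr
    exact tsum_sq_gap_le k

lemma tsum_cube_mul_quad_le :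
    ∑' m : ℕ, ((m : ℝ≥0∞) + 1) ^ 3 *
      (2⁻¹ ^ m * L + ∑' k, 2 * (2⁻¹ ^ (m - k) * 2⁻¹ ^ (k - m)) * B k) ≤
      4 * geomConst * (L + ∑' k : ℕ, ((k : ℝ≥0∞) + 1) ^ 3 * B k) := by
  simp only [mul_add]
  rw [ENNReal.tsum_add, ← ENNReal.tsum_mul_left]
  refine add_le_add ?_ ?_
  · simp only [← mul_assoc]
    rw [ENNReal.tsum_mul_right]
    gcongr
    calc _ ≤ ∑' m : ℕ, ((m : ℝ≥0∞) + 1) ^ 5 * 2⁻¹ ^ m := by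
          refine ENNReal.tsum_le_tsum fun m => ?_
          gcongr
          · exact one_le_natCast_add_one m
          · norm_num
      _ = 1 * geomConst := (one_mul _).symm
      _ ≤ _ := by gcongr; norm_num
  · simp only [← ENNReal.tsum_mul_left]
    rw [ENNReal.tsum_comm]
    refine ENNReal.tsum_le_tsum fun k => ?_
    calc _ ≤ ∑' m : ℕ, (((k - m : ℕ) : ℝ≥0∞) + 1) ^ 5 * (((m - k : ℕ) : ℝ≥0∞) + 1) ^ 5 *
          (2⁻¹ ^ (k - m) * 2⁻¹ ^ (m - k)) * (2 * (((k : ℝ≥0∞) + 1) ^ 3 * B k)) := by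
          refine ENNReal.tsum_le_tsum fun m => ?_
          have ha := one_le_natCast_add_one (m - k)
          have hb := one_le_natCast_add_one (k - m)
          calc _ ≤ ((((m - k : ℕ) : ℝ≥0∞) + 1) * ((k : ℝ≥0∞) + 1)) ^ 3 *
                (2 * (2⁻¹ ^ (m - k) * 2⁻¹ ^ (k - m)) * B k) := by
                  gcongr; exact natCast_le_gap_mul m k
            _ = 1 * (((m - k : ℕ) : ℝ≥0∞) + 1) ^ 3 * (2⁻¹ ^ (k - m) * 2⁻¹ ^ (m - k)) *
                (2 * (((k : ℝ≥0∞) + 1) ^ 3 * B k)) := by ring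
            _ ≤ _ := by
              gcongr
              · exact one_le_pow₀ hb
              · norm_num
      _ ≤ 2 * geomConst * (2 * (((k : ℝ≥0∞) + 1) ^ 3 * B k)) := by
          rw [ENNReal.tsum_mul_right]
          gcongr
          exact tsum_gap_le k
      _ = _ := by ring

end sum

/-! ### Comparison with the norms of the theorem. -/

/-- The square of the `X` norm, with `log (2 N)` replaced by the dyadic exponent. -/
def specX (κ₀ : ℝ) (f : ℝ → ℂ) : ℝ≥0∞ :=
  lowEnergy κ₀ f + ∑' k : ℕ, ((k : ℝ≥0∞) + 1) ^ 3 * dyadicEnergy κ₀ f k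

/-- The square of the `Y` norm, with `log (2 N)` replaced by the dyadic exponent. -/
def specY (κ₀ : ℝ) (f : ℝ → ℂ) : ℝ≥0∞ :=
  max (lowEnergy κ₀ f) (⨆ k : ℕ, ((k : ℝ≥0∞) + 1) ^ 4 * dyadicEnergy κ₀ f k)

lemma log_two_mul_two_pow (k : ℕ) : Real.log (2 * 2 ^ k) = (k + 1) * Real.log 2 := by
  rw [← pow_succ', Real.log_pow]; push_cast; ring

lemma log_two_bounds : 1 / 2 ≤ Real.log 2 ∧ Real.log 2 ≤ 1 :=
  ⟨by linarith [Real.log_two_gt_d9], by linarith [Real.log_two_lt_d9]⟩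

lemma ofReal_natCast_add_one_pow (k n : ℕ) :
    ENNReal.ofReal (((k : ℝ) + 1) ^ n) = ((k : ℝ≥0∞) + 1) ^ n := by
  rw [ENNReal.ofReal_pow (by positivity)]
  congr 1
  exact_mod_cast ENNReal.ofReal_natCast (k + 1)

lemma ofReal_log_pow_le (k n : ℕ) :
    ENNReal.ofReal (Real.log (2 * 2 ^ k) ^ n) ≤ ((k : ℝ≥0∞) + 1) ^ n := by
  rw [← ofReal_natCast_add_one_pow, log_two_mul_two_pow]
  refine ENNReal.ofReal_le_ofReal ?_
  have := log_two_bounds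
  have : 0 ≤ Real.log 2 := by linarith
  gcongr
  · exact mul_le_of_le_one_right (by positivity) log_two_bounds.2

/-- Here log(2·2^k) = (k+1) log 2 with 1/2 ≤ log 2 ≤ 1, so powers of the logarithm and of k + 1 are
comparable. -/
lemma le_ofReal_log_pow (k n : ℕ) :
    ((k : ℝ≥0∞) + 1) ^ n ≤ 2 ^ n * ENNReal.ofReal (Real.log (2 * 2 ^ k) ^ n) := by
  have e : (2 : ℝ≥0∞) ^ n = ENNReal.ofReal (2 ^ n) := by
    rw [ENNReal.ofReal_pow (by norm_num)]; simp
  rw [← ofReal_natCast_add_one_pow, log_two_mul_two_pow, e, ← ENNReal.ofReal_mul (by positivity),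
    ← mul_pow]
  refine ENNReal.ofReal_le_ofReal ?_
  have := log_two_bounds.1
  gcongr
  nlinarith [(Nat.cast_nonneg k : (0:ℝ) ≤ k)]

lemma normX_sq (κ₀ : ℝ) (f : ℝ → ℂ) (hκ : 0 < κ₀) :
    normX κ₀ f ^ 2 = lowEnergy κ₀ f +
      ∑' k : ℕ, ENNReal.ofReal (Real.log (2 * 2 ^ k) ^ 3) * dyadicEnergy κ₀ f k := by
  rw [normX, ← ENNReal.rpow_natCast, ← ENNReal.rpow_mul]
  norm_num
  rw [lowEnergy]
  congr 1
  refine tsum_congr fun k => ?_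
  rw [dyadicEnergy, div_eq_mul_inv, ENNReal.ofReal_mul' (by positivity), mul_assoc]

lemma normX_sq_le {κ₀ : ℝ} (hκ : 0 < κ₀) (f : ℝ → ℂ) : normX κ₀ f ^ 2 ≤ specX κ₀ f := by
  rw [normX_sq κ₀ f hκ, specX]
  gcongr with k
  exact ofReal_log_pow_le k 3

lemma specX_le {κ₀ : ℝ} (hκ : 0 < κ₀) (f : ℝ → ℂ) : specX κ₀ f ≤ 16 * normX κ₀ f ^ 2 := by
  rw [normX_sq κ₀ f hκ, specX, mul_add, ← ENNReal.tsum_mul_left]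
  refine add_le_add (le_mul_of_one_le_left zero_le (by norm_num))
    (ENNReal.tsum_le_tsum fun k => ?_)
  rw [← mul_assoc]
  gcongr
  refine (le_ofReal_log_pow k 3).trans ?_
  gcongr
  norm_num

lemma sq_ofReal_rpow_neg_half_mul {s : ℝ} (hs : 0 < s) (l : ℝ) (x : ℝ≥0∞) :
    (ENNReal.ofReal (s ^ (-(1 / 2) : ℝ) * l ^ 2) * x) ^ 2 =
      ENNReal.ofReal (l ^ 4) * (ENNReal.ofReal s⁻¹ * x ^ 2) := by
  have h : (s ^ (-(1 / 2) : ℝ)) ^ 2 = s⁻¹ := by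
    rw [← Real.rpow_natCast, ← Real.rpow_mul hs.le]
    norm_num
    exact Real.rpow_neg_one s
  rw [mul_pow, ← ENNReal.ofReal_pow (by positivity), mul_pow, h, ← mul_assoc,
    ← ENNReal.ofReal_mul (by positivity)]
  congr 2
  ring

lemma sq_max (a b : ℝ≥0∞) : max a b ^ 2 = max (a ^ 2) (b ^ 2) :=
  (pow_left_mono 2 : Monotone fun x : ℝ≥0∞ => x ^ 2).map_max

lemma sq_iSup (u : ℕ → ℝ≥0∞) : (⨆ k, u k) ^ 2 = ⨆ k, u k ^ 2 := by
  refine le_antisymm ?_ (iSup_le fun k => by gcongr; exact le_iSup u k)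
  have := (ENNReal.orderIsoRpow 2 (by norm_num)).map_iSup u
  simp only [ENNReal.orderIsoRpow_apply] at this
  have e : ∀ x : ℝ≥0∞, x ^ (2:ℝ) = x ^ 2 := fun x => by exact_mod_cast ENNReal.rpow_natCast x 2
  simp only [e] at this
  exact this.le

lemma normY_sq {κ₀ : ℝ} (hκ : 0 < κ₀) (f : ℝ → ℂ) :
    normY κ₀ f ^ 2 = max (lowEnergy κ₀ f)
      (⨆ k : ℕ, ENNReal.ofReal (Real.log (2 * 2 ^ k) ^ 4) * dyadicEnergy κ₀ f k) := by
  rw [normY, sq_max, sq_iSup]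
  congr 1
  · have := sq_ofReal_rpow_neg_half_mul hκ 1 (lowFreqNorm κ₀ f)
    simpa [lowEnergy] using this
  · refine iSup_congr fun k => ?_
    rw [sq_ofReal_rpow_neg_half_mul (by positivity), dyadicEnergy]

lemma normY_sq_le {κ₀ : ℝ} (hκ : 0 < κ₀) (f : ℝ → ℂ) : normY κ₀ f ^ 2 ≤ specY κ₀ f := by
  rw [normY_sq hκ, specY]
  gcongr with k
  exact ofReal_log_pow_le k 4

lemma specY_le {κ₀ : ℝ} (hκ : 0 < κ₀) (f : ℝ → ℂ) : specY κ₀ f ≤ 16 * normY κ₀ f ^ 2 := by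
  rw [normY_sq hκ, specY]
  refine max_le ?_ (iSup_le fun k => ?_)
  · exact (le_max_left _ _).trans (le_mul_of_one_le_left zero_le (by norm_num))
  · refine (mul_le_mul_left (le_ofReal_log_pow k 4) _).trans ?_
    rw [mul_assoc]
    refine mul_le_mul' (by norm_num) ((le_iSup (fun k : ℕ =>
      ENNReal.ofReal (Real.log (2 * 2 ^ k) ^ 4) * dyadicEnergy κ₀ f k) k).trans (le_max_right _ _))

/-! ### Finiteness and comparability in time. -/

lemma lintegral_fourierHat_sq (f : ℝ → ℂ) :
    ∫⁻ ξ, ‖fourierHat f ξ‖ₑ ^ 2 = eLpNorm (𝓕 f) 2 volume ^ 2 := by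
  have h := lintegral_fourier_eq f (fun _ => 1)
  simp only [one_mul] at h
  rw [← h, eLpNorm_two_sq]

lemma lowEnergy_le (κ₀ : ℝ) (f : ℝ → ℂ) :
    lowEnergy κ₀ f ≤ ENNReal.ofReal κ₀⁻¹ * eLpNorm (𝓕 f) 2 volume ^ 2 := by
  rw [lowEnergy, lowFreqNorm, eLpNorm_two_sq, ← lintegral_fourierHat_sq]
  gcongr
  exact Measure.restrict_le_self

lemma dyadicEnergy_le {κ₀ : ℝ} (hκ : 0 < κ₀) (f : ℝ → ℂ) (k : ℕ) :
    dyadicEnergy κ₀ f k ≤ 2⁻¹ ^ k * (ENNReal.ofReal κ₀⁻¹ * eLpNorm (𝓕 f) 2 volume ^ 2) := by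
  rw [dyadicEnergy, dyadicNorm, eLpNorm_two_sq, ← lintegral_fourierHat_sq, mul_inv,
    ENNReal.ofReal_mul (by positivity), ← inv_pow, ← one_div (2:ℝ), ← inv_two_pow_eq, ← mul_assoc,
    mul_comm (2⁻¹ ^ k)]
  gcongr
  exact Measure.restrict_le_self

lemma specX_le_eLpNorm {κ₀ : ℝ} (hκ : 0 < κ₀) (f : ℝ → ℂ) :
    specX κ₀ f ≤ 2 * geomConst * ENNReal.ofReal κ₀⁻¹ * eLpNorm (𝓕 f) 2 volume ^ 2 := by
  set E := ENNReal.ofReal κ₀⁻¹ * eLpNorm (𝓕 f) 2 volume ^ 2 with hE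
  have h1 : lowEnergy κ₀ f ≤ geomConst * E :=
    (lowEnergy_le κ₀ f).trans (le_mul_of_one_le_left zero_le one_le_geomConst)
  have h2 : ∑' k : ℕ, ((k : ℝ≥0∞) + 1) ^ 3 * dyadicEnergy κ₀ f k ≤ geomConst * E := by
    rw [geomConst, ← ENNReal.tsum_mul_right]
    refine ENNReal.tsum_le_tsum fun k => ?_
    calc _ ≤ ((k : ℝ≥0∞) + 1) ^ 5 * (2⁻¹ ^ k * E) := by
          gcongr
          · exact one_le_natCast_add_one k
          · norm_num
          · exact dyadicEnergy_le hκ f k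
      _ = _ := by ring
  calc specX κ₀ f ≤ geomConst * E + geomConst * E := add_le_add h1 h2
    _ = _ := by rw [hE]; ring

lemma specY_le_eLpNorm {κ₀ : ℝ} (hκ : 0 < κ₀) (f : ℝ → ℂ) :
    specY κ₀ f ≤ 2 * geomConst * ENNReal.ofReal κ₀⁻¹ * eLpNorm (𝓕 f) 2 volume ^ 2 := by
  set E := ENNReal.ofReal κ₀⁻¹ * eLpNorm (𝓕 f) 2 volume ^ 2 with hE
  have h1 : lowEnergy κ₀ f ≤ geomConst * E :=
    (lowEnergy_le κ₀ f).trans (le_mul_of_one_le_left zero_le one_le_geomConst)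
  have h2 : ∀ k : ℕ, ((k : ℝ≥0∞) + 1) ^ 4 * dyadicEnergy κ₀ f k ≤ geomConst * E := fun k => by
    calc _ ≤ ((k : ℝ≥0∞) + 1) ^ 4 * (2⁻¹ ^ k * E) := by gcongr; exact dyadicEnergy_le hκ f k
      _ = ((k : ℝ≥0∞) + 1) ^ 4 * 2⁻¹ ^ k * E := by ring
      _ ≤ _ := by gcongr; exact geomConst_term_le' (by norm_num) k
  calc specY κ₀ f ≤ geomConst * E := max_le h1 (iSup_le h2)
    _ ≤ geomConst * E + geomConst * E := le_add_self
    _ = _ := by rw [hE]; ring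

lemma setLIntegral_enorm_sq_le_of_add {F G D : ℝ → ℂ} (hG : Continuous G)
    (h : ∀ ξ, ‖F ξ‖ₑ ≤ ‖G ξ‖ₑ + ‖D ξ‖ₑ) (S : Set ℝ) :
    ∫⁻ ξ in S, ‖F ξ‖ₑ ^ 2 ≤ 3 * (∫⁻ ξ in S, ‖G ξ‖ₑ ^ 2) + 3 * ∫⁻ ξ in S, ‖D ξ‖ₑ ^ 2 := by
  rw [← mul_add, ← lintegral_add_left (by fun_prop), ← lintegral_const_mul' _ _ (by simp)]
  refine lintegral_mono fun ξ => ?_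
  calc ‖F ξ‖ₑ ^ 2 ≤ (‖G ξ‖ₑ + ‖D ξ‖ₑ + 0) ^ 2 := by gcongr; simpa using h ξ
    _ ≤ _ := by simpa using ENNReal.add_three_sq_le ‖G ξ‖ₑ ‖D ξ‖ₑ 0

lemma lowEnergy_le_of_add {f g d : ℝ → ℂ} (hg : Continuous (fourierHat g))
    (h : ∀ ξ, ‖fourierHat f ξ‖ₑ ≤ ‖fourierHat g ξ‖ₑ + ‖fourierHat d ξ‖ₑ) (κ₀ : ℝ) :
    lowEnergy κ₀ f ≤ 3 * lowEnergy κ₀ g + 3 * lowEnergy κ₀ d := by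
  simp only [lowEnergy, lowFreqNorm, eLpNorm_two_sq]
  refine (mul_le_mul_right (setLIntegral_enorm_sq_le_of_add hg h _) _).trans_eq ?_
  ring

lemma dyadicEnergy_le_of_add {f g d : ℝ → ℂ} (hg : Continuous (fourierHat g))
    (h : ∀ ξ, ‖fourierHat f ξ‖ₑ ≤ ‖fourierHat g ξ‖ₑ + ‖fourierHat d ξ‖ₑ) (κ₀ : ℝ) (k : ℕ) :
    dyadicEnergy κ₀ f k ≤ 3 * dyadicEnergy κ₀ g k + 3 * dyadicEnergy κ₀ d k := by
  simp only [dyadicEnergy, dyadicNorm, eLpNorm_two_sq]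
  refine (mul_le_mul_right (setLIntegral_enorm_sq_le_of_add hg h _) _).trans_eq ?_
  ring

lemma specX_le_of_add {f g d : ℝ → ℂ} (hg : Continuous (fourierHat g))
    (h : ∀ ξ, ‖fourierHat f ξ‖ₑ ≤ ‖fourierHat g ξ‖ₑ + ‖fourierHat d ξ‖ₑ) (κ₀ : ℝ) : specX κ₀ f ≤ 3 * specX κ₀ g + 3 * specX κ₀ d := by
  calc specX κ₀ f ≤ (3 * lowEnergy κ₀ g + 3 * lowEnergy κ₀ d) + ∑' k : ℕ, ((k : ℝ≥0∞) + 1) ^ 3 *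
        (3 * dyadicEnergy κ₀ g k + 3 * dyadicEnergy κ₀ d k) :=
        add_le_add (lowEnergy_le_of_add hg h κ₀) (ENNReal.tsum_le_tsum fun k =>
          mul_le_mul_right (dyadicEnergy_le_of_add hg h κ₀ k) _)
    _ = _ := by
        simp only [mul_add, ENNReal.tsum_add, mul_left_comm _ (3 : ℝ≥0∞), ENNReal.tsum_mul_left,
          specX]
        ring

lemma specY_le_of_add {f g d : ℝ → ℂ} (hg : Continuous (fourierHat g))
    (h : ∀ ξ, ‖fourierHat f ξ‖ₑ ≤ ‖fourierHat g ξ‖ₑ + ‖fourierHat d ξ‖ₑ) (κ₀ : ℝ) : specY κ₀ f ≤ 3 * specY κ₀ g + 3 * specY κ₀ d := by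
  refine max_le ((lowEnergy_le_of_add hg h κ₀).trans ?_) (iSup_le fun k => ?_)
  · gcongr <;> exact le_max_left _ _
  · have hk : ∀ e : ℝ → ℂ, ((k : ℝ≥0∞) + 1) ^ 4 * dyadicEnergy κ₀ e k ≤ specY κ₀ e := fun e =>
      (le_iSup (fun k : ℕ => ((k : ℝ≥0∞) + 1) ^ 4 * dyadicEnergy κ₀ e k) k).trans (le_max_right _ _)
    calc _ ≤ ((k : ℝ≥0∞) + 1) ^ 4 * (3 * dyadicEnergy κ₀ g k + 3 * dyadicEnergy κ₀ d k) :=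
          mul_le_mul_right (dyadicEnergy_le_of_add hg h κ₀ k) _
      _ = 3 * (((k : ℝ≥0∞) + 1) ^ 4 * dyadicEnergy κ₀ g k) +
          3 * (((k : ℝ≥0∞) + 1) ^ 4 * dyadicEnergy κ₀ d k) := by ring
      _ ≤ _ := by gcongr <;> exact hk _

lemma continuous_fourierHat {f : ℝ → ℂ} (hf : Integrable f) : Continuous (fourierHat f) := by
  have : fourierHat f = fun ξ => ((1 / Real.sqrt (2 * Real.pi) : ℝ) : ℂ) * 𝓕 f (ξ / (2 * Real.pi)) :=
    funext (fourierHat_eq f)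
  rw [this]
  exact continuous_const.mul ((continuous_fourier hf).comp (by fun_prop))

lemma fourierHat_sub {f g : ℝ → ℂ} (hf : Integrable f) (hg : Integrable g) (ξ : ℝ) :
    fourierHat (fun x => f x - g x) ξ = fourierHat f ξ - fourierHat g ξ := by
  simp only [fourierHat_eq, fourier_sub_apply hf hg]
  ring

lemma enorm_fourierHat_le_sub {f g : ℝ → ℂ} (hf : Integrable f) (hg : Integrable g) (ξ : ℝ) :
    ‖fourierHat f ξ‖ₑ ≤ ‖fourierHat g ξ‖ₑ + ‖fourierHat (fun x => f x - g x) ξ‖ₑ ∧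
    ‖fourierHat g ξ‖ₑ ≤ ‖fourierHat f ξ‖ₑ + ‖fourierHat (fun x => f x - g x) ξ‖ₑ := by
  rw [fourierHat_sub hf hg]
  set a := fourierHat f ξ
  set b := fourierHat g ξ
  refine ⟨by simpa using enorm_add_le b (a - b), ?_⟩
  rw [← enorm_neg (a - b), neg_sub]
  simpa using enorm_add_le a (b - a)

lemma tendsto_const_mul_eLpNorm_fourier_sub {q : ℝ → 𝓢(ℝ, ℂ)} (hq : Continuous q) {c : ℝ≥0∞}
    (hc : c ≠ ⊤) (t : ℝ) :
    Filter.Tendsto (fun s => c * eLpNorm (𝓕 fun x => q s x - q t x) 2 volume ^ 2) (nhds t)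
      (nhds 0) := by
  have h := (ENNReal.Tendsto.pow (n := 2) (tendsto_eLpNorm_fourier_sub hq t))
  simpa using ENNReal.Tendsto.const_mul h (Or.inr hc)

/-- Comparability up to a factor 3 and a small additive error replaces continuity. It treats the
supremum and the sum uniformly and is all the continuity argument uses. -/
lemma eventually_spec_comparable {q : ℝ → 𝓢(ℝ, ℂ)} (hq : Continuous q) {N : (ℝ → ℂ) → ℝ≥0∞}
    {c : ℝ≥0∞} (hc : c ≠ ⊤) (hN : ∀ f, N f ≤ c * eLpNorm (𝓕 f) 2 volume ^ 2)
    (hadd : ∀ f g d : ℝ → ℂ, Continuous (fourierHat g) →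
      (∀ ξ, ‖fourierHat f ξ‖ₑ ≤ ‖fourierHat g ξ‖ₑ + ‖fourierHat d ξ‖ₑ) →
      N f ≤ 3 * N g + 3 * N d) (t : ℝ) {ε : ℝ≥0∞} (hε : ε ≠ 0) :
    ∀ᶠ s in nhds t, N (q s) ≤ 3 * N (q t) + ε ∧ N (q t) ≤ 3 * N (q s) + ε := by
  have h := tendsto_const_mul_eLpNorm_fourier_sub hq (c := 3 * c)
    (ENNReal.mul_ne_top (by simp) hc) t
  filter_upwards [h.eventually_le_const (pos_iff_ne_zero.2 hε)] with s hs
  have hd : 3 * N (fun x => q s x - q t x) ≤ ε := by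
    refine le_trans ?_ hs
    rw [mul_assoc]
    gcongr
    exact hN _
  have hi := fun r => (q r).integrable (μ := volume)
  exact ⟨(hadd _ _ _ (continuous_fourierHat (hi t))
      fun ξ => (enorm_fourierHat_le_sub (hi s) (hi t) ξ).1).trans (by gcongr),
    (hadd _ _ _ (continuous_fourierHat (hi s))
      fun ξ => (enorm_fourierHat_le_sub (hi s) (hi t) ξ).2).trans (by gcongr)⟩

/-! ### The continuity argument. -/

/-- A continuity argument: a locally comparable quantity that satisfies a quadratic inequality as
long as it has remained below `η` stays comparable to its small initial value. -/
lemma bootstrap {N : ℝ → ℝ≥0∞} {C η : ℝ≥0∞} (hη0 : η ≠ 0) (hη1 : η ≤ 1) (hCη : C * η ≤ 2⁻¹)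
    (hstep : ∀ t, (∀ s ∈ Set.uIcc 0 t, N s ≤ η) → N t ≤ C * (N 0 + N 0 ^ 2 + N t ^ 2))
    (hcont : ∀ t, ∀ ε : ℝ≥0∞, ε ≠ 0 →
      ∀ᶠ s in nhds t, N s ≤ 3 * N t + ε ∧ N t ≤ 3 * N s + ε)
    (h0 : N 0 ≤ η) (hsmall : 4 * C * N 0 ≤ η / 20) (t : ℝ) : N t ≤ 4 * C * N 0 := by
  -- Smallness is required on the whole interval between 0 and t, in either direction of time, since
  -- the almost conservation law is applied on that interval.
  set V : Set ℝ := {t | ∀ s ∈ Set.uIcc 0 t, N s ≤ η}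
  have himp : ∀ t ∈ V, N t ≤ 4 * C * N 0 := fun t ht => by
    have htη : N t ≤ η := ht t Set.right_mem_uIcc
    have hfin : N t ≠ ⊤ := ne_top_of_le_ne_top ENNReal.one_ne_top (htη.trans hη1)
    have h1 : N t ≤ 2 * C * N 0 + 2⁻¹ * N t := by
      calc N t ≤ C * (N 0 + N 0 ^ 2 + N t ^ 2) := hstep t ht
        _ = C * N 0 + C * N 0 * N 0 + C * N t * N t := by ring
        _ ≤ C * N 0 + C * N 0 * 1 + C * η * N t := by gcongr; exact h0.trans hη1
        _ ≤ C * N 0 + C * N 0 * 1 + 2⁻¹ * N t := by gcongr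
        _ = _ := by ring
    have h2 : N t + N t ≤ 4 * C * N 0 + N t := by
      calc N t + N t = 2 * N t := by ring
        _ ≤ 2 * (2 * C * N 0 + 2⁻¹ * N t) := by gcongr
        _ = 4 * C * N 0 + (2 * 2⁻¹) * N t := by ring
        _ = _ := by rw [ENNReal.mul_inv_cancel (by simp) (by simp), one_mul]
    exact (ENNReal.add_le_add_iff_right hfin).1 h2
  have hy0 : η / 20 ≠ 0 := by
    rw [Ne, ENNReal.div_eq_zero_iff]; simp [hη0]
  -- Passing from one point of a ball to its centre and on to another point uses comparability
  -- twice. Starting from η/20 this reaches 13η/20, still within η.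
  have hy : ∀ x, x ≤ η / 20 → 3 * (3 * x + η / 20) + η / 20 ≤ η := fun x hx => by
    calc _ ≤ 3 * (3 * (η / 20) + η / 20) + η / 20 := by gcongr
      _ = 13 * (η / 20) := by ring
      _ ≤ 20 * (η / 20) := by gcongr; norm_num
      _ = η := ENNReal.mul_div_cancel (by simp) (by simp)
  -- The radius transfers membership in V between any two points of the ball, so V is open and
  -- closed at once.
  have hloc : ∀ t, ∃ r > 0, ∀ t₁ ∈ Metric.ball t r, ∀ t₂ ∈ Metric.ball t r, t₁ ∈ V → t₂ ∈ V := by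
    intro t
    obtain ⟨r, hr, hball⟩ := Metric.eventually_nhds_iff_ball.1 (hcont t _ hy0)
    refine ⟨r, hr, fun t₁ h1 t₂ h2 hV s hs => ?_⟩
    rcases Set.uIcc_subset_uIcc_union_uIcc (b := t₁) hs with hs | hs
    · exact hV s hs
    · have hsb : s ∈ Metric.ball t r :=
        ((convex_ball t r).ordConnected.uIcc_subset h1 h2) hs
      have hN1 := (himp t₁ hV).trans hsmall
      calc N s ≤ 3 * N t + η / 20 := (hball s hsb).1
        _ ≤ 3 * (3 * N t₁ + η / 20) + η / 20 := by gcongr; exact (hball t₁ h1).2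
        _ ≤ η := hy _ hN1
  have hV : IsClopen V := by
    constructor
    · refine isOpen_compl_iff.1 (Metric.isOpen_iff.2 fun t ht => ?_)
      obtain ⟨r, hr, h⟩ := hloc t
      exact ⟨r, hr, fun s hs hsV => ht (h s hs t (Metric.mem_ball_self hr) hsV)⟩
    · refine Metric.isOpen_iff.2 fun t ht => ?_
      obtain ⟨r, hr, h⟩ := hloc t
      exact ⟨r, hr, fun s hs => h t (Metric.mem_ball_self hr) s hs ht⟩
  have h0V : (0 : ℝ) ∈ V := fun s hs => by
    rw [Set.uIcc_self, Set.mem_singleton_iff] at hs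
    rw [hs]; exact h0
  have := hV.eq_univ ⟨0, h0V⟩
  exact himp t (this ▸ Set.mem_univ t)

/-! ### Almost conservation of the squared norms. -/

section almostConservation

variable {ε κ₀ : ℝ} {q : ℝ → 𝓢(ℝ, ℂ)} {v : ℝ → ℝ → ℂ} {J : Set ℝ} {s t : ℝ}

/-- The constant in the almost conservation laws for `specX` and `specY`. -/
def consConst : ℝ≥0∞ := 663552 * geomConst ^ 2

lemma wnorm_wK_le_of_sq_le {x : ℝ≥0∞} {m : ℕ}
    (h : ((m : ℝ≥0∞) + 1) * x ^ 2 ≤ ENNReal.ofReal (1 / 100) ^ 2) : x ≤ ENNReal.ofReal (1 / 100) := by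
  refine (ENNReal.pow_le_pow_left_iff two_ne_zero).1 (le_trans ?_ h)
  exact le_mul_of_one_le_left zero_le (one_le_natCast_add_one m)

lemma specY_bounds (f : ℝ → ℂ) : lowEnergy κ₀ f ≤ specY κ₀ f ∧
    ∀ k : ℕ, ((k : ℝ≥0∞) + 1) ^ 4 * dyadicEnergy κ₀ f k ≤ specY κ₀ f :=
  ⟨le_max_left _ _, fun k => (le_iSup (fun k : ℕ => ((k : ℝ≥0∞) + 1) ^ 4 * dyadicEnergy κ₀ f k) k).trans
    (le_max_right _ _)⟩

lemma specY_almost_conserved (hε : |ε| = 1) (hκ : 0 < κ₀) (hflow : ∀ κ, IsLaxFlow ε κ q v)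
    (hJ : Convex ℝ J) {η : ℝ≥0∞} (hη : 12 * geomConst * η ≤ ENNReal.ofReal (1 / 100) ^ 2)
    (hsmall : ∀ t ∈ J, specY κ₀ (q t) ≤ η) (hs : s ∈ J) (ht : t ∈ J) :
    specY κ₀ (q t) ≤
      consConst * (specY κ₀ (q s) + specY κ₀ (q s) ^ 2 + specY κ₀ (q t) ^ 2) := by
  have hWK : ∀ (f : ℝ → ℂ) (m : ℕ), ((m : ℝ≥0∞) + 1) * wnorm (wK (2 * (κ₀ * 2 ^ m))) (𝓕 f) ^ 2 ≤
      12 * geomConst * specY κ₀ f := fun f m =>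
    (mul_le_mul_right (wnorm_wK_sq_le_dyadic hκ f m) _).trans
      (mul_wK_le_of_sup (specY_bounds f).1 (specY_bounds f).2 m)
  have hWH : ∀ (f : ℝ → ℂ) (m : ℕ), ((m : ℝ≥0∞) + 1) ^ 3 *
      wnorm (wH (2 * (κ₀ * 2 ^ m))) (𝓕 f) ^ 2 ≤ 3 * geomConst * specY κ₀ f := fun f m =>
    (mul_le_mul_right (wnorm_wH_sq_le_dyadic hκ f m) _).trans
      (pow_mul_wH_le_of_sup (specY_bounds f).1 (specY_bounds f).2 m)
  have hA : ∀ (f : ℝ → ℂ) (m : ℕ), ((m : ℝ≥0∞) + 1) ^ 4 * quadEnergy (κ₀ * 2 ^ m) f ≤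
      5 * geomConst * specY κ₀ f := fun f m =>
    (mul_le_mul_right (quadEnergy_le_dyadic hκ f m) _).trans
      (pow_mul_quad_le_of_sup (specY_bounds f).1 (specY_bounds f).2 m)
  have hG := one_le_geomConst
  have hmain : ∀ m : ℕ, ((m : ℝ≥0∞) + 1) ^ 4 * (4 * quadEnergy (κ₀ * 2 ^ m) (q t)) ≤
      consConst * (specY κ₀ (q s) + specY κ₀ (q s) ^ 2 + specY κ₀ (q t) ^ 2) := fun m => by
    have h := (hflow (κ₀ * 2 ^ m)).quadEnergy_le hε (by positivity) hJ
      (fun t ht => wnorm_wK_le_of_sq_le ((hWK (q t) m).trans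
        ((mul_le_mul_right (hsmall t ht) _).trans hη))) hs ht
    -- The power 4 is split as 3 + 1 between the two factors. Both are bounded by the squared norm
    -- itself, so the quartic error becomes its square.
    have hQ : ∀ f : ℝ → ℂ, ((m : ℝ≥0∞) + 1) ^ 4 * (wnorm (wH (2 * (κ₀ * 2 ^ m))) (𝓕 f) ^ 2 *
        wnorm (wK (2 * (κ₀ * 2 ^ m))) (𝓕 f) ^ 2) ≤ 36 * geomConst ^ 2 * specY κ₀ f ^ 2 := fun f => by
      calc _ = (((m : ℝ≥0∞) + 1) ^ 3 * wnorm (wH (2 * (κ₀ * 2 ^ m))) (𝓕 f) ^ 2) *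
            (((m : ℝ≥0∞) + 1) * wnorm (wK (2 * (κ₀ * 2 ^ m))) (𝓕 f) ^ 2) := by ring
        _ ≤ (3 * geomConst * specY κ₀ f) * (12 * geomConst * specY κ₀ f) :=
          mul_le_mul' (hWH f m) (hWK f m)
        _ = _ := by ring
    calc _ ≤ _ := mul_le_mul_right (mul_le_mul_right h 4) _
      _ = 4 * (((m : ℝ≥0∞) + 1) ^ 4 * quadEnergy (κ₀ * 2 ^ m) (q s)) +
          18432 * (((m : ℝ≥0∞) + 1) ^ 4 * (wnorm (wH (2 * (κ₀ * 2 ^ m))) (𝓕 (q s : ℝ → ℂ)) ^ 2 *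
            wnorm (wK (2 * (κ₀ * 2 ^ m))) (𝓕 (q s : ℝ → ℂ)) ^ 2)) +
          18432 * (((m : ℝ≥0∞) + 1) ^ 4 * (wnorm (wH (2 * (κ₀ * 2 ^ m))) (𝓕 (q t : ℝ → ℂ)) ^ 2 *
            wnorm (wK (2 * (κ₀ * 2 ^ m))) (𝓕 (q t : ℝ → ℂ)) ^ 2)) := by ring
      _ ≤ 4 * (5 * geomConst * specY κ₀ (q s)) +
          18432 * (36 * geomConst ^ 2 * specY κ₀ (q s) ^ 2) +
          18432 * (36 * geomConst ^ 2 * specY κ₀ (q t) ^ 2) :=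
          add_le_add (add_le_add (mul_le_mul_right (hA _ m) _) (mul_le_mul_right (hQ _) _))
            (mul_le_mul_right (hQ _) _)
      _ ≤ 663552 * (geomConst * geomConst * specY κ₀ (q s)) +
          18432 * (36 * geomConst ^ 2 * specY κ₀ (q s) ^ 2) +
          18432 * (36 * geomConst ^ 2 * specY κ₀ (q t) ^ 2) := by
          refine add_le_add (add_le_add ?_ le_rfl) le_rfl
          calc _ = 20 * (1 * geomConst * specY κ₀ (q s)) := by ring
            _ ≤ _ := by gcongr; norm_num
      _ = _ := by rw [consConst]; ring
  refine max_le ?_ (iSup_le fun m => ?_)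
  -- The low frequencies are seen by the energy with κ = κ₀, that is m = 0.
  · have := hmain 0
    simp only [Nat.cast_zero, zero_add, one_pow, one_mul, pow_zero, mul_one] at this
    exact (lowEnergy_le_quadEnergy hκ (q t)).trans this
  · exact (mul_le_mul_right (dyadicEnergy_le_quadEnergy hκ (q t) m) _).trans (hmain m)

lemma specX_almost_conserved (hε : |ε| = 1) (hκ : 0 < κ₀) (hflow : ∀ κ, IsLaxFlow ε κ q v)
    (hJ : Convex ℝ J) {η : ℝ≥0∞} (hη : 12 * geomConst * η ≤ ENNReal.ofReal (1 / 100) ^ 2)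
    (hsmall : ∀ t ∈ J, specX κ₀ (q t) ≤ η) (hs : s ∈ J) (ht : t ∈ J) :
    specX κ₀ (q t) ≤
      consConst * (specX κ₀ (q s) + specX κ₀ (q s) ^ 2 + specX κ₀ (q t) ^ 2) := by
  have hWK : ∀ (f : ℝ → ℂ) (m : ℕ), ((m : ℝ≥0∞) + 1) * wnorm (wK (2 * (κ₀ * 2 ^ m))) (𝓕 f) ^ 2 ≤
      4 * geomConst * specX κ₀ f := fun f m =>
    (mul_le_mul_right (wnorm_wK_sq_le_dyadic hκ f m) _).trans (mul_wK_le_of_sum _ _ m)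
  have hWH : ∀ f : ℝ → ℂ, ∑' m : ℕ, ((m : ℝ≥0∞) + 1) ^ 2 *
      wnorm (wH (2 * (κ₀ * 2 ^ m))) (𝓕 f) ^ 2 ≤ 2 * geomConst * specX κ₀ f := fun f =>
    (ENNReal.tsum_le_tsum fun m => mul_le_mul_right (wnorm_wH_sq_le_dyadic hκ f m) _).trans
      (tsum_sq_mul_wH_le _ _)
  have hA : ∀ f : ℝ → ℂ, ∑' m : ℕ, ((m : ℝ≥0∞) + 1) ^ 3 * quadEnergy (κ₀ * 2 ^ m) f ≤
      4 * geomConst * specX κ₀ f := fun f =>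
    (ENNReal.tsum_le_tsum fun m => mul_le_mul_right (quadEnergy_le_dyadic hκ f m) _).trans
      (tsum_cube_mul_quad_le _ _)
  have hG := one_le_geomConst
  -- The power 3 is split as 2 + 1: the `wK` factor is bounded uniformly in m, and the `wH` factor
  -- is summed.
  have hQ : ∀ f : ℝ → ℂ, ∑' m : ℕ, ((m : ℝ≥0∞) + 1) ^ 3 *
      (wnorm (wH (2 * (κ₀ * 2 ^ m))) (𝓕 f) ^ 2 * wnorm (wK (2 * (κ₀ * 2 ^ m))) (𝓕 f) ^ 2) ≤
      8 * geomConst ^ 2 * specX κ₀ f ^ 2 := fun f => by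
    calc _ ≤ ∑' m : ℕ, (((m : ℝ≥0∞) + 1) ^ 2 * wnorm (wH (2 * (κ₀ * 2 ^ m))) (𝓕 f) ^ 2) *
          (4 * geomConst * specX κ₀ f) := ENNReal.tsum_le_tsum fun m => by
            calc _ = (((m : ℝ≥0∞) + 1) ^ 2 * wnorm (wH (2 * (κ₀ * 2 ^ m))) (𝓕 f) ^ 2) *
                (((m : ℝ≥0∞) + 1) * wnorm (wK (2 * (κ₀ * 2 ^ m))) (𝓕 f) ^ 2) := by ring
              _ ≤ _ := mul_le_mul_right (hWK f m) _
      _ ≤ (2 * geomConst * specX κ₀ f) * (4 * geomConst * specX κ₀ f) := by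
          rw [ENNReal.tsum_mul_right]
          exact mul_le_mul_left (hWH f) _
      _ = _ := by ring
  have hsum : ∑' m : ℕ, ((m : ℝ≥0∞) + 1) ^ 3 * quadEnergy (κ₀ * 2 ^ m) (q t) ≤
      4 * geomConst * specX κ₀ (q s) + 4608 * (8 * geomConst ^ 2 * specX κ₀ (q s) ^ 2) +
        4608 * (8 * geomConst ^ 2 * specX κ₀ (q t) ^ 2) := by
    refine le_trans (ENNReal.tsum_le_tsum fun m => mul_le_mul_right
      ((hflow (κ₀ * 2 ^ m)).quadEnergy_le hε (by positivity) hJ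
      (fun t ht => wnorm_wK_le_of_sq_le ((hWK (q t) m).trans (le_trans ?_ hη))) hs ht) _) ?_
    · gcongr
      · norm_num
      · exact hsmall t ht
    · simp only [mul_add, ENNReal.tsum_add, mul_left_comm _ (4608 : ℝ≥0∞), ENNReal.tsum_mul_left]
      gcongr
      · exact hA _
      · exact hQ _
      · exact hQ _
  have hlow : lowEnergy κ₀ (q t) ≤
      4 * ∑' m : ℕ, ((m : ℝ≥0∞) + 1) ^ 3 * quadEnergy (κ₀ * 2 ^ m) (q t) := by
    refine (lowEnergy_le_quadEnergy hκ (q t)).trans (mul_le_mul_right ?_ _)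
    have := ENNReal.le_tsum (f := fun m : ℕ => ((m : ℝ≥0∞) + 1) ^ 3 *
      quadEnergy (κ₀ * 2 ^ m) (q t)) 0
    simpa only [Nat.cast_zero, zero_add, one_pow, one_mul, pow_zero, mul_one] using this
  have hdy : ∑' m : ℕ, ((m : ℝ≥0∞) + 1) ^ 3 * dyadicEnergy κ₀ (q t) m ≤
      4 * ∑' m : ℕ, ((m : ℝ≥0∞) + 1) ^ 3 * quadEnergy (κ₀ * 2 ^ m) (q t) := by
    rw [← ENNReal.tsum_mul_left]
    refine ENNReal.tsum_le_tsum fun m => ?_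
    rw [mul_left_comm]
    exact mul_le_mul_right (dyadicEnergy_le_quadEnergy hκ (q t) m) _
  calc specX κ₀ (q t) ≤ _ := add_le_add hlow hdy
    _ = 8 * ∑' m : ℕ, ((m : ℝ≥0∞) + 1) ^ 3 * quadEnergy (κ₀ * 2 ^ m) (q t) := by ring
    _ ≤ 8 * (4 * (geomConst * 1) * specX κ₀ (q s) +
        4608 * (8 * geomConst ^ 2 * specX κ₀ (q s) ^ 2) +
        4608 * (8 * geomConst ^ 2 * specX κ₀ (q t) ^ 2)) := by rw [mul_one]; gcongr
    _ ≤ 8 * (82944 * (geomConst * geomConst) * specX κ₀ (q s) +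
        4608 * (18 * geomConst ^ 2 * specX κ₀ (q s) ^ 2) +
        4608 * (18 * geomConst ^ 2 * specX κ₀ (q t) ^ 2)) := by
          gcongr <;> norm_num
    _ = _ := by rw [consConst]; ring

end almostConservation

/-! ### Choice of constants and conclusion. -/

lemma one_le_consConst : 1 ≤ consConst := by
  rw [consConst]
  exact one_le_mul_of_one_le_of_one_le (by norm_num) (one_le_pow₀ one_le_geomConst)

lemma geomConst_le_consConst : geomConst ≤ consConst := by
  calc geomConst = 1 * (1 * geomConst) := by ring
    _ ≤ 663552 * (geomConst * geomConst) := by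
        gcongr
        · norm_num
        · exact one_le_geomConst
    _ = consConst := by rw [consConst]; ring

lemma consConst_ne_top : consConst ≠ ⊤ :=
  ENNReal.mul_ne_top (by simp) (ENNReal.pow_ne_top geomConst_ne_top)

/-- The size up to which the almost conservation laws are used. -/
def smallConst : ℝ≥0∞ := (120000 * consConst)⁻¹

lemma mul_smallConst : 120000 * (consConst * smallConst) = 1 := by
  rw [← mul_assoc, smallConst]
  refine ENNReal.mul_inv_cancel ?_ (ENNReal.mul_ne_top (by simp) consConst_ne_top)
  exact mul_ne_zero (by simp) (zero_lt_one.trans_le one_le_consConst).ne'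

lemma consConst_mul_smallConst_le : consConst * smallConst ≤ 2⁻¹ := by
  rw [ENNReal.le_inv_iff_mul_le, mul_comm, ← mul_smallConst]
  gcongr
  norm_num

lemma smallConst_ne_zero : smallConst ≠ 0 :=
  ENNReal.inv_ne_zero.2 (ENNReal.mul_ne_top (by simp) consConst_ne_top)

lemma smallConst_le_one : smallConst ≤ 1 := by
  rw [← mul_smallConst]
  calc smallConst = 1 * (1 * smallConst) := by ring
    _ ≤ _ := by gcongr <;> first | exact one_le_consConst | norm_num

/-- This requirement dictates the constant 120000 = 12 · 100²: it keeps the `wK` norm below the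
threshold 1/100 of the Riccati theory at every scale. -/
lemma geomConst_mul_smallConst_le :
    12 * geomConst * smallConst ≤ ENNReal.ofReal (1 / 100) ^ 2 := by
  have e : ENNReal.ofReal (1 / 100) ^ 2 = (10000 : ℝ≥0∞)⁻¹ := by
    rw [← ENNReal.ofReal_pow (by norm_num), one_div, inv_pow,
      ENNReal.ofReal_inv_of_pos (by norm_num)]
    norm_num
  rw [e, ENNReal.le_inv_iff_mul_le, ← mul_smallConst]
  calc _ = 120000 * (geomConst * smallConst) := by ring
    _ ≤ _ := by gcongr; exact geomConst_le_consConst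

lemma bounded_of_almost_conserved {q : ℝ → 𝓢(ℝ, ℂ)} {nm N : (ℝ → ℂ) → ℝ≥0∞}
    (hle : ∀ f, nm f ^ 2 ≤ N f) (hge : ∀ f, N f ≤ 16 * nm f ^ 2)
    (hcons : ∀ {J : Set ℝ} {s t : ℝ}, Convex ℝ J → (∀ t ∈ J, N (q t) ≤ smallConst) → s ∈ J →
      t ∈ J → N (q t) ≤ consConst * (N (q s) + N (q s) ^ 2 + N (q t) ^ 2))
    (hcont : ∀ t, ∀ ε : ℝ≥0∞, ε ≠ 0 →
      ∀ᶠ s in nhds t, N (q s) ≤ 3 * N (q t) + ε ∧ N (q t) ≤ 3 * N (q s) + ε)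
    (h0 : nm (q 0) ≤ smallConst / 1280) (t : ℝ) : nm (q t) ≤ 64 * consConst * nm (q 0) := by
  -- The number 1280 is 4 · 16 · 20: the factor 4 and the division by 20 come from `bootstrap`, and
  -- 16 from the comparison of the two forms of the norm.
  have hdiv : 1280 * (smallConst / 1280) = smallConst := ENNReal.mul_div_cancel (by simp) (by simp)
  have hsmall : 4 * consConst * N (q 0) ≤ smallConst / 20 := by
    rw [ENNReal.le_div_iff_mul_le (by simp) (by simp)]
    calc 4 * consConst * N (q 0) * 20
        ≤ 4 * consConst * (16 * (smallConst / 1280) ^ 2) * 20 := by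
          gcongr; exact (hge _).trans (by gcongr)
      _ = (consConst * (1 * (smallConst / 1280))) * (1280 * (smallConst / 1280)) := by ring
      _ ≤ (consConst * (1280 * (smallConst / 1280))) * (1280 * (smallConst / 1280)) := by
          gcongr; norm_num
      _ = (1 * (consConst * smallConst)) * smallConst := by rw [hdiv, one_mul]
      _ ≤ (120000 * (consConst * smallConst)) * smallConst := by gcongr; norm_num
      _ = smallConst := by rw [mul_smallConst, one_mul]
  have h0' : N (q 0) ≤ smallConst := by
    calc N (q 0) = 1 * 1 * N (q 0) := by ring
      _ ≤ 4 * consConst * N (q 0) := by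
          gcongr
          · norm_num
          · exact one_le_consConst
      _ ≤ smallConst / 20 := hsmall
      _ ≤ smallConst := ENNReal.div_le_of_le_mul (le_mul_of_one_le_right zero_le (by norm_num))
  have hb := bootstrap (N := fun t => N (q t)) smallConst_ne_zero smallConst_le_one
    consConst_mul_smallConst_le
    (fun t ht => hcons (convex_uIcc 0 t) ht Set.left_mem_uIcc Set.right_mem_uIcc) hcont h0' hsmall t
  refine (ENNReal.pow_le_pow_left_iff two_ne_zero).1 ?_
  have h1 : (1 : ℝ≥0∞) ≤ 64 * consConst :=
    one_le_mul_of_one_le_of_one_le (by norm_num) one_le_consConst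
  calc nm (q t) ^ 2 ≤ N (q t) := hle _
    _ ≤ 4 * consConst * N (q 0) := hb
    _ ≤ 4 * consConst * (16 * nm (q 0) ^ 2) := by gcongr; exact hge _
    _ = 64 * consConst * 1 * nm (q 0) ^ 2 := by ring
    -- Since 64·`consConst` ≥ 1, one further factor makes the right side a perfect square, so no
    -- root of the constant has to be taken.
    _ ≤ 64 * consConst * (64 * consConst) * nm (q 0) ^ 2 := by gcongr
    _ = _ := by ring

lemma isLaxFlow_of_solution {σ : ℤˣ} {q : ℝ → 𝓢(ℝ, ℂ)}
    (h : IsSchwartzSolutionNLS σ q ∨ IsSchwartzSolutionHmKdV σ q) :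
    Continuous q ∧ ∃ v, ∀ κ, IsLaxFlow ((σ : ℤ) : ℝ) κ q v :=
  h.elim (fun h => ⟨h.continuous, _, fun κ => h.isLaxFlow κ⟩)
    (fun h => ⟨h.continuous, _, fun κ => h.isLaxFlow κ⟩)

lemma specConst_ne_top (κ₀ : ℝ) : 2 * geomConst * ENNReal.ofReal κ₀⁻¹ ≠ ⊤ :=
  ENNReal.mul_ne_top (ENNReal.mul_ne_top (by simp) geomConst_ne_top) ENNReal.ofReal_ne_top

lemma normY_le_of_solution {σ : ℤˣ} {q : ℝ → 𝓢(ℝ, ℂ)}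
    (h : IsSchwartzSolutionNLS σ q ∨ IsSchwartzSolutionHmKdV σ q) {κ₀ : ℝ} (hκ : 0 < κ₀)
    (h0 : normY κ₀ (q 0) ≤ smallConst / 1280) (t : ℝ) :
    normY κ₀ (q t) ≤ 64 * consConst * normY κ₀ (q 0) := by
  obtain ⟨hq, v, hflow⟩ := isLaxFlow_of_solution h
  have hcont : ∀ t, ∀ ε : ℝ≥0∞, ε ≠ 0 → ∀ᶠ s in nhds t,
      specY κ₀ (q s) ≤ 3 * specY κ₀ (q t) + ε ∧ specY κ₀ (q t) ≤ 3 * specY κ₀ (q s) + ε :=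
    fun t _ hε => eventually_spec_comparable hq (specConst_ne_top κ₀)
      (specY_le_eLpNorm hκ) (fun _ _ _ hg h => specY_le_of_add hg h κ₀) t hε
  have hcons : ∀ {J : Set ℝ} {s t : ℝ}, Convex ℝ J → (∀ t ∈ J, specY κ₀ (q t) ≤ smallConst) →
      s ∈ J → t ∈ J → specY κ₀ (q t) ≤
        consConst * (specY κ₀ (q s) + specY κ₀ (q s) ^ 2 + specY κ₀ (q t) ^ 2) :=
    fun hJ hsmall hs ht => specY_almost_conserved (abs_sign_cast σ) hκ hflow hJ
      geomConst_mul_smallConst_le hsmall hs ht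
  exact @bounded_of_almost_conserved q (normY κ₀) (specY κ₀) (normY_sq_le hκ) (specY_le hκ)
    hcons hcont h0 t

lemma normX_le_of_solution {σ : ℤˣ} {q : ℝ → 𝓢(ℝ, ℂ)}
    (h : IsSchwartzSolutionNLS σ q ∨ IsSchwartzSolutionHmKdV σ q) {κ₀ : ℝ} (hκ : 0 < κ₀)
    (h0 : normX κ₀ (q 0) ≤ smallConst / 1280) (t : ℝ) :
    normX κ₀ (q t) ≤ 64 * consConst * normX κ₀ (q 0) := by
  obtain ⟨hq, v, hflow⟩ := isLaxFlow_of_solution h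
  have hcont : ∀ t, ∀ ε : ℝ≥0∞, ε ≠ 0 → ∀ᶠ s in nhds t,
      specX κ₀ (q s) ≤ 3 * specX κ₀ (q t) + ε ∧ specX κ₀ (q t) ≤ 3 * specX κ₀ (q s) + ε :=
    fun t _ hε => eventually_spec_comparable hq (specConst_ne_top κ₀)
      (specX_le_eLpNorm hκ) (fun _ _ _ hg h => specX_le_of_add hg h κ₀) t hε
  have hcons : ∀ {J : Set ℝ} {s t : ℝ}, Convex ℝ J → (∀ t ∈ J, specX κ₀ (q t) ≤ smallConst) →
      s ∈ J → t ∈ J → specX κ₀ (q t) ≤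
        consConst * (specX κ₀ (q s) + specX κ₀ (q s) ^ 2 + specX κ₀ (q t) ^ 2) :=
    fun hJ hsmall hs ht => specX_almost_conserved (abs_sign_cast σ) hκ hflow hJ
      geomConst_mul_smallConst_le hsmall hs ht
  exact @bounded_of_almost_conserved q (normX κ₀) (specX κ₀) (normX_sq_le hκ) (specX_le hκ)
    hcons hcont h0 t

lemma iSup_comparable {u : ℝ → ℝ≥0∞} {C : ℝ} (hC : 1 ≤ C)
    (h : ∀ t, u t ≤ ENNReal.ofReal C * u 0) :
    ENNReal.ofReal C⁻¹ * u 0 ≤ (⨆ t, u t) ∧ (⨆ t, u t) ≤ ENNReal.ofReal C * u 0 := by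
  refine ⟨le_trans ?_ (le_iSup u 0), iSup_le h⟩
  exact mul_le_of_le_one_left zero_le (ENNReal.ofReal_le_one.2 (inv_le_one_of_one_le₀ hC))

end

theorem theorem4p7 :
    ∃ c C : ℝ, 0 < c ∧ 0 < C ∧
      ∀ (σ : ℤˣ) (q : ℝ → 𝓢(ℝ, ℂ)),
        (IsSchwartzSolutionNLS σ q ∨ IsSchwartzSolutionHmKdV σ q) →
        ∀ κ₀ : ℝ, 0 < κ₀ →
          (normY κ₀ (q 0) ≤ ENNReal.ofReal c →
            ENNReal.ofReal C⁻¹ * normY κ₀ (q 0) ≤ (⨆ t : ℝ, normY κ₀ (q t)) ∧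
            (⨆ t : ℝ, normY κ₀ (q t)) ≤ ENNReal.ofReal C * normY κ₀ (q 0)) ∧
          (normX κ₀ (q 0) ≤ ENNReal.ofReal c →
            ENNReal.ofReal C⁻¹ * normX κ₀ (q 0) ≤ (⨆ t : ℝ, normX κ₀ (q t)) ∧
            (⨆ t : ℝ, normX κ₀ (q t)) ≤ ENNReal.ofReal C * normX κ₀ (q 0)) := by
  have hc : smallConst / 1280 ≠ ⊤ :=
    ENNReal.div_ne_top (ne_top_of_le_ne_top ENNReal.one_ne_top smallConst_le_one) (by simp)
  have hc0 : smallConst / 1280 ≠ 0 := ENNReal.div_ne_zero.2 ⟨smallConst_ne_zero, by simp⟩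
  have hC : 64 * consConst ≠ ⊤ := ENNReal.mul_ne_top (by simp) consConst_ne_top
  have hC1 : 1 ≤ (64 * consConst).toReal := by
    rw [← ENNReal.toReal_one]
    exact ENNReal.toReal_mono hC
      (one_le_mul_of_one_le_of_one_le (by norm_num) one_le_consConst)
  refine ⟨(smallConst / 1280).toReal, (64 * consConst).toReal, ENNReal.toReal_pos hc0 hc,
    by linarith, fun σ q h κ₀ hκ => ?_⟩
  rw [ENNReal.ofReal_toReal hc]
  refine ⟨fun h0 => iSup_comparable (u := fun t => normY κ₀ (q t)) hC1 fun t => ?_,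
    fun h0 => iSup_comparable (u := fun t => normX κ₀ (q t)) hC1 fun t => ?_⟩
  · rw [ENNReal.ofReal_toReal hC]
    exact normY_le_of_solution h hκ h0 t
  · rw [ENNReal.ofReal_toReal hC]
    exact normX_le_of_solution h hκ h0 t
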